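/- **Algebraic data.** Let $W$ be a complex vector space of dimension $2$ and $R$ one of dimension $1$; put $Q=R^{\otimes 2}\otimes(\wedge^2W)^{\otimes 3}$. Let $\mathfrak g=\bigoplus_{k=-2}^{2}\mathfrak g_k=(\mathfrak l\oplus\mathbb C\,\mathrm{Id}_V)\ltimes V$ be the graded Lie algebra in which $\mathfrak l$ is simple of type $G_2$ and $V$ is its $7$-dimensional irreducible representation, with $$\mathfrak l_{-2}=Q,\quad \mathfrak l_{-1}=R\otimes \mathrm{Sym}^3W,\quad \mathfrak l_0\oplus\mathbb C\,\mathrm{Id}_V=\mathfrak{gl}(R)\oplus\mathfrak{gl}(W),\quad \mathfrak l_1=\mathfrak l_{-1}^*,\quad \mathfrak l_2=Q^*,$$ $$V_{-1}=W,\quad V_0=R^*\otimes \mathrm{Sym}^2W^*,\quad V_1=Q^*\otimes W,\quad V_k=0\ \text{ for } |k|\ge 2 .$$ So $\mathfrak g_-=\mathfrak g_{-2}\oplus\mathfrak g_{-1}$ with $\mathfrak g_{-2}=Q$ and $\mathfrak g_{-1}=W\oplus(R\otimes\mathrm{Sym}^3W)$; its bracket $\wedge^2\mathfrak g_{-1}\to\mathfrak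 g_{-2}$ has $W$ in its kernel and satisfies $[r\otimes u^3,r\otimes v^3]=r^2\otimes(u\wedge v)^3$. Let $\mathbf G_0=(GL(R)\times GL(W))\ltimes V_0$ be the group with Lie algebra $\mathfrak g_0$, acting on $\mathfrak g$ preserving the gradation and the subspaces $V_k\subset\mathfrak g_k$: the Levi factor acts naturally and $q\in V_0$ acts as $\exp(\mathrm{ad}\,q)=1+\mathrm{ad}\,q$. Let $\mathbb S\subset\mathbb P\mathfrak g_{-1}$ be the surface $\{[c\,w+r\otimes w^3] : c\in\mathbb C,\ r\in R,\ w\in W\}$, which is $\mathbf G_0$-invariant. (For $|k|>2$ put $\mathfrak g_k=0$.) **Setup.** Let $M$ be a connected complex manifold of dimension $7$ and let $\mathcal D\subset TM$ be a holomorphic subbundle of rank $6$ such that the filtration $\mathcal D\subset TM$ is of type $\mathfrak g_-$: for each $x\in M$ the symbol algebra $\mathcal D_x\oplus T_xM/\mathcal D_x$, with the bracket induced by the Lie bracket of local sections of $\mathcal D$, is isomorphic to $\mathfrak g_-$ as a graded Lie algebra. Let $\mathcal A$ be a $\mathbf G_0$-structure subordinate to this filtration, that is, a holomorphic principal $\mathbf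 G_0$-subbundle of the bundle whose fibre at $x$ is the set of graded Lie algebra isomorphisms from $\mathfrak g_-$ to the symbol algebra at $x$. Let $\mathcal C\subset\mathbb P\mathcal D$ be the family of subsets $\mathcal C_x\subset\mathbb P\mathcal D_x$ corresponding to $\mathbb S\subset\mathbb P\mathfrak g_{-1}$ under the elements of $\mathcal A_x$. For each integer $k$ let $$\mathcal V_k=\mathcal A\times^{\mathbf G_0}V_k,\qquad \mathcal G_k=\mathcal A\times^{\mathbf G_0}\mathfrak g_k,\qquad \mathcal L_k=\mathcal G_k/\mathcal V_k$$ be the associated vector bundles on $M$, and put $\mathcal W=\mathcal V_{-1}$, $\mathcal Q=\mathcal L_{-2}$ and $\mathcal R=\mathcal A\times^{\mathbf G_0}R$. **Assumption.** Fix a point $o\in\mathbb P^1$. There is a nonempty Zariski-open subset $M'\subset M$ and, for each $x\in M'$, a nonempty Euclidean open subset $\mathcal W_x^o\subset\mathcal W_x\setminus\{0\}$ such that for each $a\in\mathcal W_x^o$ there is a holomorphic map $f_a:\mathbb P^1\to M$ with $f_a(o)=x$ and: 1. $f_a^*\mathcal Q\cong\mathcal O(1)$; 2. $f_a^*\mathcal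 R\cong\mathcal O(-1)$; 3. $f_a^*\mathcal W$ has a unique line subbundle $f_a^1\mathcal W$ of degree $1$, one has $f_a^*\mathcal W\cong f_a^1\mathcal W\oplus\mathcal O$, and the fibre of $f_a^1\mathcal W$ at $o$ is $\mathbb C a\subset\mathcal W_x$. **Theorem.** Under these hypotheses, for all integers $i,j<0$ and $k\ge i+j+1$, every holomorphic vector bundle homomorphism on $M$ $$(\mathcal V_i\oplus\mathcal L_i)\wedge(\mathcal V_j\oplus\mathcal L_j)\longrightarrow \mathcal V_k\oplus\mathcal L_k$$ is zero. Here $(\mathcal V_i\oplus\mathcal L_i)\wedge(\mathcal V_j\oplus\mathcal L_j)$ is spanned by the products $u\wedge v$ in the second exterior power of $\bigoplus_m(\mathcal V_m\oplus\mathcal L_m)$. -/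

import Mathlib

open scoped Manifold ContDiff

namespace G2Horo

noncomputable section

open MvPolynomial

/-! ### The graded `G₀`-module `𝔤` -/

/-- The plane `W`, with basis `e₀, e₁`. -/
abbrev W := Fin 2 → ℂ

/-- `Sym^d W`: binary forms of degree `d` in the basis vectors `e₀ = X 0`, `e₁ = X 1` of `W`. -/
abbrev SymW (d : ℕ) := homogeneousSubmodule (Fin 2) ℂ d

/-- A vector of `W` seen in `Sym¹ W`, as a polynomial in the basis vectors. -/
def form (w : W) : MvPolynomial (Fin 2) ℂ := ∑ i, C (w i) * X i

lemma form_homog (w : W) : (form w).IsHomogeneous 1 := by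
  apply IsHomogeneous.sum
  intro i _
  exact isHomogeneous_C_mul_X _ _

/-- The power `w ^ d ∈ Sym^d W`. -/
def symPow (d : ℕ) (w : W) : SymW d :=
  ⟨form w ^ d, by simpa using (form_homog w).pow d⟩

/-- The algebra endomorphism of the symmetric algebra of `W` induced by `A : W → W`
(so `e_j ↦ A e_j = ∑ i, A i j e_i`). -/
def subst (A : Matrix (Fin 2) (Fin 2) ℂ) :
    MvPolynomial (Fin 2) ℂ →ₐ[ℂ] MvPolynomial (Fin 2) ℂ :=
  aeval fun j => form fun i => A i j

lemma subst_X (A : Matrix (Fin 2) (Fin 2) ℂ) (j : Fin 2) :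
    subst A (X j) = C (A 0 j) * X 0 + C (A 1 j) * X 1 := by
  simp [subst, form]

lemma subst_homog (A : Matrix (Fin 2) (Fin 2) ℂ) {d : ℕ} {p : MvPolynomial (Fin 2) ℂ}
    (hp : p.IsHomogeneous d) : (subst A p).IsHomogeneous d := by
  simpa [subst] using hp.aeval (fun j => form fun i => A i j) (fun j => form_homog _)

lemma subst_mul (A B : Matrix (Fin 2) (Fin 2) ℂ) : subst (A * B) = (subst A).comp (subst B) := by
  apply MvPolynomial.algHom_ext
  intro j
  simp [subst_X, Matrix.mul_apply, AlgHom.comp_apply]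
  ring

lemma subst_one : subst 1 = AlgHom.id ℂ _ := by
  apply MvPolynomial.algHom_ext
  intro j
  fin_cases j <;> simp [subst_X]

/-- The functor `Sym^d`: the linear action of `A` on `Sym^d W`. -/
def symMap (d : ℕ) : Matrix (Fin 2) (Fin 2) ℂ →* Module.End ℂ (SymW d) where
  toFun A := (subst A).toLinearMap.restrict fun _ hp => subst_homog A hp
  map_one' := by ext p; simp [subst_one]
  map_mul' A B := by
    ext1 p
    apply Subtype.ext
    change subst (A * B) (p : MvPolynomial (Fin 2) ℂ) = subst A (subst B p)
    rw [subst_mul, AlgHom.comp_apply]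

lemma coe_symMap (d : ℕ) (A : Matrix (Fin 2) (Fin 2) ℂ) (p : SymW d) :
    (symMap d A p : MvPolynomial (Fin 2) ℂ) = subst A p := rfl

/-- The partial derivative `∂ᵢ : Sym^(d+1) W → Sym^d W`. -/
def dSym (d : ℕ) (i : Fin 2) : SymW (d + 1) →ₗ[ℂ] SymW d :=
  (pderiv i).toLinearMap.restrict fun _ hp => by
    simpa using IsHomogeneous.pderiv (i := i) hp

lemma pderiv_subst (A : Matrix (Fin 2) (Fin 2) ℂ) (i : Fin 2) (p : MvPolynomial (Fin 2) ℂ) :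
    pderiv i (subst A p) = C (A i 0) * subst A (pderiv 0 p) + C (A i 1) * subst A (pderiv 1 p) := by
  induction p using MvPolynomial.induction_on with
  | C a => simp [subst]
  | add p q hp hq => simp only [map_add, hp, hq]; ring
  | mul_X p j hp =>
    simp only [map_mul, Derivation.leibniz, hp, subst_X, smul_eq_mul, map_add, pderiv_C, pderiv_X]
    fin_cases i <;> fin_cases j <;> simp <;> ring

lemma dSym_symMap (d : ℕ) (A : Matrix (Fin 2) (Fin 2) ℂ) (i : Fin 2) (p : SymW (d + 1)) :
    dSym d i (symMap (d + 1) A p) =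
      A i 0 • symMap d A (dSym d 0 p) + A i 1 • symMap d A (dSym d 1 p) := by
  apply Subtype.ext
  change pderiv i (subst A p) =
    A i 0 • subst A (pderiv 0 (p : MvPolynomial (Fin 2) ℂ))
      + A i 1 • subst A (pderiv 1 (p : MvPolynomial (Fin 2) ℂ))
  rw [pderiv_subst, smul_eq_C_mul, smul_eq_C_mul]

/-- Multiplication by the basis vector `eᵢ : Sym^d W → Sym^(d+1) W`. -/
def mulE (d : ℕ) (i : Fin 2) : SymW d →ₗ[ℂ] SymW (d + 1) :=
  (LinearMap.mulLeft ℂ (X i)).restrict fun p hp => by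
    rw [mem_homogeneousSubmodule] at hp ⊢
    rw [add_comm]
    exact (isHomogeneous_X ℂ i).mul hp

lemma coe_mulE (d : ℕ) (i : Fin 2) (p : SymW d) :
    (mulE d i p : MvPolynomial (Fin 2) ℂ) = X i * (p : MvPolynomial (Fin 2) ℂ) := rfl

lemma symMap_mulE (d : ℕ) (A : Matrix (Fin 2) (Fin 2) ℂ) (i : Fin 2) (p : SymW d) :
    symMap (d + 1) A (mulE d i p) =
      A 0 i • mulE d 0 (symMap d A p) + A 1 i • mulE d 1 (symMap d A p) := by
  apply Subtype.ext
  rw [Submodule.coe_add, Submodule.coe_smul, Submodule.coe_smul, coe_symMap, coe_mulE, coe_mulE,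
    coe_mulE, coe_symMap, map_mul, subst_X, smul_eq_C_mul, smul_eq_C_mul]
  ring

/-- The constant of a form of degree `0`. -/
def const0 : SymW 0 →ₗ[ℂ] ℂ := (lcoeff ℂ 0).comp (Submodule.subtype _)

lemma const0_symMap (A : Matrix (Fin 2) (Fin 2) ℂ) (p : SymW 0) :
    const0 (symMap 0 A p) = const0 p := by
  obtain ⟨p, hp⟩ := p
  rw [mem_homogeneousSubmodule, ← totalDegree_zero_iff_isHomogeneous,
    totalDegree_eq_zero_iff_eq_C] at hp
  change coeff 0 (subst A p) = coeff 0 p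
  rw [hp]
  simp [subst]

/-- The third partial derivative `∂ᵢ∂ⱼ∂ₖ` of a cubic form. -/
def d3 (i j k : Fin 2) : SymW 3 →ₗ[ℂ] ℂ := const0 ∘ₗ dSym 0 i ∘ₗ dSym 1 j ∘ₗ dSym 2 k

lemma d3_symMap (A : Matrix (Fin 2) (Fin 2) ℂ) (i j k : Fin 2) (p : SymW 3) :
    d3 i j k (symMap 3 A p) = ∑ a, ∑ b, ∑ c, A i a * A j b * A k c * d3 a b c p := by
  simp only [d3, LinearMap.comp_apply, dSym_symMap, map_add, map_smul, const0_symMap,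
    Fin.sum_univ_two, smul_eq_mul]
  ring

/-- The bracket `𝔩₋₁ × 𝔩₋₁ → 𝔩₋₂`: the bilinear form with
`[r ⊗ u³, r ⊗ v³] = r² ⊗ (u ∧ v)³`, in the basis `r² ⊗ (e₀ ∧ e₁)³` of `𝔩₋₂`. -/
def omega : SymW 3 →ₗ[ℂ] SymW 3 →ₗ[ℂ] ℂ :=
  (1 / 36 : ℂ) • ((LinearMap.mul ℂ ℂ).compl₁₂ (d3 0 0 0) (d3 1 1 1)
    - 3 • (LinearMap.mul ℂ ℂ).compl₁₂ (d3 0 0 1) (d3 0 1 1)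
    + 3 • (LinearMap.mul ℂ ℂ).compl₁₂ (d3 0 1 1) (d3 0 0 1)
    - (LinearMap.mul ℂ ℂ).compl₁₂ (d3 1 1 1) (d3 0 0 0))

lemma pderiv_comm (i j : Fin 2) (p : MvPolynomial (Fin 2) ℂ) :
    pderiv i (pderiv j p) = pderiv j (pderiv i p) := by
  induction p using MvPolynomial.induction_on with
  | C a => simp
  | add p q hp hq => simp only [map_add, hp, hq]
  | mul_X p k hp =>
    simp only [Derivation.leibniz, map_add, smul_eq_mul, hp]
    fin_cases i <;> fin_cases j <;> fin_cases k <;> simp <;> ring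

lemma d3_comm (i j k : Fin 2) (p : SymW 3) : d3 i j k p = d3 j i k p ∧ d3 i j k p = d3 i k j p := by
  constructor
  · change coeff 0 (pderiv i (pderiv j _)) = coeff 0 (pderiv j (pderiv i _))
    rw [pderiv_comm]
  · change coeff 0 (pderiv i (pderiv j (pderiv k (p : MvPolynomial (Fin 2) ℂ)))) =
      coeff 0 (pderiv i (pderiv k (pderiv j (p : MvPolynomial (Fin 2) ℂ))))
    rw [pderiv_comm j k]

lemma omega_apply (p q : SymW 3) :
    omega p q = (1 / 36) * (d3 0 0 0 p * d3 1 1 1 q - 3 * (d3 0 0 1 p * d3 0 1 1 q)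
      + 3 * (d3 0 1 1 p * d3 0 0 1 q) - d3 1 1 1 p * d3 0 0 0 q) := by
  simp [omega]

lemma omega_symMap (A : Matrix (Fin 2) (Fin 2) ℂ) (p q : SymW 3) :
    omega (symMap 3 A p) (symMap 3 A q) = A.det ^ 3 * omega p q := by
  have h1 (p) : d3 0 1 0 p = d3 0 0 1 p := (d3_comm 0 1 0 p).2
  have h2 (p) : d3 1 0 0 p = d3 0 0 1 p := by rw [(d3_comm 1 0 0 p).1, h1]
  have h3 (p) : d3 1 0 1 p = d3 0 1 1 p := (d3_comm 1 0 1 p).1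
  have h4 (p) : d3 1 1 0 p = d3 0 1 1 p := by rw [(d3_comm 1 1 0 p).2, h3]
  simp only [omega_apply, d3_symMap, Fin.sum_univ_two, Matrix.det_fin_two, h1, h2, h3, h4]
  ring

/-- The contraction `(q, p) ↦ q ⌟ p`, `Sym² W* × Sym³ W → W`, with `h² ⌟ w³ = h(w)² w`. -/
def contr : Module.Dual ℂ (SymW 2) →ₗ[ℂ] SymW 3 →ₗ[ℂ] W :=
  LinearMap.mk₂ ℂ (fun q p i => (1 / 3) * q (dSym 2 i p))
    (fun _ _ _ => by ext; simp; ring) (fun _ _ _ => by ext; simp; ring)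
    (fun _ _ _ => by ext; simp; ring) (fun _ _ _ => by ext; simp; ring)

lemma contr_apply (q : Module.Dual ℂ (SymW 2)) (p : SymW 3) (i : Fin 2) :
    contr q p i = (1 / 3) * q (dSym 2 i p) := rfl

lemma contr_symMap (A : Matrix (Fin 2) (Fin 2) ℂ) (q : Module.Dual ℂ (SymW 2)) (p : SymW 3) :
    contr q (symMap 3 A p) = A.mulVec (contr (q ∘ₗ symMap 2 A) p) := by
  ext i
  simp only [contr_apply, dSym_symMap, Matrix.mulVec, dotProduct, Fin.sum_univ_two, map_add,
    map_smul, LinearMap.comp_apply, smul_eq_mul]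
  ring

/-- The action of `X ∈ 𝔤𝔩(W)` on `Sym² W` by derivations. -/
def derSym : Matrix (Fin 2) (Fin 2) ℂ →ₗ[ℂ] Module.End ℂ (SymW 2) :=
  ∑ i, ∑ j, (Matrix.entryLinearMap ℂ ℂ i j).smulRight (mulE 1 i ∘ₗ dSym 1 j)

lemma derSym_apply (X : Matrix (Fin 2) (Fin 2) ℂ) (s : SymW 2) :
    derSym X s = ∑ i, ∑ j, X i j • mulE 1 i (dSym 1 j s) := by
  simp [derSym, Fin.sum_univ_two]

lemma derSym_symMap (A X Y : Matrix (Fin 2) (Fin 2) ℂ) (h : Y * A = A * X) (s : SymW 2) :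
    derSym Y (symMap 2 A s) = symMap 2 A (derSym X s) := by
  have h' (i j) := congrFun (congrFun h i) j
  simp only [Matrix.mul_apply, Fin.sum_univ_two] at h'
  simp only [derSym_apply, Fin.sum_univ_two, dSym_symMap, map_add, map_smul, symMap_mulE]
  simp only [smul_add, smul_smul]
  have h00 := h' 0 0
  have h01 := h' 0 1
  have h10 := h' 1 0
  have h11 := h' 1 1
  linear_combination (norm := module) h00 • mulE 1 0 (symMap 1 A (dSym 1 0 s))
    + h01 • mulE 1 0 (symMap 1 A (dSym 1 1 s)) + h10 • mulE 1 1 (symMap 1 A (dSym 1 0 s))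
    + h11 • mulE 1 1 (symMap 1 A (dSym 1 1 s))

/-- The monomial `eᵢ eⱼ ∈ Sym² W`. -/
def ee (i j : Fin 2) : SymW 2 :=
  ⟨X i * X j, (isHomogeneous_X ℂ i).mul (isHomogeneous_X ℂ j)⟩

lemma coe_ee (i j : Fin 2) : (ee i j : MvPolynomial (Fin 2) ℂ) = X i * X j := rfl

lemma symMap_ee (A : Matrix (Fin 2) (Fin 2) ℂ) (i j : Fin 2) :
    symMap 2 A (ee i j) = (A 0 i * A 0 j) • ee 0 0 + (A 0 i * A 1 j + A 1 i * A 0 j) • ee 0 1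
      + (A 1 i * A 1 j) • ee 1 1 := by
  apply Subtype.ext
  simp only [Submodule.coe_add, Submodule.coe_smul, coe_symMap, coe_ee, map_mul, subst_X,
    smul_eq_C_mul, map_add]
  ring

/-- The isomorphism `Sym² W* ≅ Sym² W` induced by `h ↦ (e₀ ∧ e₁) ⌞ h`. -/
def sharp : Module.Dual ℂ (SymW 2) →ₗ[ℂ] SymW 2 :=
  (LinearMap.applyₗ (ee 1 1)).smulRight (ee 0 0)
    - 2 • (LinearMap.applyₗ (ee 0 1)).smulRight (ee 0 1)
    + (LinearMap.applyₗ (ee 0 0)).smulRight (ee 1 1)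

lemma sharp_apply (q : Module.Dual ℂ (SymW 2)) :
    sharp q = q (ee 1 1) • ee 0 0 - (2 * q (ee 0 1)) • ee 0 1 + q (ee 0 0) • ee 1 1 := by
  simp only [sharp, LinearMap.add_apply, LinearMap.sub_apply, LinearMap.smul_apply,
    LinearMap.smulRight_apply, LinearMap.applyₗ_apply_apply, mul_smul, ofNat_smul_eq_nsmul]

lemma symMap_sharp (B : Matrix (Fin 2) (Fin 2) ℂ) (q : Module.Dual ℂ (SymW 2)) :
    symMap 2 B (sharp (q ∘ₗ symMap 2 B)) = B.det ^ 2 • sharp q := by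
  simp only [sharp_apply, LinearMap.comp_apply, symMap_ee, map_add, map_sub, map_smul,
    smul_eq_mul, Matrix.det_fin_two]
  module

/-- The bilinear map `Sym² W* × Sym³ W* → W`, `(h₂², h₁³) ↦ ⟨e₀ ∧ e₁, h₁ ∧ h₂⟩² (e₀ ∧ e₁) ⌞ h₁`. -/
def tau : Module.Dual ℂ (SymW 2) →ₗ[ℂ] Module.Dual ℂ (SymW 3) →ₗ[ℂ] W :=
  LinearMap.mk₂ ℂ (fun q φ => ![-φ (mulE 2 1 (sharp q)), φ (mulE 2 0 (sharp q))])
    (fun _ _ _ => by simp; ring) (fun _ _ _ => by simp)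
    (fun _ _ _ => by simp; ring) (fun _ _ _ => by simp)

lemma tau_apply (q : Module.Dual ℂ (SymW 2)) (φ : Module.Dual ℂ (SymW 3)) :
    tau q φ = ![-φ (mulE 2 1 (sharp q)), φ (mulE 2 0 (sharp q))] := rfl

lemma tau_symMap (A B : Matrix (Fin 2) (Fin 2) ℂ) (h : A * B = 1) (q : Module.Dual ℂ (SymW 2))
    (φ : Module.Dual ℂ (SymW 3)) :
    A.det ^ 3 • tau (q ∘ₗ symMap 2 B) (φ ∘ₗ symMap 3 B) = A.mulVec (tau q φ) := by
  have hd : A.det * B.det = 1 := by rw [← Matrix.det_mul, h, Matrix.det_one]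
  have hB : A.det • B = A.adjugate := by
    have := congrArg (A.adjugate * ·) h
    simpa [← mul_assoc, Matrix.adjugate_mul] using this
  have h' (i j) : A.det * B i j = A.adjugate i j := by rw [← hB]; rfl
  have h00 : A.det * B 0 0 = A 1 1 := by simpa [Matrix.adjugate_fin_two] using h' 0 0
  have h01 : A.det * B 0 1 = -A 0 1 := by simpa [Matrix.adjugate_fin_two] using h' 0 1
  have h10 : A.det * B 1 0 = -A 1 0 := by simpa [Matrix.adjugate_fin_two] using h' 1 0
  have h11 : A.det * B 1 1 = A 0 0 := by simpa [Matrix.adjugate_fin_two] using h' 1 1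
  have hs (i) : symMap 3 B (mulE 2 i (sharp (q ∘ₗ symMap 2 B))) =
      (B.det ^ 2 * B 0 i) • mulE 2 0 (sharp q) + (B.det ^ 2 * B 1 i) • mulE 2 1 (sharp q) := by
    rw [symMap_mulE, symMap_sharp]
    simp only [map_smul, smul_smul, mul_comm]
  simp only [tau_apply, LinearMap.comp_apply, hs, map_add, map_smul, smul_eq_mul]
  set a := φ (mulE 2 0 (sharp q))
  set b := φ (mulE 2 1 (sharp q))
  ext i
  fin_cases i
  · simp [Matrix.mulVec, dotProduct, Fin.sum_univ_two]
    linear_combination (-(A.det * B.det + 1) * (A.det * B 0 1 * a + A.det * B 1 1 * b)) * hd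
      - a * h01 - b * h11
  · simp [Matrix.mulVec, dotProduct, Fin.sum_univ_two]
    linear_combination ((A.det * B.det + 1) * (A.det * B 0 0 * a + A.det * B 1 0 * b)) * hd
      + a * h00 + b * h10

/-- The Levi group `GL(R) × GL(W)`, where `R = ℂ`. -/
abbrev Levi := ℂˣ × GL (Fin 2) ℂ

/-- The character of `GL(R) × GL(W)` on the line `R`. -/
def chiR : Levi →* ℂ := (Units.coeHom ℂ).comp (MonoidHom.fst _ _)

/-- The character of `GL(R) × GL(W)` on the line `Q = R^{⊗2} ⊗ (⋀² W)^{⊗3}`. -/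
def chiQ : Levi →* ℂ where
  toFun g := (g.1 : ℂ) ^ 2 * (g.2 : Matrix (Fin 2) (Fin 2) ℂ).det ^ 3
  map_one' := by simp
  map_mul' g h := by simp; ring

/-- The character of `GL(R) × GL(W)` on the line `Q*`. -/
def chiQd : Levi →* ℂ where
  toFun g := (chiQ g)⁻¹
  map_one' := by simp
  map_mul' g h := by simp [mul_comm]

/-- A one-dimensional representation given by a character. -/
def charRep (χ : Levi →* ℂ) : Representation ℂ Levi ℂ where
  toFun g := χ g • LinearMap.id
  map_one' := by ext; simp
  map_mul' g h := by ext; simp [mul_comm (χ g)]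

/-- The representation `χ ⊗ ρ`. -/
def twist {U : Type} [AddCommGroup U] [Module ℂ U] (χ : Levi →* ℂ) (ρ : Representation ℂ Levi U) :
    Representation ℂ Levi U where
  toFun g := χ g • ρ g
  map_one' := by simp
  map_mul' g h := by
    ext1 x
    simp only [map_mul, LinearMap.smul_apply, Module.End.mul_apply, map_smul, smul_smul,
      mul_comm (χ g)]

/-- `W` as a representation of `GL(R) × GL(W)`. -/
def repW : Representation ℂ Levi W where
  toFun g := Matrix.toLin' (g.2 : Matrix (Fin 2) (Fin 2) ℂ)
  map_one' := by simp; rfl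
  map_mul' g h := by simp [Matrix.toLin'_mul]; rfl

/-- `Sym^d W` as a representation of `GL(R) × GL(W)`. -/
def repSym (d : ℕ) : Representation ℂ Levi (SymW d) where
  toFun g := symMap d (g.2 : Matrix (Fin 2) (Fin 2) ℂ)
  map_one' := by simp
  map_mul' g h := by simp

/-- The adjoint representation of `GL(R) × GL(W)` on `𝔤𝔩(R) ⊕ 𝔤𝔩(W) = 𝔩₀ ⊕ ℂ Id_V`. -/
def repGl : Representation ℂ Levi (ℂ × Matrix (Fin 2) (Fin 2) ℂ) where
  toFun g :=
    LinearMap.id.prodMap (LinearMap.mulLeft ℂ (g.2 : Matrix (Fin 2) (Fin 2) ℂ) ∘ₗ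
      LinearMap.mulRight ℂ ((g.2⁻¹ : GL (Fin 2) ℂ) : Matrix (Fin 2) (Fin 2) ℂ))
  map_one' := by ext <;> simp
  map_mul' g h := LinearMap.ext fun x => by simp [mul_assoc]

/-- `𝔩 ⊕ ℂ Id_V`, as the product of its graded pieces: `𝔩₋₂ = Q`, `𝔩₋₁ = R ⊗ Sym³ W`,
`𝔩₀ ⊕ ℂ Id_V = 𝔤𝔩(R) ⊕ 𝔤𝔩(W)`, `𝔩₁ = R* ⊗ Sym³ W* = (R ⊗ Sym³ W)*` and `𝔩₂ = Q*`. -/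
abbrev LPart := ℂ × SymW 3 × (ℂ × Matrix (Fin 2) (Fin 2) ℂ) × Module.Dual ℂ (SymW 3) × ℂ

/-- The representation `V` of `𝔩`, as the product of its graded pieces: `V₋₁ = W`,
`V₀ = R* ⊗ Sym² W* = (R ⊗ Sym² W)*` and `V₁ = Q* ⊗ W`. -/
abbrev VPart := W × Module.Dual ℂ (SymW 2) × W

/-- The direct sum of the two parts of `𝔤 = (𝔩 ⊕ ℂ Id_V) ⋉ V`. -/
abbrev GSum := LPart × VPart

/-- `V₀ = R* ⊗ Sym² W*` as a representation of `GL(R) × GL(W)`. -/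
def repV0 : Representation ℂ Levi (Module.Dual ℂ (SymW 2)) := (twist chiR (repSym 2)).dual

/-- The natural representation of `GL(R) × GL(W)` on `𝔤`. -/
def repLevi : Representation ℂ Levi GSum :=
  ((charRep chiQ).prod ((twist chiR (repSym 3)).prod (repGl.prod
    ((twist chiR (repSym 3)).dual.prod (charRep chiQd))))).prod
    (repW.prod (repV0.prod (twist chiQd repW)))

/-- The adjoint action of `q ∈ V₀` on `𝔤`: it annihilates `𝔩₋₂`, `𝔩₂` and `V`, and
`[q, p] = -(q ⌟ p)` for `p ∈ 𝔩₋₁`, `[q, (c, X)] = -(c, X) · q` for `(c, X) ∈ 𝔤𝔩(R) ⊕ 𝔤𝔩(W)`,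
`[q, φ] = -tau q φ` for `φ ∈ 𝔩₁`. -/
def adV0 : Module.Dual ℂ (SymW 2) →ₗ[ℂ] Module.End ℂ GSum :=
  LinearMap.mk₂ ℂ (fun q x => ((0 : LPart),
      (-contr q x.1.2.1,
        q ∘ₗ (x.1.2.2.1.1 • LinearMap.id + derSym x.1.2.2.1.2),
        -tau q x.1.2.2.2.1)))
    (fun _ _ _ => by simp [LinearMap.add_comp]; exact ⟨add_comm _ _, add_comm _ _⟩)
    (fun _ _ _ => by simp [LinearMap.smul_comp])
    (fun _ _ _ => by
      simp [LinearMap.comp_add, add_smul, LinearMap.comp_smul]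
      refine ⟨add_comm _ _, by abel, add_comm _ _⟩)
    (fun _ _ _ => by simp [LinearMap.comp_add, smul_smul, LinearMap.comp_smul])

lemma adV0_apply (q : Module.Dual ℂ (SymW 2)) (x : GSum) :
    adV0 q x = ((0 : LPart), (-contr q x.1.2.1,
        q ∘ₗ (x.1.2.2.1.1 • LinearMap.id + derSym x.1.2.2.1.2), -tau q x.1.2.2.2.1)) := rfl

lemma adV0_mul (q q' : Module.Dual ℂ (SymW 2)) : adV0 q * adV0 q' = 0 := by
  refine LinearMap.ext fun x => ?_
  simp [adV0_apply, Module.End.mul_apply]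

lemma repLevi_apply (g : Levi) (x : GSum) : repLevi g x =
    ((chiQ g * x.1.1, chiR g • symMap 3 (g.2 : Matrix (Fin 2) (Fin 2) ℂ) x.1.2.1,
      (x.1.2.2.1.1, (g.2 : Matrix (Fin 2) (Fin 2) ℂ) * (x.1.2.2.1.2 *
        ((g.2⁻¹ : GL (Fin 2) ℂ) : Matrix (Fin 2) (Fin 2) ℂ))),
      x.1.2.2.2.1 ∘ₗ (chiR g⁻¹ • symMap 3 ((g.2⁻¹ : GL (Fin 2) ℂ) : Matrix (Fin 2) (Fin 2) ℂ)),
      (chiQ g)⁻¹ * x.1.2.2.2.2),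
    ((g.2 : Matrix (Fin 2) (Fin 2) ℂ).mulVec x.2.1, repV0 g x.2.2.1,
      (chiQ g)⁻¹ • (g.2 : Matrix (Fin 2) (Fin 2) ℂ).mulVec x.2.2.2)) := rfl

lemma repV0_apply (g : Levi) (q : Module.Dual ℂ (SymW 2)) : repV0 g q =
    q ∘ₗ (chiR g⁻¹ • symMap 2 ((g.2⁻¹ : GL (Fin 2) ℂ) : Matrix (Fin 2) (Fin 2) ℂ)) := rfl

lemma repLevi_adV0 (g : Levi) (q : Module.Dual ℂ (SymW 2)) (x : GSum) :
    repLevi g (adV0 q x) = adV0 (repV0 g q) (repLevi g x) := by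
  obtain ⟨l, A⟩ := g
  obtain ⟨⟨a, p, ⟨c, Y⟩, φ, b⟩, w, r, w'⟩ := x
  have hl : (l : ℂ) ≠ 0 := l.ne_zero
  have hAB : (A : Matrix (Fin 2) (Fin 2) ℂ) * ((A⁻¹ : GL (Fin 2) ℂ) : Matrix (Fin 2) (Fin 2) ℂ)
    = 1 := by rw [← Units.val_mul, mul_inv_cancel]; rfl
  have hBA : ((A⁻¹ : GL (Fin 2) ℂ) : Matrix (Fin 2) (Fin 2) ℂ) * (A : Matrix (Fin 2) (Fin 2) ℂ)
    = 1 := by rw [← Units.val_mul, inv_mul_cancel]; rfl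
  have hdet : (A : Matrix (Fin 2) (Fin 2) ℂ).det ≠ 0 := fun h0 => by
    have := congrArg Matrix.det hAB
    rw [Matrix.det_mul, h0, zero_mul, Matrix.det_one] at this
    exact zero_ne_one this
  rw [repLevi_apply, adV0_apply, adV0_apply, repLevi_apply]
  simp only [repV0_apply]
  have e1 : ∀ (q : Module.Dual ℂ (SymW 2)) (p : SymW 3), contr (q ∘ₗ
      (chiR ((l, A) : Levi)⁻¹ • symMap 2 ((A⁻¹ : GL (Fin 2) ℂ) : Matrix (Fin 2) (Fin 2) ℂ)))
      (chiR ((l, A) : Levi) • symMap 3 (A : Matrix (Fin 2) (Fin 2) ℂ) p)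
      = (A : Matrix (Fin 2) (Fin 2) ℂ).mulVec (contr q p) := by
    intro q p
    have : (q ∘ₗ symMap 2 ((A⁻¹ : GL (Fin 2) ℂ) : Matrix (Fin 2) (Fin 2) ℂ)) ∘ₗ
        symMap 2 (A : Matrix (Fin 2) (Fin 2) ℂ) = q := by
      rw [LinearMap.comp_assoc, ← Module.End.mul_eq_comp, ← map_mul, hBA, map_one]
      rfl
    rw [LinearMap.comp_smul, map_smul, map_smul, LinearMap.smul_apply, contr_symMap, this, smul_smul,
      ← map_mul, mul_inv_cancel, map_one, one_smul]
  have e3 : tau (q ∘ₗ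
      (chiR ((l, A) : Levi)⁻¹ • symMap 2 ((A⁻¹ : GL (Fin 2) ℂ) : Matrix (Fin 2) (Fin 2) ℂ)))
      (φ ∘ₗ (chiR ((l, A) : Levi)⁻¹ • symMap 3 ((A⁻¹ : GL (Fin 2) ℂ) : Matrix (Fin 2) (Fin 2) ℂ)))
      = (chiQ ((l, A) : Levi))⁻¹ • (A : Matrix (Fin 2) (Fin 2) ℂ).mulVec (tau q φ) := by
    rw [← tau_symMap _ _ hAB, LinearMap.comp_smul, LinearMap.comp_smul, map_smul, map_smul,
      LinearMap.smul_apply, smul_smul, smul_smul]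
    congr 1
    simp [chiQ, chiR]
    field_simp
  have e2 : (q ∘ₗ (c • LinearMap.id + derSym Y)) ∘ₗ
      (chiR ((l, A) : Levi)⁻¹ • symMap 2 ((A⁻¹ : GL (Fin 2) ℂ) : Matrix (Fin 2) (Fin 2) ℂ))
      = (q ∘ₗ (chiR ((l, A) : Levi)⁻¹ • symMap 2
          ((A⁻¹ : GL (Fin 2) ℂ) : Matrix (Fin 2) (Fin 2) ℂ))) ∘ₗ
        (c • LinearMap.id + derSym ((A : Matrix (Fin 2) (Fin 2) ℂ) *
          (Y * ((A⁻¹ : GL (Fin 2) ℂ) : Matrix (Fin 2) (Fin 2) ℂ)))) := by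
    ext1 s
    have := derSym_symMap ((A⁻¹ : GL (Fin 2) ℂ) : Matrix (Fin 2) (Fin 2) ℂ)
      ((A : Matrix (Fin 2) (Fin 2) ℂ) *
          (Y * ((A⁻¹ : GL (Fin 2) ℂ) : Matrix (Fin 2) (Fin 2) ℂ))) Y
      (by rw [← mul_assoc, hBA, one_mul]) s
    simp only [LinearMap.comp_apply, LinearMap.add_apply, LinearMap.smul_apply, LinearMap.id_apply,
      map_add, map_smul, this]
    simp only [smul_eq_mul]
    ring
  rw [e1, e2, e3]
  simp only [Matrix.mulVec_neg, smul_neg]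
  simp

/-- The unipotent radical `R* ⊗ Sym² W*`, written multiplicatively, with the action of
`GL(R) × GL(W)`. -/
def leviAut : Levi →* MulAut (Multiplicative (Module.Dual ℂ (SymW 2))) where
  toFun g :=
    { toFun := fun q => .ofAdd (repV0 g q.toAdd)
      invFun := fun q => .ofAdd (repV0 g⁻¹ q.toAdd)
      left_inv := fun q => by simp
      right_inv := fun q => by simp
      map_mul' := fun q q' => by simp }
  map_one' := by ext; simp
  map_mul' g h := by ext; simp

/-- The group `G₀ = (GL(R) × GL(W)) ⋉ (R* ⊗ Sym² W*)`. -/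
abbrev G0 := Multiplicative (Module.Dual ℂ (SymW 2)) ⋊[leviAut] Levi

/-- The space underlying the Lie algebra `𝔤 = (𝔩 ⊕ ℂ Id_V) ⋉ V`. -/
def LieG := GSum

instance : AddCommGroup LieG := inferInstanceAs (AddCommGroup GSum)

instance : Module ℂ LieG := inferInstanceAs (Module ℂ GSum)

/-- The projection `𝔤 → 𝔤 / V = 𝔩 ⊕ ℂ Id_V`. -/
def projL : LieG →ₗ[ℂ] LPart := LinearMap.fst ℂ LPart VPart

/-- The action of `G₀` on `𝔤`: the Levi factor acts naturally, and `q ∈ V₀` acts by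
`exp (ad q) = 1 + ad q`. -/
def repGSum : Representation ℂ G0 GSum where
  toFun g := (1 + adV0 g.left.toAdd) * repLevi g.right
  map_one' := by simp
  map_mul' g h := by
    have hc : repLevi g.right * adV0 h.left.toAdd =
        adV0 (repV0 g.right h.left.toAdd) * repLevi g.right :=
      LinearMap.ext fun x => repLevi_adV0 _ _ _
    have hl : ((g * h).left).toAdd = g.left.toAdd + repV0 g.right h.left.toAdd := rfl
    have hr : (g * h).right = g.right * h.right := rfl
    rw [hl, hr, map_mul, map_add]
    calc _ = (1 + adV0 g.left.toAdd) * ((1 + adV0 (repV0 g.right h.left.toAdd)) * repLevi g.right)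
            * repLevi h.right := by
          have := adV0_mul g.left.toAdd (repV0 g.right h.left.toAdd)
          simp only [← mul_assoc, add_mul, mul_add, one_mul, this, add_zero]
          abel_nf
      _ = _ := by
          rw [add_mul 1 (adV0 (repV0 g.right h.left.toAdd)), ← hc]
          simp only [mul_assoc, add_mul, mul_add, one_mul]

/-- The action of `G₀` on `𝔤`. -/
def repG : Representation ℂ G0 LieG := repGSum

/-- The character of `G₀` on the line `R`. -/
def repR : Representation ℂ G0 ℂ := (charRep chiR).comp SemidirectProduct.rightHom

/-- The degree operator of the gradation of `𝔤`: it multiplies `𝔩ₖ` and `Vₖ` by `k`. -/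
def degSum : Module.End ℂ GSum :=
  (((-2 : ℂ) • LinearMap.id).prodMap (((-1 : ℂ) • LinearMap.id).prodMap
    (((0 : ℂ) • LinearMap.id).prodMap
      (((1 : ℂ) • LinearMap.id).prodMap ((2 : ℂ) • LinearMap.id))))).prodMap
    (((-1 : ℂ) • LinearMap.id).prodMap
      (((0 : ℂ) • LinearMap.id).prodMap ((1 : ℂ) • LinearMap.id)))

/-- The degree operator of the gradation of `𝔤`. -/
def degOp : Module.End ℂ LieG := degSum

lemma degSum_apply (x : GSum) : degSum x =
    (((-2 : ℂ) • x.1.1, (-1 : ℂ) • x.1.2.1, (0 : ℂ) • x.1.2.2.1, (1 : ℂ) • x.1.2.2.2.1,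
      (2 : ℂ) • x.1.2.2.2.2),
    ((-1 : ℂ) • x.2.1, (0 : ℂ) • x.2.2.1, (1 : ℂ) • x.2.2.2)) := rfl

lemma repGSum_apply (g : G0) (x : GSum) :
    repGSum g x = repLevi g.right x + adV0 g.left.toAdd (repLevi g.right x) := rfl

lemma repLevi_degSum (g : Levi) (x : GSum) : repLevi g (degSum x) = degSum (repLevi g x) := by
  simp [repLevi_apply, degSum_apply, Matrix.mulVec_neg]
  exact ⟨by ring, smul_comm _ _ _, by ring⟩

lemma adV0_degSum (q : Module.Dual ℂ (SymW 2)) (x : GSum) :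
    adV0 q (degSum x) = degSum (adV0 q x) := by
  simp [adV0_apply, degSum_apply]
  rfl

lemma repGSum_degSum (g : G0) (x : GSum) : repGSum g (degSum x) = degSum (repGSum g x) := by
  rw [repGSum_apply, repGSum_apply, repLevi_degSum, adV0_degSum, map_add]

lemma repG_degOp (g : G0) (x : LieG) : repG g (degOp x) = degOp (repG g x) :=
  repGSum_degSum g x

lemma repGSum_fst (g : G0) (x : GSum) (h : x.1 = 0) : (repGSum g x).1 = 0 := by
  rw [repGSum_apply, adV0_apply, repLevi_apply, h]
  simp

/-- The graded piece `𝔤ₖ`. -/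
def gr (k : ℤ) : Submodule ℂ LieG := Module.End.eigenspace degOp (k : ℂ)

lemma gr_invariant (k : ℤ) (g : G0) : gr k ≤ (gr k).comap (repG g) := by
  intro x hx
  rw [gr, Module.End.mem_eigenspace_iff] at hx
  rw [Submodule.mem_comap, gr, Module.End.mem_eigenspace_iff, ← repG_degOp, hx, map_smul]

/-- `𝔤ₖ` as a `G₀`-module. -/
def repGr (k : ℤ) : Representation ℂ G0 (gr k) := repG.subrepresentation (gr k) (gr_invariant k)

/-- The submodule `Vₖ = 𝔤ₖ ∩ V` of `𝔤ₖ`. -/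
def vGr (k : ℤ) : Submodule ℂ (gr k) :=
  LinearMap.ker (projL ∘ₗ (gr k).subtype)

lemma vGr_invariant (k : ℤ) (g : G0) : vGr k ≤ (vGr k).comap (repGr k g) := by
  rintro ⟨x, hx⟩ h
  exact repGSum_fst g x h

/-- `Vₖ` as a `G₀`-module. -/
def repV (k : ℤ) : Representation ℂ G0 (vGr k) :=
  (repGr k).subrepresentation (vGr k) (vGr_invariant k)

/-- The quotient `G₀`-module `𝔤ₖ / Vₖ`. -/
def repL (k : ℤ) : Representation ℂ G0 (gr k ⧸ vGr k) :=
  (repGr k).quotient (vGr k) (vGr_invariant k)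

lemma gr_neg_two_mem (a : ℂ) : (show LieG from ((a, 0), 0)) ∈ gr (-2) := by
  rw [gr, Module.End.mem_eigenspace_iff]
  change degSum ((a, 0), 0) = (((-2 : ℤ) : ℂ) • (((a, 0), 0) : GSum))
  simp [degSum_apply]

/-- The Lie bracket `𝔤₋₁ × 𝔤₋₁ → 𝔤₋₂` of `𝔤₋ = 𝔤₋₁ ⊕ 𝔤₋₂`: it is `omega` on `𝔩₋₁`, and `V₋₁` is
in its kernel. -/
def bracket (x y : gr (-1)) : gr (-2) :=
  ⟨((omega x.1.1.2.1 y.1.1.2.1, 0), 0), gr_neg_two_mem _⟩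

lemma repGSum_omega (g : G0) (x y : GSum) :
    repGSum g ((omega x.1.2.1 y.1.2.1, 0), 0) =
      ((omega (repGSum g x).1.2.1 (repGSum g y).1.2.1, 0), 0) := by
  have h (x : GSum) : (repGSum g x).1.2.1 =
      chiR g.right • symMap 3 (g.right.2 : Matrix (Fin 2) (Fin 2) ℂ) x.1.2.1 := by
    rw [repGSum_apply, adV0_apply, repLevi_apply]
    simp
  rw [h, h, map_smul, map_smul, LinearMap.smul_apply, omega_symMap, repGSum_apply, adV0_apply,
    repLevi_apply]
  simp [chiQ, chiR]
  ring

lemma bracket_rep (g : G0) (x y : gr (-1)) :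
    bracket (repGr (-1) g x) (repGr (-1) g y) = repGr (-2) g (bracket x y) :=
  Subtype.ext (repGSum_omega g x.1 y.1).symm

/-- The affine cone `{c w + r ⊗ w³}` in `𝔤₋₁ = W ⊕ (R ⊗ Sym³ W)` over the surface `𝕊`. -/
def coneS : Set (gr (-1)) :=
  {x | ∃ (c r : ℂ) (w : W), (x : LieG) = ((0, r • symPow 3 w, 0), (c • w, 0))}

/-- The surface `𝕊 ⊂ ℙ 𝔤₋₁`. -/
def surfaceS : Set (Projectivization ℂ (gr (-1))) :=
  {P | ∃ (x : gr (-1)) (hx : x ≠ 0), x ∈ coneS ∧ P = Projectivization.mk ℂ x hx}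

/-- The invertible linear map by which `g` acts in a representation. -/
def repEquiv {U : Type} [AddCommGroup U] [Module ℂ U] (ρ : Representation ℂ G0 U) (g : G0) :
    U ≃ₗ[ℂ] U :=
  LinearEquiv.ofLinearMap (ρ g) (ρ g⁻¹)
    (by rw [← Module.End.mul_eq_comp, ← map_mul, mul_inv_cancel, map_one]; rfl)
    (by rw [← Module.End.mul_eq_comp, ← map_mul, inv_mul_cancel, map_one]; rfl)

/-! ### Filtrations of type `𝔤₋` and `G₀`-structures on a complex manifold of dimension 7 -/

/-- The model space of complex manifolds of dimension 7. -/
abbrev Model := EuclideanSpace ℂ (Fin 7)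

section Manifold

variable {M : Type*} [TopologicalSpace M] [ChartedSpace Model M] [IsManifold 𝓘(ℂ, Model) ω M]

/-- The vector field `X` is holomorphic on `N`. -/
def IsHolField (X : ∀ y : M, TangentSpace 𝓘(ℂ, Model) y) (N : Set M) : Prop :=
  ContMDiffOn 𝓘(ℂ, Model) 𝓘(ℂ, Model).tangent ω
    (fun y => (⟨y, X y⟩ : TangentBundle 𝓘(ℂ, Model) M)) N

/-- The scalar function `h` is holomorphic on `N`. -/
def IsHolFun (h : M → ℂ) (N : Set M) : Prop :=
  ContMDiffOn 𝓘(ℂ, Model) 𝓘(ℂ, ℂ) ω h N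

/-- `D` is a holomorphic vector subbundle of rank `r` of the tangent bundle. -/
def IsHolSubbundle (D : ∀ x : M, Submodule ℂ (TangentSpace 𝓘(ℂ, Model) x)) (r : ℕ) : Prop :=
  ∀ x, ∃ N : Set M, IsOpen N ∧ x ∈ N ∧ ∃ X : Fin r → ∀ y : M, TangentSpace 𝓘(ℂ, Model) y,
    (∀ i, IsHolField (X i) N) ∧
      ∀ y ∈ N, LinearIndependent ℂ (fun i => X i y) ∧
        Submodule.span ℂ (Set.range fun i => X i y) = D y

/-- `c` is the bracket of `a, b ∈ D_x` in the symbol algebra `D_x ⊕ T_x M / D_x` of the filtration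
`D ⊂ TM`: it is the class of `[X, Y](x)` for local holomorphic sections `X, Y` of `D` extending
`a, b`. -/
def IsSymbolBracket (D : ∀ x : M, Submodule ℂ (TangentSpace 𝓘(ℂ, Model) x)) (x : M)
    (a b : D x) (c : TangentSpace 𝓘(ℂ, Model) x ⧸ D x) : Prop :=
  ∀ (N : Set M) (X Y : ∀ y : M, TangentSpace 𝓘(ℂ, Model) y), IsOpen N → x ∈ N →
    IsHolField X N → IsHolField Y N → (∀ y ∈ N, X y ∈ D y) → (∀ y ∈ N, Y y ∈ D y) →
    X x = a → Y x = b → (D x).mkQ (VectorField.mlieBracket 𝓘(ℂ, Model) X Y x) = c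

/-- Graded frames at `x`: the isomorphisms of graded Lie algebras from `𝔤₋ = 𝔤₋₁ ⊕ 𝔤₋₂` to the
symbol algebra `D_x ⊕ T_x M / D_x` of the filtration `D ⊂ TM`. -/
structure GrFrame (D : ∀ x : M, Submodule ℂ (TangentSpace 𝓘(ℂ, Model) x)) (x : M) where
  neg1 : gr (-1) ≃ₗ[ℂ] D x
  neg2 : gr (-2) ≃ₗ[ℂ] (TangentSpace 𝓘(ℂ, Model) x ⧸ D x)
  map_bracket : ∀ u v, IsSymbolBracket D x (neg1 u) (neg1 v) (neg2 (bracket u v))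

/-- The right action of `G₀` on graded frames. -/
def GrFrame.act {D : ∀ x : M, Submodule ℂ (TangentSpace 𝓘(ℂ, Model) x)} {x : M}
    (p : GrFrame D x) (g : G0) : GrFrame D x where
  neg1 := (repEquiv (repGr (-1)) g).trans p.neg1
  neg2 := (repEquiv (repGr (-2)) g).trans p.neg2
  map_bracket u v := by
    have h := p.map_bracket (repGr (-1) g u) (repGr (-1) g v)
    rw [bracket_rep] at h
    exact h

/-- The family `φ` of graded frames is holomorphic on `N`. -/
def IsHolFrame {D : ∀ x : M, Submodule ℂ (TangentSpace 𝓘(ℂ, Model) x)} (N : Set M)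
    (φ : ∀ y, GrFrame D y) : Prop :=
  (∀ u : gr (-1), IsHolField (fun y => ((φ y).neg1 u : TangentSpace 𝓘(ℂ, Model) y)) N) ∧
    ∀ c : gr (-2), ∀ x ∈ N, ∃ N' : Set M, IsOpen N' ∧ x ∈ N' ∧
      ∃ X : ∀ y : M, TangentSpace 𝓘(ℂ, Model) y, IsHolField X N' ∧
        ∀ y ∈ N', (D y).mkQ (X y) = (φ y).neg2 c

/-- A `G₀`-structure subordinate to the filtration `D ⊂ TM`: a holomorphic principal
`G₀`-subbundle of the graded frame bundle. -/
structure G0Structure (D : ∀ x : M, Submodule ℂ (TangentSpace 𝓘(ℂ, Model) x)) where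
  fiber : ∀ x, Set (GrFrame D x)
  act_mem : ∀ x, ∀ p ∈ fiber x, ∀ g : G0, p.act g ∈ fiber x
  exists_act : ∀ x, ∀ p ∈ fiber x, ∀ p' ∈ fiber x, ∃ g : G0, p' = p.act g
  exists_section : ∀ x, ∃ N : Set M, IsOpen N ∧ x ∈ N ∧
    ∃ φ : ∀ y, fiber y, IsHolFrame N (fun y => (φ y : GrFrame D y))

/-- `φ` is a holomorphic section over `N` of the principal bundle `A` (its values outside `N` are
irrelevant). -/
def G0Structure.IsHolSection {D : ∀ x : M, Submodule ℂ (TangentSpace 𝓘(ℂ, Model) x)}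
    (A : G0Structure D) (N : Set M) (φ : ∀ y, A.fiber y) : Prop :=
  IsOpen N ∧ IsHolFrame N (fun y => (φ y : GrFrame D y))

/-- The fibre at `x` of the vector bundle `A ×^{G₀} U` associated with a representation `U` of
`G₀`: the class of `(p, u)` is the function on `A_x` with value `u` at `p` and with
`s (p g) = g⁻¹ s (p)`. In terms of a local holomorphic section `φ` of `A`, a section `s` of
`A ×^{G₀} U` is holomorphic when `x ↦ s x (φ x) ∈ U` is. -/
def G0Structure.assoc {D : ∀ x : M, Submodule ℂ (TangentSpace 𝓘(ℂ, Model) x)}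
    (A : G0Structure D) {U : Type} [AddCommGroup U] [Module ℂ U] (ρ : Representation ℂ G0 U)
    (x : M) : Submodule ℂ (A.fiber x → U) where
  carrier := {s | ∀ (p p' : A.fiber x) (g : G0),
    (p' : GrFrame D x) = (p : GrFrame D x).act g → ρ g (s p') = s p}
  add_mem' hs ht p p' g h := by simp [hs p p' g h, ht p p' g h]
  zero_mem' p p' g h := by simp
  smul_mem' c s hs p p' g h := by simp [hs p p' g h]

end Manifold

/-! ### Vector bundles on the projective line -/

/-- The projective line `ℙ¹`. -/
abbrev P1 := Projectivization ℂ (Fin 2 → ℂ)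

/-- The vectors `(1, z)` and `(z, 1)`. -/
def affVec (b : Fin 2) (z : ℂ) : Fin 2 → ℂ := fun i => if i = b then 1 else z

lemma affVec_ne_zero (b : Fin 2) (z : ℂ) : affVec b z ≠ 0 := fun h => by
  have := congrFun h b
  simp [affVec] at this

/-- The two affine charts `z ↦ [1 : z]` and `z ↦ [z : 1]` of `ℙ¹`, which give its topology and its
complex structure. -/
def chart (b : Fin 2) (z : ℂ) : P1 := Projectivization.mk ℂ (affVec b z) (affVec_ne_zero b z)

/-- Open subsets of `ℙ¹`. -/
def IsOpenP1 (T : Set P1) : Prop := ∀ b, IsOpen (chart b ⁻¹' T)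

/-- A vector bundle on `ℙ¹`, given by its fibres and by the holomorphic sections
among all the sections over an open subset. -/
structure P1Bundle where
  E : P1 → Type
  [addCommGroup : ∀ t, AddCommGroup (E t)]
  [module : ∀ t, Module ℂ (E t)]
  IsHol : Set P1 → (∀ t, E t) → Prop

attribute [instance] P1Bundle.addCommGroup P1Bundle.module

/-- Two bundles on `ℙ¹` are isomorphic: there are linear isomorphisms of the fibres that identify
the local holomorphic sections. -/
def P1Bundle.Iso (B B' : P1Bundle) : Prop :=
  ∃ e : ∀ t, B.E t ≃ₗ[ℂ] B'.E t, ∀ (T : Set P1) (s : ∀ t, B.E t), IsOpenP1 T →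
    (B.IsHol T s ↔ B'.IsHol T fun t => e t (s t))

/-- The direct sum of two bundles on `ℙ¹`. -/
def P1Bundle.sum (B B' : P1Bundle) : P1Bundle where
  E t := B.E t × B'.E t
  IsHol T s := B.IsHol T (fun t => (s t).1) ∧ B'.IsHol T (fun t => (s t).2)

/-- The subfamily `L` of fibres with the holomorphic sections of `B` that lie in it. -/
def P1Bundle.sub (B : P1Bundle) (L : ∀ t, Submodule ℂ (B.E t)) : P1Bundle where
  E t := L t
  IsHol T s := B.IsHol T fun t => (s t : B.E t)

/-- `L` is a holomorphic line subbundle of `B`: it is locally spanned by a nowhere zero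
holomorphic section. -/
def P1Bundle.IsLineSubbundle (B : P1Bundle) (L : ∀ t, Submodule ℂ (B.E t)) : Prop :=
  ∀ t₀, ∃ T : Set P1, IsOpenP1 T ∧ t₀ ∈ T ∧ ∃ s : ∀ t, B.E t, B.IsHol T s ∧
    ∀ t ∈ T, s t ≠ 0 ∧ L t = Submodule.span ℂ {s t}

/-- The nonzero vectors of the line `t ⊂ ℂ²`. -/
abbrev LineVec (t : P1) := {v : Fin 2 → ℂ // ∃ hv : v ≠ 0, Projectivization.mk ℂ v hv = t}

/-- The line bundle `𝒪(k)` on `ℙ¹`: its fibre at a line `t ⊂ ℂ²` is the space of functions on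
`t ∖ {0}` that are homogeneous of degree `k` (so that the fibre of `𝒪(-1)` is `t` itself). -/
def O (k : ℤ) : P1Bundle where
  E t := ({ carrier := {s | ∀ (v v' : LineVec t) (c : ℂ), v'.1 = c • v.1 → s v' = c ^ k * s v}
            add_mem' := fun hs ht v v' c h => by simp [hs v v' c h, ht v v' c h, mul_add]
            zero_mem' := fun v v' c h => by simp
            smul_mem' := fun a s hs v v' c h => by simp [hs v v' c h, mul_left_comm] } :
          Submodule ℂ (LineVec t → ℂ))
  IsHol T s := ∀ b, DifferentiableOn ℂ
    (fun z => (s (chart b z)).1 ⟨affVec b z, affVec_ne_zero b z, rfl⟩) (chart b ⁻¹' T)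

/-- `L` is a line subbundle of degree `k` of `B`. -/
def P1Bundle.IsLineSubbundleOfDegree (B : P1Bundle) (L : ∀ t, Submodule ℂ (B.E t)) (k : ℤ) : Prop :=
  B.IsLineSubbundle L ∧ (B.sub L).Iso (O k)

/-! ### The setting: geometric structures modelled on `𝔤` with rational curves -/

section Setting

variable {M : Type*} [TopologicalSpace M] [ChartedSpace Model M] [IsManifold 𝓘(ℂ, Model) ω M]

/-- The map `f : ℙ¹ → M` is holomorphic. -/
def IsHolCurve (f : P1 → M) : Prop :=
  ∀ b, ContMDiff 𝓘(ℂ, ℂ) 𝓘(ℂ, Model) ω fun z : ℂ => f (chart b z)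

/-- The pull-back along `f : ℙ¹ → M` of the vector bundle `A ×^{G₀} U`. -/
def G0Structure.pull {D : ∀ x : M, Submodule ℂ (TangentSpace 𝓘(ℂ, Model) x)}
    (A : G0Structure D) {U : Type} [AddCommGroup U] [Module ℂ U] (ρ : Representation ℂ G0 U)
    (f : P1 → M) : P1Bundle where
  E t := A.assoc ρ (f t)
  IsHol T s := ∀ (N : Set M) (φ : ∀ y, A.fiber y), A.IsHolSection N φ →
    ∀ (l : Module.Dual ℂ U) (b : Fin 2), DifferentiableOn ℂ
      (fun z => l ((s (chart b z)).1 (φ (f (chart b z)))))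
      {z | chart b z ∈ T ∧ f (chart b z) ∈ N}

/-- `Z` is a closed analytic subset of `M`. -/
def IsAnalyticSubset (Z : Set M) : Prop :=
  ∀ x, ∃ N : Set M, IsOpen N ∧ x ∈ N ∧ ∃ (n : ℕ) (h : Fin n → M → ℂ), (∀ i, IsHolFun (h i) N) ∧
    Z ∩ N = {y | y ∈ N ∧ ∀ i, h i y = 0}

/-- Zariski-open subsets of the complex manifold `M`. -/
def IsZariskiOpen (M' : Set M) : Prop := IsAnalyticSubset M'ᶜ

/-- Euclidean open subsets of a finite-dimensional complex vector space. -/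
def IsEuclideanOpen {E : Type*} [AddCommGroup E] [Module ℂ E] (s : Set E) : Prop :=
  ∀ (n : ℕ) (e : (Fin n → ℂ) →ₗ[ℂ] E), IsOpen (e ⁻¹' s)

variable (M) in
/-- A subbundle `D ⊂ TM` of rank 6 that defines a filtration of type `𝔤₋`, a `G₀`-structure `A`
subordinate to it, and a family `C` of subsets `C_x ⊂ ℙ D_x` that corresponds to `𝕊 ⊂ ℙ 𝔤₋₁`
under all the elements of `A`. -/
structure Setup where
  D : ∀ x : M, Submodule ℂ (TangentSpace 𝓘(ℂ, Model) x)
  isHolSubbundle : IsHolSubbundle D 6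
  nonempty_grFrame : ∀ x, Nonempty (GrFrame D x)
  A : G0Structure D
  C : ∀ x, Set (Projectivization ℂ (D x))
  image_surfaceS : ∀ x, ∀ p ∈ A.fiber x,
    Projectivization.map (p.neg1 : gr (-1) →ₗ[ℂ] D x) p.neg1.injective '' surfaceS = C x

/-- The vector bundle `𝒱ₖ = A ×^{G₀} Vₖ`. -/
abbrev Setup.V (S : Setup M) (k : ℤ) (x : M) := S.A.assoc (repV k) x

/-- The vector bundle `ℒₖ = 𝒢ₖ / 𝒱ₖ = A ×^{G₀} (𝔤ₖ / Vₖ)`. -/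
abbrev Setup.L (S : Setup M) (k : ℤ) (x : M) := S.A.assoc (repL k) x

/-- `f = f_a : ℙ¹ → M` is one of the required rational curves for `a ∈ 𝒲_x`, where `𝒲 = 𝒱₋₁`. -/
def Setup.IsGoodCurve (S : Setup M) (o : P1) (x : M) (a : S.V (-1) x) (f : P1 → M) : Prop :=
  IsHolCurve f ∧ ∃ hx : f o = x,
    (S.A.pull (repL (-2)) f).Iso (O 1) ∧
    (S.A.pull repR f).Iso (O (-1)) ∧
    ∃ L : ∀ t, Submodule ℂ ((S.A.pull (repV (-1)) f).E t),
      (S.A.pull (repV (-1)) f).IsLineSubbundleOfDegree L 1 ∧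
      (∀ L', (S.A.pull (repV (-1)) f).IsLineSubbundleOfDegree L' 1 → L' = L) ∧
      (S.A.pull (repV (-1)) f).Iso (((S.A.pull (repV (-1)) f).sub L).sum (O 0)) ∧
      L o = Submodule.span ℂ {(hx.symm ▸ a : S.V (-1) (f o))}

/-- There is a family of rational curves `f_a`, indexed by the vectors `a` of nonempty open subsets
of the fibres of `𝒲 = 𝒱₋₁` at the points of a nonempty Zariski-open subset of `M`. -/
def Setup.HasRationalCurves (S : Setup M) (o : P1) : Prop :=
  ∃ M' : Set M, IsZariskiOpen M' ∧ M'.Nonempty ∧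
    ∃ Wo : ∀ x, Set (S.V (-1) x), ∀ x ∈ M',
      IsEuclideanOpen (Wo x) ∧ (Wo x).Nonempty ∧ (0 : S.V (-1) x) ∉ Wo x ∧
        ∀ a ∈ Wo x, ∃ f : P1 → M, S.IsGoodCurve o x a f

/-! ### Homomorphisms -/

/-- The vector bundle `𝒱ₖ ⊕ ℒₖ`. -/
def Setup.VL (S : Setup M) (k : ℤ) (x : M) := S.V k x × S.L k x

instance (S : Setup M) (k : ℤ) (x : M) : AddCommGroup (S.VL k x) :=
  inferInstanceAs (AddCommGroup (S.V k x × S.L k x))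

instance (S : Setup M) (k : ℤ) (x : M) : Module ℂ (S.VL k x) :=
  inferInstanceAs (Module ℂ (S.V k x × S.L k x))

/-- The coordinate in `Vₖ ⊕ 𝔤ₖ / Vₖ` of an element of `𝒱ₖ ⊕ ℒₖ` with respect to a frame `p ∈ A`. -/
def Setup.coord (S : Setup M) {k : ℤ} {x : M} (p : S.A.fiber x) (s : S.VL k x) :
    vGr k × (gr k ⧸ vGr k) := (s.1.1 p, s.2.1 p)

open scoped DirectSum

/-- The inclusion of `𝒱ₘ ⊕ ℒₘ` in the exterior algebra of `⨁ₘ (𝒱ₘ ⊕ ℒₘ)`. -/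
def Setup.incl (S : Setup M) (m : ℤ) (x : M) :
    S.VL m x →ₗ[ℂ] ExteriorAlgebra ℂ (⨁ n : ℤ, S.VL n x) :=
  ExteriorAlgebra.ι ℂ ∘ₗ DirectSum.lof ℂ ℤ (fun n => S.VL n x) m

/-- The vector bundle `(𝒱ᵢ ⊕ ℒᵢ) ∧ (𝒱ⱼ ⊕ ℒⱼ)`: the span of the products `u ∧ v` in
`⋀² ⨁ₘ (𝒱ₘ ⊕ ℒₘ)`. -/
def Setup.wedge (S : Setup M) (i j : ℤ) (x : M) :
    Submodule ℂ (ExteriorAlgebra ℂ (⨁ n : ℤ, S.VL n x)) :=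
  LinearMap.range (S.incl i x) * LinearMap.range (S.incl j x)

/-- The element `u ∧ v` of `(𝒱ᵢ ⊕ ℒᵢ) ∧ (𝒱ⱼ ⊕ ℒⱼ)`. -/
def Setup.wedgeMk (S : Setup M) {i j : ℤ} {x : M} (u : S.VL i x) (v : S.VL j x) : S.wedge i j x :=
  ⟨S.incl i x u * S.incl j x v, Submodule.mul_mem_mul ⟨u, rfl⟩ ⟨v, rfl⟩⟩

/-- The family of linear maps `σ : (𝒱ᵢ ⊕ ℒᵢ) ∧ (𝒱ⱼ ⊕ ℒⱼ) → 𝒱ₖ ⊕ ℒₖ` is holomorphic: its matrix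
coefficients are holomorphic in the trivializations given by local holomorphic sections `φ`
of `A`. -/
def Setup.IsHolHom (S : Setup M) {i j k : ℤ} (σ : ∀ x, S.wedge i j x →ₗ[ℂ] S.VL k x) : Prop :=
  ∀ (N : Set M) (φ : ∀ y, S.A.fiber y), S.A.IsHolSection N φ →
    ∀ (a : vGr i × (gr i ⧸ vGr i)) (b : vGr j × (gr j ⧸ vGr j))
      (u : ∀ x, S.VL i x) (v : ∀ x, S.VL j x),
      (∀ x ∈ N, S.coord (φ x) (u x) = a) → (∀ x ∈ N, S.coord (φ x) (v x) = b) →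
      ∀ l : Module.Dual ℂ (vGr k × (gr k ⧸ vGr k)),
        IsHolFun (fun x => l (S.coord (φ x) (σ x (S.wedgeMk (u x) (v x))))) N

end Setting

end

end G2Horo

open G2Horo

namespace G2Horo
noncomputable section
open MvPolynomial

/-! ### Weights of the maximal torus on `𝔤` -/

/-! For `q ∈ V₀`, `ad q` maps `𝔤` into `V` and kills `V`, so the unipotent radical of `G₀` acts
trivially on `Vₖ` and on `𝔤ₖ / Vₖ` (`toG_rep`). Hence the bundles `𝒱ₖ ⊕ ℒₖ` are built from `𝒲` and
`ℛ` alone. Along a curve with `f^*𝒲 ≅ 𝒪(1) ⊕ 𝒪` and `f^*ℛ ≅ 𝒪(-1)` they split into line bundles: a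
vector of weight `r^m a^n b^n'` under the maximal torus contributes `𝒪(n - m)`.

The matrix coefficient of `σ` from the weights `(m₁, n₁, n₁')`, `(m₂, n₂, n₂')` to `(m, n, n')` is
thus a global section of `𝒪(e)` with `e = (n - m) - (n₁ - m₁) - (n₂ - m₂)`, and it vanishes when `e
< 0` (`Setup.CurveFrame.cowt_homCoord_eq_zero`). At `x ∈ M'`, take independent vectors `a, a'` in
the given open set and a frame in which they are the standard basis of `W`. The curve of `a'`
exchanges the two basis vectors, so the same coefficient also vanishes when `e' = (n' - m) - (n₁' -
m₁) - (n₂' - m₂) < 0`.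

The gradation is given by the element `(2, -Id)` of `𝔤𝔩(R) ⊕ 𝔤𝔩(W)`, so a weight has degree `2m - n
- n' = -(n - m) - (n' - m)`. Therefore `e + e' = i + j - k ≤ -1`, and one of `e`, `e'` is negative:
every coefficient vanishes at `x` (`Setup.eq_zero_of_isGoodCurve`).

One frame can serve both curves because the trivial summand of `f^*𝒲` may be moved by a global
section of `𝒪(1)`, so that it passes through any prescribed vector outside the line of degree 1
(`exists_trivialization_plane`). Finally `M'` is dense by the identity theorem and the connectedness
of `M` (`IsZariskiOpen.dense`), and `σ` vanishes everywhere by continuity. -/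

instance (d : ℕ) : Module.Finite ℂ (SymW d) :=
  Module.Finite.iff_fg.mpr (homogeneousSubmodule_fg (Fin 2) ℂ d)

/-- The exponents of the monomials of degree `d` in two variables. -/
def exps (d : ℕ) : Finset (Fin 2 →₀ ℕ) := Finset.univ.finsuppAntidiag d

lemma mem_exps {d : ℕ} {m : Fin 2 →₀ ℕ} : m ∈ exps d ↔ m 0 + m 1 = d := by
  simp [exps, Finset.mem_finsuppAntidiag]

/-- The monomial with exponent `m` in `Sym^d W` (zero if `m` has another degree). -/
def mono (d : ℕ) (m : Fin 2 →₀ ℕ) : SymW d :=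
  if h : m 0 + m 1 = d then
    ⟨monomial m 1, isHomogeneous_monomial 1 (by simpa [Finsupp.degree_eq_sum] using h)⟩ else 0

lemma coe_mono {d : ℕ} {m : Fin 2 →₀ ℕ} (h : m 0 + m 1 = d) :
    (mono d m : MvPolynomial (Fin 2) ℂ) = monomial m 1 := by
  simp [mono, h]

/-- The coefficient of the monomial with exponent `m`. -/
def coeffSym (d : ℕ) (m : Fin 2 →₀ ℕ) : Module.Dual ℂ (SymW d) :=
  (lcoeff ℂ m).comp (Submodule.subtype _)

lemma coeffSym_apply (d : ℕ) (m : Fin 2 →₀ ℕ) (p : SymW d) :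
    coeffSym d m p = coeff m (p : MvPolynomial (Fin 2) ℂ) := rfl

lemma symW_eq_sum {d : ℕ} (p : SymW d) : p = ∑ m ∈ exps d, coeffSym d m p • mono d m := by
  apply Subtype.ext
  have hs : (p : MvPolynomial (Fin 2) ℂ).support ⊆ exps d := fun m hm => by
    have := p.2 (mem_support_iff.mp hm)
    rw [mem_exps]
    simpa [Finsupp.weight_apply, Finsupp.sum_fintype] using this
  conv_lhs => rw [(p : MvPolynomial (Fin 2) ℂ).as_sum]
  rw [Submodule.coe_sum, Finset.sum_subset hs fun m _ hm => by simp [notMem_support_iff.mp hm]]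
  refine Finset.sum_congr rfl fun m hm => ?_
  rw [Submodule.coe_smul, coe_mono (mem_exps.mp hm), smul_monomial, coeffSym_apply, smul_eq_mul,
    mul_one]

lemma dual_eq_sum {d : ℕ} (φ : Module.Dual ℂ (SymW d)) :
    φ = ∑ m ∈ exps d, φ (mono d m) • coeffSym d m := by
  ext1 p
  conv_lhs => rw [symW_eq_sum p]
  simp [mul_comm]

/-- The element of `GL(W)` with matrix `diag(a, b)`. -/
def diagGL (a b : ℂˣ) : GL (Fin 2) ℂ where
  val := Matrix.diagonal ![(a : ℂ), b]
  inv := Matrix.diagonal ![((a⁻¹ : ℂˣ) : ℂ), ((b⁻¹ : ℂˣ) : ℂ)]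
  val_inv := by
    ext i j
    fin_cases i <;> fin_cases j <;> simp
  inv_val := by
    ext i j
    fin_cases i <;> fin_cases j <;> simp

/-- The elements of the maximal torus of `GL(R) × GL(W)`. -/
def tor (r a b : ℂˣ) : Levi := (r, diagGL a b)

lemma diagGL_val (a b : ℂˣ) :
    (diagGL a b : Matrix (Fin 2) (Fin 2) ℂ) = Matrix.diagonal ![(a : ℂ), b] := rfl

lemma diagGL_inv (a b : ℂˣ) : (diagGL a b)⁻¹ = diagGL a⁻¹ b⁻¹ := rfl

lemma symMap_diagGL_mono (d : ℕ) (a b : ℂˣ) (m : Fin 2 →₀ ℕ) :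
    symMap d (diagGL a b : Matrix (Fin 2) (Fin 2) ℂ) (mono d m) =
      ((a : ℂ) ^ m 0 * (b : ℂ) ^ m 1) • mono d m := by
  by_cases h : m 0 + m 1 = d
  · apply Subtype.ext
    rw [Submodule.coe_smul, coe_symMap, coe_mono h, monomial_eq, C_1, one_mul,
      Finsupp.prod_fintype _ _ (by simp), Fin.prod_univ_two, map_mul, map_pow, map_pow, subst_X,
      subst_X, diagGL_val, smul_eq_C_mul]
    simp
    ring
  · simp [mono, h]

lemma coeffSym_mono {d : ℕ} {m m' : Fin 2 →₀ ℕ} (h : m' ∈ exps d) :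
    coeffSym d m (mono d m') = if m' = m then 1 else 0 := by
  rw [coeffSym_apply, coe_mono (mem_exps.mp h), coeff_monomial]

lemma coeffSym_symMap_diagGL (d : ℕ) (a b : ℂˣ) (m : Fin 2 →₀ ℕ) (p : SymW d) :
    coeffSym d m (symMap d (diagGL a b : Matrix (Fin 2) (Fin 2) ℂ) p) =
      ((a : ℂ) ^ m 0 * (b : ℂ) ^ m 1) * coeffSym d m p := by
  conv_lhs => rw [symW_eq_sum p]
  conv_rhs => rw [symW_eq_sum p]
  simp only [map_sum, map_smul, symMap_diagGL_mono, smul_eq_mul, Finset.mul_sum]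
  refine Finset.sum_congr rfl fun m' hm' => ?_
  rw [coeffSym_mono hm']
  split_ifs with h
  · subst h; ring
  · simp

/-- `x ∈ 𝔤` is a vector of weight `r^m a^n b^n'` for the maximal torus; its degree is
`2 m - n - n'`. -/
def IsWt (m n n' : ℤ) (x : GSum) : Prop :=
  (∀ r a b : ℂˣ, repLevi (tor r a b) x = ((r : ℂ) ^ m * (a : ℂ) ^ n * (b : ℂ) ^ n') • x) ∧
    degSum x = ((2 * m - n - n' : ℤ) : ℂ) • x

/-- `c` is a linear form on `𝔤` that picks up the weight `r^m a^n b^n'` of the maximal torus. -/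
def IsCowt (m n n' : ℤ) (c : Module.Dual ℂ GSum) : Prop :=
  (∀ (r a b : ℂˣ) (x : GSum),
    c (repLevi (tor r a b) x) = ((r : ℂ) ^ m * (a : ℂ) ^ n * (b : ℂ) ^ n') * c x) ∧
    ∀ x, c (degSum x) = ((2 * m - n - n' : ℤ) : ℂ) * c x

lemma repLevi_tor (r a b : ℂˣ) (x : GSum) : repLevi (tor r a b) x =
    (((r : ℂ) ^ 2 * (a * b) ^ 3 * x.1.1,
      (r : ℂ) • symMap 3 (diagGL a b : Matrix (Fin 2) (Fin 2) ℂ) x.1.2.1,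
      (x.1.2.2.1.1, fun i j => ![(a : ℂ), b] i * x.1.2.2.1.2 i j * (![(a : ℂ), b] j)⁻¹),
      (r : ℂ)⁻¹ • x.1.2.2.2.1 ∘ₗ symMap 3 (diagGL a⁻¹ b⁻¹ : Matrix (Fin 2) (Fin 2) ℂ),
      ((r : ℂ) ^ 2 * (a * b) ^ 3)⁻¹ * x.1.2.2.2.2),
    (fun i => ![(a : ℂ), b] i * x.2.1 i,
      (r : ℂ)⁻¹ • x.2.2.1 ∘ₗ symMap 2 (diagGL a⁻¹ b⁻¹ : Matrix (Fin 2) (Fin 2) ℂ),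
      fun i => ((r : ℂ) ^ 2 * (a * b) ^ 3)⁻¹ * (![(a : ℂ), b] i * x.2.2.2 i))) := by
  have hQ : chiQ (tor r a b) = (r : ℂ) ^ 2 * (a * b) ^ 3 := by
    change (r : ℂ) ^ 2 * (Matrix.diagonal ![(a : ℂ), b]).det ^ 3 = _
    simp [Matrix.det_diagonal]
  have hR : chiR (tor r a b) = r := rfl
  have hR' : chiR (tor r a b)⁻¹ = (r : ℂ)⁻¹ := by
    change ((r⁻¹ : ℂˣ) : ℂ) = _
    simp
  have h2 : (tor r a b).2 = diagGL a b := rfl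
  rw [repLevi_apply, repV0_apply, hQ, hR, hR', h2, diagGL_inv]
  simp only [LinearMap.comp_smul, diagGL_val]
  refine Prod.ext (Prod.ext rfl (Prod.ext rfl (Prod.ext (Prod.ext rfl ?_) (Prod.ext rfl rfl))))
    (Prod.ext ?_ (Prod.ext rfl ?_))
  · ext i j
    fin_cases i <;> fin_cases j <;> simp [Matrix.mul_apply, mul_assoc]
  · ext i
    change Matrix.mulVec (Matrix.diagonal _) x.2.1 i = _
    rw [Matrix.mulVec_diagonal]
  · ext i
    change _ * Matrix.mulVec (Matrix.diagonal _) x.2.2.2 i = _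
    rw [Matrix.mulVec_diagonal]

/-- The vectors that lie in a weight space of the maximal torus. -/
def wtVectors : Set GSum := {x | ∃ m n n' : ℤ, IsWt m n n' x}

lemma mem_span_wtVectors_of_mem {m n n' : ℤ} {x : GSum} (h : IsWt m n n' x) :
    x ∈ Submodule.span ℂ wtVectors := Submodule.subset_span ⟨m, n, n', h⟩

lemma dual_comp_symMap (d : ℕ) (m : Fin 2 →₀ ℕ) (a b : ℂˣ) :
    coeffSym d m ∘ₗ symMap d (diagGL a⁻¹ b⁻¹ : Matrix (Fin 2) (Fin 2) ℂ) =
      ((a : ℂ) ^ (-(m 0 : ℤ)) * (b : ℂ) ^ (-(m 1 : ℤ))) • coeffSym d m := by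
  ext1 p
  rw [LinearMap.comp_apply, coeffSym_symMap_diagGL]
  simp

lemma weight_Q (r a b : ℂˣ) : (r : ℂ) ^ 2 * ((a : ℂ) * b) ^ 3 =
    (r : ℂ) ^ (2 : ℤ) * (a : ℂ) ^ (3 : ℤ) * (b : ℂ) ^ (3 : ℤ) := by
  simp only [zpow_ofNat]; ring

lemma weight_Qd (r a b : ℂˣ) : ((r : ℂ) ^ 2 * ((a : ℂ) * b) ^ 3)⁻¹ =
    (r : ℂ) ^ (-2 : ℤ) * (a : ℂ) ^ (-3 : ℤ) * (b : ℂ) ^ (-3 : ℤ) := by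
  rw [weight_Q]
  simp only [mul_inv, zpow_neg]

lemma isWt_symPart {m : Fin 2 →₀ ℕ} (hm : m ∈ exps 3) :
    IsWt 1 (m 0) (m 1) ((0, mono 3 m, 0), 0) := by
  refine ⟨fun r a b => ?_, ?_⟩
  · rw [repLevi_tor]
    ext1
    · simp [symMap_diagGL_mono, smul_smul, mul_assoc]
      rfl
    · simp
      rfl
  · have h : (2 * 1 - m 0 - m 1 : ℤ) = -1 := by have := mem_exps.mp hm; omega
    rw [degSum_apply, h]
    simp

lemma isWt_dualPart {m : Fin 2 →₀ ℕ} (hm : m ∈ exps 3) :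
    IsWt (-1) (-(m 0 : ℤ)) (-(m 1 : ℤ)) ((0, 0, 0, coeffSym 3 m, 0), 0) := by
  refine ⟨fun r a b => ?_, ?_⟩
  · rw [repLevi_tor]
    ext1
    · simp [dual_comp_symMap, smul_smul, mul_assoc]
      rfl
    · simp
      rfl
  · have h : (2 * -1 - -(m 0 : ℤ) - -(m 1 : ℤ) : ℤ) = 1 := by have := mem_exps.mp hm; omega
    rw [degSum_apply, h]
    simp

lemma isWt_dualPart' {m : Fin 2 →₀ ℕ} (hm : m ∈ exps 2) :
    IsWt (-1) (-(m 0 : ℤ)) (-(m 1 : ℤ)) (0, (0, coeffSym 2 m, 0)) := by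
  refine ⟨fun r a b => ?_, ?_⟩
  · rw [repLevi_tor]
    ext1
    · simp
      rfl
    · simp [dual_comp_symMap, smul_smul, mul_assoc]
      rfl
  · have h : (2 * -1 - -(m 0 : ℤ) - -(m 1 : ℤ) : ℤ) = 0 := by have := mem_exps.mp hm; omega
    rw [degSum_apply, h]
    simp

lemma isWt_Q : IsWt 2 3 3 ((1, 0), 0) := by
  refine ⟨fun r a b => ?_, ?_⟩
  · rw [repLevi_tor, weight_Q]
    ext1
    · simp
      rfl
    · simp
      rfl
  · rw [degSum_apply]
    norm_num

lemma isWt_Qd : IsWt (-2) (-3) (-3) ((0, 0, 0, 0, 1), 0) := by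
  refine ⟨fun r a b => ?_, ?_⟩
  · rw [repLevi_tor, weight_Qd]
    ext1
    · simp
      rfl
    · simp
      rfl
  · rw [degSum_apply]
    norm_num

lemma isWt_glR : IsWt 0 0 0 ((0, 0, (1, 0), 0, 0), 0) := by
  refine ⟨fun r a b => ?_, ?_⟩
  · rw [repLevi_tor]
    ext1
    · simp
      rfl
    · simp
      rfl
  · rw [degSum_apply]
    norm_num

/-- The exponent of the `c`-th coordinate of the torus of `GL(W)` in the weight of `eᵢ`. -/
def unitWt (i c : Fin 2) : ℤ := if i = c then 1 else 0

lemma unitWt_apply (i : Fin 2) (a b : ℂˣ) :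
    ![(a : ℂ), b] i = (a : ℂ) ^ unitWt i 0 * (b : ℂ) ^ unitWt i 1 := by
  fin_cases i <;> simp [unitWt]

lemma unitWt_add (i : Fin 2) : unitWt i 0 + unitWt i 1 = 1 := by
  fin_cases i <;> simp [unitWt]

lemma isWt_glW (i j : Fin 2) : IsWt 0 (unitWt i 0 - unitWt j 0) (unitWt i 1 - unitWt j 1)
    ((0, 0, (0, Matrix.single i j 1), 0, 0), 0) := by
  refine ⟨fun r a b => ?_, ?_⟩
  · rw [repLevi_tor, zpow_sub₀ a.ne_zero, zpow_sub₀ b.ne_zero]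
    ext1
    · simp only [smul_zero, mul_zero, LinearMap.zero_comp, map_zero, Prod.smul_mk]
      refine congrArg (fun Z => ((0, 0, (0, Z), 0, 0) : LPart)) ?_
      ext i' j'
      rw [unitWt_apply, unitWt_apply]
      by_cases hi : i' = i
      · by_cases hj : j' = j
        · subst hi hj
          simp
          field_simp
        · simp [Ne.symm hj]
      · simp [Ne.symm hi]
    · simp
      rfl
  · have h : (2 * 0 - (unitWt i 0 - unitWt j 0) - (unitWt i 1 - unitWt j 1) : ℤ) = 0 := by
      linear_combination unitWt_add j - unitWt_add i
    rw [degSum_apply, h]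
    norm_num

lemma isWt_W (i : Fin 2) : IsWt 0 (unitWt i 0) (unitWt i 1) (0, (Pi.single i 1, 0, 0)) := by
  refine ⟨fun r a b => ?_, ?_⟩
  · rw [repLevi_tor]
    ext1
    · simp
      rfl
    · simp [unitWt_apply]
      refine ⟨?_, rfl⟩
      ext i'
      by_cases hi : i' = i
      · subst hi
        simp
      · simp [hi]
  · have h : (2 * 0 - unitWt i 0 - unitWt i 1 : ℤ) = -1 := by
      linear_combination - unitWt_add i
    rw [degSum_apply, h]
    norm_num

lemma isWt_QdW (i : Fin 2) :
    IsWt (-2) (-3 + unitWt i 0) (-3 + unitWt i 1) (0, (0, 0, Pi.single i 1)) := by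
  refine ⟨fun r a b => ?_, ?_⟩
  · rw [repLevi_tor, weight_Qd, zpow_add₀ a.ne_zero, zpow_add₀ b.ne_zero]
    ext1
    · simp
      rfl
    · simp [unitWt_apply]
      refine ⟨rfl, ?_⟩
      ext i'
      by_cases hi : i' = i
      · subst hi
        simp
        ring
      · simp [hi]
  · have h : (2 * -2 - (-3 + unitWt i 0) - (-3 + unitWt i 1) : ℤ) = 1 := by
      linear_combination - unitWt_add i
    rw [degSum_apply, h]
    norm_num

/-- Each of the nine summands of `𝔤` has a basis of torus eigenvectors: monomials, dual monomials,
matrix units and unit vectors. A bilinear map on `𝔤` is therefore determined by its values on weight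
vectors. -/
lemma span_wtVectors : Submodule.span ℂ wtVectors = ⊤ := by
  rw [eq_top_iff]
  rintro ⟨⟨a, p, ⟨c, Y⟩, φ, b⟩, w, q, w'⟩ -
  have hx : (((a, p, (c, Y), φ, b), w, q, w') : GSum) =
      a • ((1, 0), 0) + ∑ m ∈ exps 3, coeffSym 3 m p • ((0, mono 3 m, 0), 0)
      + c • ((0, 0, (1, 0), 0, 0), 0)
      + ∑ i, ∑ j, Y i j • ((0, 0, (0, Matrix.single i j 1), 0, 0), 0)
      + ∑ m ∈ exps 3, φ (mono 3 m) • ((0, 0, 0, coeffSym 3 m, 0), 0)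
      + b • ((0, 0, 0, 0, 1), 0)
      + ∑ i, w i • (0, (Pi.single i 1, 0, 0))
      + ∑ m ∈ exps 2, q (mono 2 m) • (0, (0, coeffSym 2 m, 0))
      + ∑ i, w' i • (0, (0, 0, Pi.single i 1)) := by
    have hY : Y = ∑ i, ∑ j, Y i j • Matrix.single i j (1 : ℂ) := by
      ext i j
      fin_cases i <;> fin_cases j <;> simp [Fin.sum_univ_two]
    have hw (w : W) : w = ∑ i, w i • Pi.single i (1 : ℂ) := by
      ext i
      fin_cases i <;> simp [Fin.sum_univ_two]
    simp only [Prod.ext_iff, Prod.fst_add, Prod.snd_add, Prod.fst_sum, Prod.snd_sum, Prod.smul_fst,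
      Prod.smul_snd, smul_zero, Finset.sum_const_zero, add_zero,
      zero_add, mul_zero, ← symW_eq_sum, ← dual_eq_sum, ← hY, ← hw, smul_eq_mul, mul_one, and_self]
  rw [hx]
  refine add_mem (add_mem (add_mem (add_mem (add_mem (add_mem (add_mem (add_mem ?_ ?_) ?_) ?_) ?_)
    ?_) ?_) ?_) ?_
  · exact Submodule.smul_mem _ _ (mem_span_wtVectors_of_mem isWt_Q)
  · exact Submodule.sum_mem _ fun m hm =>
      Submodule.smul_mem _ _ (mem_span_wtVectors_of_mem (isWt_symPart hm))
  · exact Submodule.smul_mem _ _ (mem_span_wtVectors_of_mem isWt_glR)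
  · exact Submodule.sum_mem _ fun i _ => Submodule.sum_mem _ fun j _ =>
      Submodule.smul_mem _ _ (mem_span_wtVectors_of_mem (isWt_glW i j))
  · exact Submodule.sum_mem _ fun m hm =>
      Submodule.smul_mem _ _ (mem_span_wtVectors_of_mem (isWt_dualPart hm))
  · exact Submodule.smul_mem _ _ (mem_span_wtVectors_of_mem isWt_Qd)
  · exact Submodule.sum_mem _ fun i _ =>
      Submodule.smul_mem _ _ (mem_span_wtVectors_of_mem (isWt_W i))
  · exact Submodule.sum_mem _ fun m hm =>
      Submodule.smul_mem _ _ (mem_span_wtVectors_of_mem (isWt_dualPart' hm))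
  · exact Submodule.sum_mem _ fun i _ =>
      Submodule.smul_mem _ _ (mem_span_wtVectors_of_mem (isWt_QdW i))

lemma coeffSym_eq_zero {d : ℕ} {p : SymW d} (h : ∀ m ∈ exps d, coeffSym d m p = 0) : p = 0 := by
  rw [symW_eq_sum p]
  exact Finset.sum_eq_zero fun m hm => by rw [h m hm, zero_smul]

lemma apply_mono_eq_zero {d : ℕ} {φ : Module.Dual ℂ (SymW d)}
    (h : ∀ m ∈ exps d, φ (mono d m) = 0) : φ = 0 := by
  rw [dual_eq_sum φ]
  exact Finset.sum_eq_zero fun m hm => by rw [h m hm, zero_smul]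

/-- The linear forms of pure weight separate the points of `𝔤`. -/
lemma eq_zero_of_isCowt (x : GSum) (h : ∀ m n n' c, IsCowt m n n' c → c x = 0) : x = 0 := by
  obtain ⟨⟨a, p, ⟨c, Y⟩, φ, b⟩, w, q, w'⟩ := x
  -- The forms used are the coordinates in the weight basis. The form dual to a basis vector picks
  -- up the weight of that vector itself, since it is evaluated after the torus has acted.
  have ha : a = 0 := h 2 3 3 (LinearMap.fst _ _ _ ∘ₗ LinearMap.fst _ _ _) <| by
    refine ⟨fun r a b x => ?_, fun x => ?_⟩
    · change (repLevi (tor r a b) x).1.1 = _ * x.1.1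
      rw [repLevi_tor, weight_Q]
    · simp [degSum_apply]
  have hp : p = 0 := coeffSym_eq_zero fun m hm =>
    h 1 (m 0) (m 1) (coeffSym 3 m ∘ₗ LinearMap.fst _ _ _ ∘ₗ LinearMap.snd _ _ _ ∘ₗ
      LinearMap.fst _ _ _) <| by
    refine ⟨fun r a b x => ?_, fun x => ?_⟩
    · change coeffSym 3 m (repLevi (tor r a b) x).1.2.1 = _ * coeffSym 3 m x.1.2.1
      simp [repLevi_tor, coeffSym_symMap_diagGL, mul_assoc]
    · have h : (2 * 1 - m 0 - m 1 : ℤ) = -1 := by have := mem_exps.mp hm; omega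
      rw [h]
      simp [degSum_apply]
  have hc : c = 0 := h 0 0 0 (LinearMap.fst _ _ _ ∘ₗ LinearMap.fst _ _ _ ∘ₗ LinearMap.snd _ _ _ ∘ₗ
      LinearMap.snd _ _ _ ∘ₗ LinearMap.fst _ _ _) <| by
    refine ⟨fun r a b x => ?_, fun x => ?_⟩
    · change (repLevi (tor r a b) x).1.2.2.1.1 = _ * x.1.2.2.1.1
      simp [repLevi_tor]
    · simp [degSum_apply]
  have hY : Y = 0 := by
    ext i j
    refine h 0 (unitWt i 0 - unitWt j 0) (unitWt i 1 - unitWt j 1)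
      (Matrix.entryLinearMap ℂ ℂ i j ∘ₗ LinearMap.snd _ _ _ ∘ₗ LinearMap.fst _ _ _ ∘ₗ
        LinearMap.snd _ _ _ ∘ₗ LinearMap.snd _ _ _ ∘ₗ LinearMap.fst _ _ _) ?_
    refine ⟨fun r a b x => ?_, fun x => ?_⟩
    · change (repLevi (tor r a b) x).1.2.2.1.2 i j = _ * x.1.2.2.1.2 i j
      simp [repLevi_tor, unitWt_apply, zpow_sub₀ a.ne_zero, zpow_sub₀ b.ne_zero]
      ring
    · have h : (2 * 0 - (unitWt i 0 - unitWt j 0) - (unitWt i 1 - unitWt j 1) : ℤ) = 0 := by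
        linear_combination unitWt_add j - unitWt_add i
      rw [h]
      simp [degSum_apply]
  have hφ : φ = 0 := apply_mono_eq_zero fun m hm =>
    h (-1) (-(m 0 : ℤ)) (-(m 1 : ℤ)) (LinearMap.applyₗ (mono 3 m) ∘ₗ LinearMap.fst _ _ _ ∘ₗ
      LinearMap.snd _ _ _ ∘ₗ LinearMap.snd _ _ _ ∘ₗ LinearMap.snd _ _ _ ∘ₗ
      LinearMap.fst _ _ _) <| by
    refine ⟨fun r a b x => ?_, fun x => ?_⟩
    · change (repLevi (tor r a b) x).1.2.2.2.1 (mono 3 m) = _ * x.1.2.2.2.1 (mono 3 m)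
      simp [repLevi_tor, symMap_diagGL_mono, mul_assoc]
    · have h : (2 * -1 - -(m 0 : ℤ) - -(m 1 : ℤ) : ℤ) = 1 := by have := mem_exps.mp hm; omega
      rw [h]
      simp [degSum_apply]
  have hb : b = 0 := h (-2) (-3) (-3) (LinearMap.snd _ _ _ ∘ₗ LinearMap.snd _ _ _ ∘ₗ
      LinearMap.snd _ _ _ ∘ₗ LinearMap.snd _ _ _ ∘ₗ LinearMap.fst _ _ _) <| by
    refine ⟨fun r a b x => ?_, fun x => ?_⟩
    · change (repLevi (tor r a b) x).1.2.2.2.2 = _ * x.1.2.2.2.2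
      rw [repLevi_tor, weight_Qd]
    · simp [degSum_apply]
  have hw : w = 0 := by
    ext i
    refine h 0 (unitWt i 0) (unitWt i 1)
      (LinearMap.proj i ∘ₗ LinearMap.fst _ _ _ ∘ₗ LinearMap.snd _ _ _) ?_
    refine ⟨fun r a b x => ?_, fun x => ?_⟩
    · change (repLevi (tor r a b) x).2.1 i = _ * x.2.1 i
      simp [repLevi_tor, unitWt_apply]
    · have h : (2 * 0 - unitWt i 0 - unitWt i 1 : ℤ) = -1 := by
        linear_combination - unitWt_add i
      rw [h]
      simp [degSum_apply]
  have hq : q = 0 := apply_mono_eq_zero fun m hm =>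
    h (-1) (-(m 0 : ℤ)) (-(m 1 : ℤ)) (LinearMap.applyₗ (mono 2 m) ∘ₗ LinearMap.fst _ _ _ ∘ₗ
      LinearMap.snd _ _ _ ∘ₗ LinearMap.snd _ _ _) <| by
    refine ⟨fun r a b x => ?_, fun x => ?_⟩
    · change (repLevi (tor r a b) x).2.2.1 (mono 2 m) = _ * x.2.2.1 (mono 2 m)
      simp [repLevi_tor, symMap_diagGL_mono, mul_assoc]
    · have h : (2 * -1 - -(m 0 : ℤ) - -(m 1 : ℤ) : ℤ) = 0 := by have := mem_exps.mp hm; omega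
      rw [h]
      simp [degSum_apply]
  have hw' : w' = 0 := by
    ext i
    refine h (-2) (-3 + unitWt i 0) (-3 + unitWt i 1)
      (LinearMap.proj i ∘ₗ LinearMap.snd _ _ _ ∘ₗ LinearMap.snd _ _ _ ∘ₗ LinearMap.snd _ _ _) ?_
    refine ⟨fun r a b x => ?_, fun x => ?_⟩
    · change (repLevi (tor r a b) x).2.2.2 i = _ * x.2.2.2 i
      rw [repLevi_tor, weight_Qd, zpow_add₀ a.ne_zero, zpow_add₀ b.ne_zero]
      simp [unitWt_apply]
      ring
    · have h : (2 * -2 - (-3 + unitWt i 0) - (-3 + unitWt i 1) : ℤ) = 1 := by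
        linear_combination - unitWt_add i
      rw [h]
      simp [degSum_apply]
  rw [ha, hp, hc, hY, hφ, hb, hw, hq, hw']
  rfl

/-! ### The `G₀`-modules `Vₖ ⊕ 𝔤ₖ / Vₖ` as pieces of `𝔤` -/

/-- The projection `𝔤 → V`. -/
def projV : LieG →ₗ[ℂ] VPart := LinearMap.snd ℂ LPart VPart

/-- The identity or zero, according to whether `k = l`. -/
def diagProj (k l : ℤ) (U : Type) [AddCommGroup U] [Module ℂ U] : Module.End ℂ U :=
  if k = l then LinearMap.id else 0

lemma diagProj_comm (k l : ℤ) {U U' : Type} [AddCommGroup U] [Module ℂ U] [AddCommGroup U']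
    [Module ℂ U'] (T : U →ₗ[ℂ] U') (u : U) : diagProj k l U' (T u) = T (diagProj k l U u) := by
  unfold diagProj
  split_ifs <;> simp

/-- The hypothesis amounts to `(l - c) u = 0`, so either `l = c` or `u = 0`; both cases give the
value. This avoids any case distinction on the degree when a block of `𝔤` is zero. -/
lemma diagProj_eq {k l : ℤ} {U : Type} [AddCommGroup U] [Module ℂ U] {c : ℤ} {u : U}
    (h : (l : ℂ) • u = (c : ℂ) • u) : diagProj k l U u = if k = c then u else 0 := by
  rw [← sub_eq_zero, ← sub_smul, smul_eq_zero, sub_eq_zero, Int.cast_inj] at h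
  unfold diagProj
  rcases h with rfl | rfl
  · split_ifs <;> simp
  · simp

/-- The projection of `𝔤` to its piece of degree `k`. -/
def degProj (k : ℤ) : Module.End ℂ GSum :=
  ((diagProj k (-2) _).prodMap ((diagProj k (-1) _).prodMap ((diagProj k 0 _).prodMap
    ((diagProj k 1 _).prodMap (diagProj k 2 _))))).prodMap
      ((diagProj k (-1) _).prodMap ((diagProj k 0 _).prodMap (diagProj k 1 _)))

lemma degProj_apply (k : ℤ) (x : GSum) : degProj k x =
    ((diagProj k (-2) _ x.1.1, diagProj k (-1) _ x.1.2.1, diagProj k 0 _ x.1.2.2.1,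
      diagProj k 1 _ x.1.2.2.2.1, diagProj k 2 _ x.1.2.2.2.2),
    (diagProj k (-1) _ x.2.1, diagProj k 0 _ x.2.2.1, diagProj k 1 _ x.2.2.2)) := rfl

lemma degProj_eq {k l : ℤ} {x : GSum} (h : degSum x = (l : ℂ) • x) :
    degProj k x = if k = l then x else 0 := by
  simp only [degSum_apply, Prod.ext_iff, Prod.smul_fst, Prod.smul_snd] at h
  obtain ⟨⟨h1, h2, ⟨h3, h3'⟩, h4, h5⟩, h6, h7, h8⟩ := h
  rw [degProj_apply, diagProj_eq (l := -2) (c := l) (by simpa using h1),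
    diagProj_eq (l := -1) (c := l) (u := x.1.2.1) (by rw [← h2]; simp only [Int.cast_neg, Int.cast_one]),
    diagProj_eq (l := 0) (c := l) (u := x.1.2.2.1)
      (by rw [Prod.ext_iff]; exact ⟨by simpa using h3, by simpa using h3'⟩),
    diagProj_eq (l := 1) (c := l) (by simpa using h4),
    diagProj_eq (l := 2) (c := l) (by simpa using h5),
    diagProj_eq (l := -1) (c := l) (by simpa using h6),
    diagProj_eq (l := 0) (c := l) (by simpa using h7),
    diagProj_eq (l := 1) (c := l) (by simpa using h8)]
  split_ifs <;> rfl

lemma degSum_degProj (k : ℤ) (x : GSum) : degSum (degProj k x) = (k : ℂ) • degProj k x := by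
  have key (l : ℤ) (U : Type) [AddCommGroup U] [Module ℂ U] (u : U) :
      (l : ℂ) • diagProj k l U u = (k : ℂ) • diagProj k l U u := by
    unfold diagProj
    split_ifs with h
    · rw [h]
    · simp
  have e1 := key (-2) _ x.1.1
  have e2 := key (-1) _ x.1.2.1
  have e3 := key 0 _ x.1.2.2.1
  have e4 := key 1 _ x.1.2.2.2.1
  have e5 := key 2 _ x.1.2.2.2.2
  have e6 := key (-1) _ x.2.1
  have e7 := key 0 _ x.2.2.1
  have e8 := key 1 _ x.2.2.2
  push_cast at e1 e2 e3 e4 e5 e6 e7 e8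
  rw [degSum_apply, degProj_apply]
  simp only [e1, e2, e3, e4, e5, e6, e7, e8]
  rfl

lemma degProj_repLevi (k : ℤ) (g : Levi) (x : GSum) :
    degProj k (repLevi g x) = repLevi g (degProj k x) := by
  have e : repLevi g x = ((charRep chiQ g x.1.1, twist chiR (repSym 3) g x.1.2.1,
      repGl g x.1.2.2.1, (twist chiR (repSym 3)).dual g x.1.2.2.2.1,
      charRep chiQd g x.1.2.2.2.2), (repW g x.2.1, repV0 g x.2.2.1,
      twist chiQd repW g x.2.2.2)) := rfl
  rw [e, degProj_apply]
  simp only [diagProj_comm]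
  rfl

/-- The inclusion of `Vₖ ⊕ 𝔤ₖ / Vₖ` in `𝔤`. -/
def toG (k : ℤ) : (vGr k × (gr k ⧸ vGr k)) →ₗ[ℂ] GSum :=
  ((vGr k).liftQ (projL ∘ₗ (gr k).subtype) le_rfl ∘ₗ LinearMap.snd ℂ _ _).prod
    (projV ∘ₗ (gr k).subtype ∘ₗ (vGr k).subtype ∘ₗ LinearMap.fst ℂ _ _)

lemma toG_mk (k : ℤ) (v : vGr k) (y : gr k) :
    toG k (v, Submodule.Quotient.mk y) = (projL y, projV (v : gr k)) := rfl

lemma toG_injective (k : ℤ) : Function.Injective (toG k) := by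
  rw [← LinearMap.ker_eq_bot, LinearMap.ker_eq_bot']
  rintro ⟨v, y⟩ h
  induction y using Submodule.Quotient.induction_on with
  | _ y =>
  rw [toG_mk, Prod.ext_iff] at h
  ext1
  · apply Subtype.ext
    apply Subtype.ext
    exact Prod.ext v.2 h.2
  · exact (Submodule.Quotient.mk_eq_zero _).mpr h.1

lemma repGSum_apply_fst (g : G0) (x : GSum) (b : VPart) :
    (repGSum g x).1 = (repLevi g.right (x.1, b)).1 := by
  rw [repGSum_apply, adV0_apply, repLevi_apply, repLevi_apply]
  simp

lemma repGSum_apply_snd (g : G0) (x : GSum) (a : LPart) (h : x.1 = 0) :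
    (repGSum g x).2 = (repLevi g.right (a, x.2)).2 := by
  rw [repGSum_apply, adV0_apply, repLevi_apply, repLevi_apply, h]
  simp

lemma repGSum_fst_snd (g : G0) (x z : GSum) (h : z.1 = 0) :
    ((repGSum g x).1, (repGSum g z).2) = repLevi g.right (x.1, z.2) := by
  rw [repGSum_apply_fst g x z.2, repGSum_apply_snd g z x.1 h]

/-- The operator `ad q` has image in `V` and kills `V`. It is thus invisible both on the submodule
and on the quotient, and only the Levi component of `g` remains. -/
lemma toG_rep (k : ℤ) (g : G0) (v : vGr k) (y : gr k ⧸ vGr k) :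
    toG k (repV k g v, repL k g y) = repLevi g.right (toG k (v, y)) := by
  induction y using Submodule.Quotient.induction_on with
  | _ y =>
  rw [toG_mk]
  have h1 : toG k (repV k g v, repL k g (Submodule.Quotient.mk y)) =
    ((repGSum g (y : LieG)).1, (repGSum g ((v : gr k) : LieG)).2) := rfl
  exact h1.trans (repGSum_fst_snd g y.1 v.1.1 v.2)

lemma mem_gr_iff {k : ℤ} {x : LieG} : x ∈ gr k ↔ degSum x = (k : ℂ) • (x : GSum) :=
  Module.End.mem_eigenspace_iff

lemma degSum_toG (k : ℤ) (s : vGr k × (gr k ⧸ vGr k)) :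
    degSum (toG k s) = (k : ℂ) • toG k s := by
  obtain ⟨v, y⟩ := s
  induction y using Submodule.Quotient.induction_on with
  | _ y =>
  have h1 : (degSum (y : LieG)).1 = (k : ℂ) • projL (y : LieG) :=
    congrArg (fun z : GSum => z.1) (mem_gr_iff.mp y.2)
  have h2 : (degSum ((v : gr k) : LieG)).2 = (k : ℂ) • projV ((v : gr k) : LieG) :=
    congrArg (fun z : GSum => z.2) (mem_gr_iff.mp v.1.2)
  rw [toG_mk, Prod.smul_mk, ← h1, ← h2]
  rfl

lemma degSum_zero_snd {k : ℤ} {x : GSum} (h : degSum x = (k : ℂ) • x) :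
    degSum (0, x.2) = (k : ℂ) • ((0, x.2) : GSum) := by
  have h2 : (degSum x).2 = (k : ℂ) • x.2 := congrArg (fun z : GSum => z.2) h
  rw [Prod.smul_mk, ← h2, smul_zero, degSum_apply, degSum_apply]
  simp

/-- The projection of `𝔤` to `Vₖ ⊕ 𝔤ₖ / Vₖ`. -/
def ofG (k : ℤ) : GSum →ₗ[ℂ] (vGr k × (gr k ⧸ vGr k)) :=
  LinearMap.prod
    (LinearMap.codRestrict (vGr k) (LinearMap.codRestrict (gr k)
      (LinearMap.inr ℂ LPart VPart ∘ₗ LinearMap.snd ℂ LPart VPart ∘ₗ degProj k)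
      fun x => mem_gr_iff.mpr (degSum_zero_snd (degSum_degProj k x)))
      fun _ => rfl)
    ((vGr k).mkQ ∘ₗ LinearMap.codRestrict (gr k) (degProj k)
      fun x => mem_gr_iff.mpr (degSum_degProj k x))

lemma toG_ofG (k : ℤ) (x : GSum) : toG k (ofG k x) = degProj k x := rfl

lemma ofG_toG (k : ℤ) (s : vGr k × (gr k ⧸ vGr k)) : ofG k (toG k s) = s := by
  apply toG_injective
  rw [toG_ofG, degProj_eq (degSum_toG k s), if_pos rfl]

/-! ### The coordinate on `W = V₋₁` -/

/-- The identification of `V₋₁` with `W`. -/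
def wCoord : vGr (-1) →ₗ[ℂ] W :=
  LinearMap.fst ℂ W _ ∘ₗ projV ∘ₗ (gr (-1)).subtype ∘ₗ (vGr (-1)).subtype

lemma wCoord_eq (v : vGr (-1)) : wCoord v = (toG (-1) (v, 0)).2.1 := rfl

lemma wCoord_rep (g : G0) (v : vGr (-1)) :
    wCoord (repV (-1) g v) = (g.right.2 : Matrix (Fin 2) (Fin 2) ℂ).mulVec (wCoord v) := by
  have h := toG_rep (-1) g v 0
  rw [map_zero] at h
  rw [wCoord_eq, h, repLevi_apply, wCoord_eq]

/-- A vector of `V₋₁` has degree `-1`, whereas the second and third components of `VPart` have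
degrees `0` and `1`. Those components vanish, and the one in `W` determines the vector. -/
lemma wCoord_injective : Function.Injective wCoord := by
  rw [← LinearMap.ker_eq_bot, LinearMap.ker_eq_bot']
  intro v hv
  rw [wCoord_eq] at hv
  have h0 : (toG (-1) (v, 0)).1 = 0 := rfl
  have hd := degSum_toG (-1) (v, 0)
  have hv' : toG (-1) (v, 0) = 0 := by
    generalize toG (-1) (v, 0) = x at *
    obtain ⟨l, w, q, w'⟩ := x
    dsimp only at hv h0
    subst hv h0
    simp only [degSum_apply, Prod.ext_iff, Prod.smul_fst, Prod.smul_snd] at hd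
    have h1 := hd.2.2.1
    have h2 := hd.2.2.2
    simp only [zero_smul, Int.cast_neg, Int.cast_one, one_smul, neg_smul] at h1 h2
    rw [eq_comm, neg_eq_zero] at h1
    rw [self_eq_neg] at h2
    rw [h1, h2]
    rfl
  exact congrArg Prod.fst (toG_injective _ (hv'.trans (map_zero _).symm))

lemma wCoord_surjective : Function.Surjective wCoord := by
  intro w
  refine ⟨(ofG (-1) (0, (w, 0, 0))).1, ?_⟩
  have h : degSum (0, (w, 0, 0)) = ((-1 : ℤ) : ℂ) • ((0, (w, 0, 0)) : GSum) := by
    rw [degSum_apply]; simp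
  have h2 : wCoord (ofG (-1) (0, (w, 0, 0))).1 = (toG (-1) (ofG (-1) (0, (w, 0, 0)))).2.1 := rfl
  rw [h2, toG_ofG, degProj_eq h, if_pos rfl]

lemma symMap_mul_inv (d : ℕ) (A : GL (Fin 2) ℂ) (p : SymW d) :
    symMap d ((A⁻¹ : GL (Fin 2) ℂ) : Matrix (Fin 2) (Fin 2) ℂ)
      (symMap d (A : Matrix (Fin 2) (Fin 2) ℂ) p) = p := by
  rw [← Module.End.mul_apply, ← map_mul, ← Units.val_mul, inv_mul_cancel, Units.val_one, map_one]
  rfl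

/-- An element of `G₀` is determined up to `V₀` by its action on `𝔤₋₁`. -/
lemma right_eq_of_repGr_eq {g g' : G0} (h : ∀ u, repGr (-1) g u = repGr (-1) g' u) :
    g.right = g'.right := by
  have key (x : GSum) (hx : degSum x = ((-1 : ℤ) : ℂ) • x) : repGSum g x = repGSum g' x :=
    congrArg Subtype.val (h ⟨x, mem_gr_iff.mpr hx⟩)
  have hA : g.right.2 = g'.right.2 := by
    apply Units.ext
    refine Matrix.ext_of_mulVec_single fun j => ?_
    have h1 := congrArg (fun z : GSum => z.2.1) (key (0, (Pi.single j 1, 0, 0))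
      (by rw [degSum_apply]; simp))
    rw [repGSum_apply_snd g _ 0 rfl, repGSum_apply_snd g' _ 0 rfl] at h1
    exact h1
  -- The matrices agree by now, so that the action on `e₀³` modulo `V` compares the two scalars of
  -- `GL(R)`.
  have hR : chiR g.right = chiR g'.right := by
    have h1 := congrArg (fun z : GSum => z.1.2.1) (key ((0, symPow 3 (Pi.single 0 1), 0), 0)
      (by rw [degSum_apply]; simp))
    rw [repGSum_apply_fst g _ 0, repGSum_apply_fst g' _ 0, repLevi_apply, repLevi_apply, hA] at h1
    have h2 := congrArg
      (symMap 3 ((g'.right.2⁻¹ : GL (Fin 2) ℂ) : Matrix (Fin 2) (Fin 2) ℂ)) h1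
    rw [map_smul, map_smul, symMap_mul_inv] at h2
    have h3 : chiR g.right • symPow 3 (Pi.single 0 1) = chiR g'.right • symPow 3 (Pi.single 0 1) :=
      h2
    refine smul_left_injective ℂ (fun h4 : symPow 3 (Pi.single 0 1) = 0 => ?_) h3
    have h5 : form (Pi.single 0 1) ^ 3 = 0 := congrArg Subtype.val h4
    simp [form] at h5
  exact Prod.ext (Units.ext hR) hA

/-! ### Associated bundles in the coordinates given by a frame -/

section Manifold

variable {M : Type*} [TopologicalSpace M] [ChartedSpace Model M] [IsManifold 𝓘(ℂ, Model) ω M]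

section Assoc

variable {D : ∀ x : M, Submodule ℂ (TangentSpace 𝓘(ℂ, Model) x)} (A : G0Structure D)

/-- The right action of `G₀` on the fibres of a `G₀`-structure. -/
def G0Structure.act {x : M} (p : A.fiber x) (g : G0) : A.fiber x :=
  ⟨(p : GrFrame D x).act g, A.act_mem x p p.2 g⟩

lemma GrFrame.ext_of {x : M} {p p' : GrFrame D x} (h1 : p.neg1 = p'.neg1) (h2 : p.neg2 = p'.neg2) :
    p = p' := by
  cases p; cases p'; congr

lemma GrFrame.act_act {x : M} (p : GrFrame D x) (g h : G0) :
    (p.act g).act h = p.act (g * h) := by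
  refine GrFrame.ext_of (LinearEquiv.ext fun u => ?_) (LinearEquiv.ext fun u => ?_)
  · change p.neg1 (repGr (-1) g (repGr (-1) h u)) = p.neg1 (repGr (-1) (g * h) u)
    rw [map_mul, Module.End.mul_apply]
  · change p.neg2 (repGr (-2) g (repGr (-2) h u)) = p.neg2 (repGr (-2) (g * h) u)
    rw [map_mul, Module.End.mul_apply]

lemma G0Structure.act_act {x : M} (p : A.fiber x) (g h : G0) :
    A.act (A.act p g) h = A.act p (g * h) :=
  Subtype.ext (GrFrame.act_act _ _ _)

lemma G0Structure.exists_eq_act {x : M} (p p' : A.fiber x) : ∃ g, p' = A.act p g := by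
  obtain ⟨g, hg⟩ := A.exists_act x p p.2 p' p'.2
  exact ⟨g, Subtype.ext hg⟩

lemma G0Structure.right_eq_of_act_eq {x : M} {p : A.fiber x} {g g' : G0}
    (h : A.act p g = A.act p g') : g.right = g'.right := by
  apply right_eq_of_repGr_eq
  intro u
  have h1 : (p : GrFrame D x).act g = (p : GrFrame D x).act g' := congrArg Subtype.val h
  have h2 : (p : GrFrame D x).neg1 (repGr (-1) g u) = (p : GrFrame D x).neg1 (repGr (-1) g' u) :=
    congrArg (fun q : GrFrame D x => q.neg1 u) h1
  exact (p : GrFrame D x).neg1.injective h2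

variable {A} {U : Type} [AddCommGroup U] [Module ℂ U] {ρ : Representation ℂ G0 U}

lemma G0Structure.assoc_act {x : M} (s : A.assoc ρ x) (p : A.fiber x) (g : G0) :
    ρ g (s.1 (A.act p g)) = s.1 p := s.2 p _ g rfl

lemma rep_inv_apply (g : G0) (u : U) : ρ g (ρ g⁻¹ u) = u := by
  rw [← Module.End.mul_apply, ← map_mul, mul_inv_cancel, map_one]; rfl

lemma rep_inv_apply' (g : G0) (u : U) : ρ g⁻¹ (ρ g u) = u := by
  rw [← Module.End.mul_apply, ← map_mul, inv_mul_cancel, map_one]; rfl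

lemma G0Structure.assoc_act' {x : M} (s : A.assoc ρ x) (p : A.fiber x) (g : G0) :
    s.1 (A.act p g) = ρ g⁻¹ (s.1 p) := by
  rw [← assoc_act s p g, rep_inv_apply']

/-- The action of `G₀` on `ρ` factors through the Levi factor. -/
def FactorsLevi (ρ : Representation ℂ G0 U) : Prop := ∀ g g' : G0, g.right = g'.right → ρ g = ρ g'

/-- The coordinate of an element of an associated bundle with respect to a frame. -/
def G0Structure.evalAt (ρ : Representation ℂ G0 U) {x : M} (p : A.fiber x) :
    A.assoc ρ x →ₗ[ℂ] U :=
  LinearMap.proj p ∘ₗ (A.assoc ρ x).subtype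

lemma G0Structure.evalAt_injective {x : M} (p : A.fiber x) :
    Function.Injective (G0Structure.evalAt ρ p) := by
  intro s t h
  apply Subtype.ext
  funext p'
  obtain ⟨g, rfl⟩ := A.exists_eq_act p p'
  have h' : s.1 p = t.1 p := h
  rw [assoc_act', assoc_act', h']

/-- The element with value `u` at `p` has to take the value `ρ(γ)⁻¹ u` at `p γ`. A group element `γ`
joining two frames is only known to be unique up to its Levi component (`right_eq_of_act_eq`);
`FactorsLevi` makes the value independent of the choice. -/
lemma G0Structure.evalAt_surjective (hρ : FactorsLevi ρ) {x : M} (p : A.fiber x) :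
    Function.Surjective (G0Structure.evalAt ρ p) := by
  intro u
  choose γ hγ using A.exists_eq_act p
  refine ⟨⟨fun p' => ρ (γ p')⁻¹ u, fun p' p'' g h => ?_⟩, ?_⟩
  · have h1 : A.act p (γ p'') = A.act p (γ p' * g) := by
      rw [← hγ, ← A.act_act, ← hγ]
      exact Subtype.ext h
    have h2 : ρ (γ p'')⁻¹ = ρ (γ p' * g)⁻¹ :=
      hρ _ _ (by simp [A.right_eq_of_act_eq h1])
    change ρ g (ρ (γ p'')⁻¹ u) = ρ (γ p')⁻¹ u
    rw [h2, mul_inv_rev, map_mul, Module.End.mul_apply, rep_inv_apply]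
  · change ρ (γ p)⁻¹ u = u
    have h1 : A.act p (γ p) = A.act p 1 := by
      rw [← hγ]
      apply Subtype.ext
      refine GrFrame.ext_of (LinearEquiv.ext fun u => ?_) (LinearEquiv.ext fun u => ?_)
      · change p.1.neg1 u = p.1.neg1 (repGr (-1) 1 u)
        rw [map_one]; rfl
      · change p.1.neg2 u = p.1.neg2 (repGr (-2) 1 u)
        rw [map_one]; rfl
    have h2 : ρ (γ p)⁻¹ = ρ 1 := hρ _ _ (by simp [A.right_eq_of_act_eq h1])
    rw [h2, map_one]; rfl

/-- The linear coordinates on an associated bundle given by a frame. -/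
def G0Structure.evalEquiv (hρ : FactorsLevi ρ) {x : M} (p : A.fiber x) : A.assoc ρ x ≃ₗ[ℂ] U :=
  LinearEquiv.ofBijective (G0Structure.evalAt ρ p)
    ⟨G0Structure.evalAt_injective p, G0Structure.evalAt_surjective hρ p⟩

lemma G0Structure.evalEquiv_symm_apply (hρ : FactorsLevi ρ) {x : M} (p : A.fiber x) (u : U) :
    ((G0Structure.evalEquiv hρ p).symm u).1 p = u :=
  (G0Structure.evalEquiv hρ p).apply_symm_apply u

end Assoc

lemma factorsLevi_VL (k : ℤ) (g g' : G0) (h : g.right = g'.right)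
    (s : vGr k × (gr k ⧸ vGr k)) :
    (repV k g s.1, repL k g s.2) = (repV k g' s.1, repL k g' s.2) :=
  toG_injective k (by rw [toG_rep, toG_rep, h])

lemma factorsLevi_repV (k : ℤ) : FactorsLevi (repV k) := fun g g' h =>
  LinearMap.ext fun v => congrArg Prod.fst (factorsLevi_VL k g g' h (v, 0))

lemma factorsLevi_repL (k : ℤ) : FactorsLevi (repL k) := fun g g' h =>
  LinearMap.ext fun v => congrArg Prod.snd (factorsLevi_VL k g g' h (0, v))

/-! ### Bundle homomorphisms as bilinear maps on `𝔤` -/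

section Hom

variable (S : Setup M) {x : M}

/-- The coordinate of `𝒱ₖ ⊕ ℒₖ` with respect to a frame, as a linear map to `𝔤`. -/
def Setup.toG (k : ℤ) (p : S.A.fiber x) : S.VL k x →ₗ[ℂ] GSum :=
  G2Horo.toG k ∘ₗ (G0Structure.evalAt (repV k) p).prodMap (G0Structure.evalAt (repL k) p)

lemma Setup.toG_apply (k : ℤ) (p : S.A.fiber x) (s : S.VL k x) :
    S.toG k p s = G2Horo.toG k (S.coord p s) := rfl

lemma Setup.toG_injective (k : ℤ) (p : S.A.fiber x) : Function.Injective (S.toG k p) := by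
  intro s t h
  have h1 := G2Horo.toG_injective k h
  exact Prod.ext (G0Structure.evalAt_injective p (congrArg Prod.fst h1))
    (G0Structure.evalAt_injective p (congrArg Prod.snd h1))

/-- The projection of `𝔤` to the fibre of `𝒱ₖ ⊕ ℒₖ` given by a frame. -/
def Setup.ofG (k : ℤ) (p : S.A.fiber x) : GSum →ₗ[ℂ] S.VL k x :=
  ((G0Structure.evalEquiv (factorsLevi_repV k) p).symm.toLinearMap.prodMap
    (G0Structure.evalEquiv (factorsLevi_repL k) p).symm.toLinearMap) ∘ₗ G2Horo.ofG k

lemma Setup.coord_ofG (k : ℤ) (p : S.A.fiber x) (y : GSum) :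
    S.coord p (S.ofG k p y) = G2Horo.ofG k y :=
  Prod.ext (G0Structure.evalEquiv_symm_apply (factorsLevi_repV k) p _)
    (G0Structure.evalEquiv_symm_apply (factorsLevi_repL k) p _)

lemma Setup.toG_ofG (k : ℤ) (p : S.A.fiber x) (y : GSum) :
    S.toG k p (S.ofG k p y) = degProj k y := by
  rw [S.toG_apply, S.coord_ofG, G2Horo.toG_ofG]

lemma Setup.degSum_toG (k : ℤ) (p : S.A.fiber x) (s : S.VL k x) :
    degSum (S.toG k p s) = (k : ℂ) • S.toG k p s := G2Horo.degSum_toG k _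

lemma Setup.ofG_toG (k : ℤ) (p : S.A.fiber x) (s : S.VL k x) :
    S.ofG k p (S.toG k p s) = s := by
  apply S.toG_injective k p
  rw [S.toG_ofG, degProj_eq (S.degSum_toG k p s), if_pos rfl]

lemma Setup.toG_act (k : ℤ) (p : S.A.fiber x) (g : G0) (s : S.VL k x) :
    S.toG k p s = repLevi g.right (S.toG k (S.A.act p g) s) := by
  have h : S.coord p s = (repV k g (S.coord (S.A.act p g) s).1,
      repL k g (S.coord (S.A.act p g) s).2) :=
    Prod.ext (G0Structure.assoc_act s.1 p g).symm (G0Structure.assoc_act s.2 p g).symm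
  rw [S.toG_apply, h, toG_rep, S.toG_apply]

lemma Setup.ofG_act (k : ℤ) (p : S.A.fiber x) (g : G0) (y : GSum) :
    S.ofG k (S.A.act p g) y = S.ofG k p (repLevi g.right y) := by
  apply S.toG_injective k p
  rw [S.toG_act k p g, S.toG_ofG, S.toG_ofG, degProj_repLevi]

variable {i j k : ℤ}

lemma Setup.wedgeMk_add_left (u u' : S.VL i x) (v : S.VL j x) :
    S.wedgeMk (u + u') v = S.wedgeMk u v + S.wedgeMk u' v :=
  Subtype.ext (by simp [Setup.wedgeMk, add_mul])

lemma Setup.wedgeMk_add_right (u : S.VL i x) (v v' : S.VL j x) :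
    S.wedgeMk u (v + v') = S.wedgeMk u v + S.wedgeMk u v' :=
  Subtype.ext (by simp [Setup.wedgeMk, mul_add])

lemma Setup.wedgeMk_smul_left (c : ℂ) (u : S.VL i x) (v : S.VL j x) :
    S.wedgeMk (c • u) v = c • S.wedgeMk u v :=
  Subtype.ext (by simp [Setup.wedgeMk])

lemma Setup.wedgeMk_smul_right (c : ℂ) (u : S.VL i x) (v : S.VL j x) :
    S.wedgeMk u (c • v) = c • S.wedgeMk u v :=
  Subtype.ext (by simp [Setup.wedgeMk])

/-- The bilinear map on `𝔤` that expresses `σ` in a frame. -/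
def Setup.homCoord (σ : S.wedge i j x →ₗ[ℂ] S.VL k x) (p : S.A.fiber x) :
    GSum →ₗ[ℂ] GSum →ₗ[ℂ] GSum :=
  LinearMap.mk₂ ℂ (fun y z => S.toG k p (σ (S.wedgeMk (S.ofG i p y) (S.ofG j p z))))
    (fun _ _ _ => by rw [map_add, S.wedgeMk_add_left, map_add, map_add])
    (fun _ _ _ => by rw [map_smul, S.wedgeMk_smul_left, map_smul, map_smul])
    (fun _ _ _ => by rw [map_add, S.wedgeMk_add_right, map_add, map_add])
    (fun _ _ _ => by rw [map_smul, S.wedgeMk_smul_right, map_smul, map_smul])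

lemma Setup.homCoord_apply (σ : S.wedge i j x →ₗ[ℂ] S.VL k x) (p : S.A.fiber x) (y z : GSum) :
    S.homCoord σ p y z = S.toG k p (σ (S.wedgeMk (S.ofG i p y) (S.ofG j p z))) := rfl

/-- Source and target are modules of the Levi group, so a change of frame conjugates the bilinear
map by the Levi component of `g`. All transition functions along curves come from this formula. -/
lemma Setup.homCoord_act (σ : S.wedge i j x →ₗ[ℂ] S.VL k x) (p : S.A.fiber x) (g : G0)
    (y z : GSum) : repLevi g.right (S.homCoord σ (S.A.act p g) y z) =
      S.homCoord σ p (repLevi g.right y) (repLevi g.right z) := by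
  rw [S.homCoord_apply, S.homCoord_apply, ← S.toG_act, S.ofG_act, S.ofG_act]

lemma Setup.degSum_homCoord (σ : S.wedge i j x →ₗ[ℂ] S.VL k x) (p : S.A.fiber x) (y z : GSum) :
    degSum (S.homCoord σ p y z) = (k : ℂ) • S.homCoord σ p y z := S.degSum_toG k p _

lemma Setup.ofG_eq_zero {l : ℤ} (p : S.A.fiber x) {y : GSum}
    (h : degSum y = (l : ℂ) • y) (hl : k ≠ l) : S.ofG k p y = 0 := by
  apply S.toG_injective k p
  rw [S.toG_ofG, degProj_eq h, if_neg hl, map_zero]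

lemma Setup.wedgeMk_zero_left (v : S.VL j x) : S.wedgeMk (0 : S.VL i x) v = 0 :=
  Subtype.ext (by simp [Setup.wedgeMk])

lemma Setup.wedgeMk_zero_right (u : S.VL i x) : S.wedgeMk u (0 : S.VL j x) = 0 :=
  Subtype.ext (by simp [Setup.wedgeMk])

lemma Setup.eq_zero_of_wedgeMk (σ : S.wedge i j x →ₗ[ℂ] S.VL k x)
    (h : ∀ (u : S.VL i x) (v : S.VL j x), σ (S.wedgeMk u v) = 0) : σ = 0 := by
  refine LinearMap.ext fun m => ?_
  obtain ⟨m, hm⟩ := m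
  refine Submodule.mul_induction_on' (C := fun m hm => σ ⟨m, hm⟩ = 0) ?_ ?_ hm
  · rintro _ ⟨u, rfl⟩ _ ⟨v, rfl⟩
    exact h u v
  · intro a ha b hb h1 h2
    have : (⟨a + b, Submodule.add_mem _ ha hb⟩ : S.wedge i j x) = ⟨a, ha⟩ + ⟨b, hb⟩ := rfl
    rw [this, map_add, h1, h2, add_zero]

lemma Setup.eq_zero_of_homCoord (σ : S.wedge i j x →ₗ[ℂ] S.VL k x) (p : S.A.fiber x)
    (h : S.homCoord σ p = 0) : σ = 0 := by
  refine S.eq_zero_of_wedgeMk σ fun u v => S.toG_injective k p ?_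
  have h1 := LinearMap.congr_fun₂ h (S.toG i p u) (S.toG j p v)
  rw [S.homCoord_apply, S.ofG_toG, S.ofG_toG] at h1
  rw [h1, map_zero]
  rfl

end Hom

end Manifold

/-! ### Holomorphic dependence on a parameter -/

section WeaklyHol

variable {E E' : Type*} [AddCommGroup E] [Module ℂ E] [AddCommGroup E'] [Module ℂ E']

/-- All the coordinates of the vector-valued function `F` are holomorphic on `U`. -/
def WeaklyHol (U : Set ℂ) (F : ℂ → E) : Prop :=
  ∀ l : Module.Dual ℂ E, DifferentiableOn ℂ (fun z => l (F z)) U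

variable {U : Set ℂ}

lemma weaklyHol_const (u : E) : WeaklyHol U fun _ => u := fun _ => differentiableOn_const _

lemma weaklyHol_of_differentiableOn {f : ℂ → ℂ} (h : DifferentiableOn ℂ f U) : WeaklyHol U f := by
  intro l
  have (z : ℂ) : l (f z) = f z * l 1 := by
    rw [← smul_eq_mul, ← map_smul, smul_eq_mul, mul_one]
  simp only [this]
  exact h.mul_const _

lemma WeaklyHol.smul {f : ℂ → ℂ} {F : ℂ → E} (hf : DifferentiableOn ℂ f U) (hF : WeaklyHol U F) :
    WeaklyHol U fun z => f z • F z := by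
  intro l
  simp only [map_smul, smul_eq_mul]
  exact hf.mul (hF l)

lemma WeaklyHol.prodMk {F : ℂ → E} {F' : ℂ → E'} (h : WeaklyHol U F) (h' : WeaklyHol U F') :
    WeaklyHol U fun z => (F z, F' z) := by
  intro l
  have (z : ℂ) : l (F z, F' z) = (l ∘ₗ LinearMap.inl ℂ E E') (F z) +
      (l ∘ₗ LinearMap.inr ℂ E E') (F' z) := by
    simp [← map_add]
  simp only [this]
  exact (h _).add (h' _)

/-- In a finite basis of `E` the value is a finite sum of products of holomorphic functions. No
topology on `E` or `E'` enters. -/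
lemma WeaklyHol.apply [Module.Finite ℂ E] {T : ℂ → E →ₗ[ℂ] E'} {F : ℂ → E}
    (hT : ∀ u, WeaklyHol U fun z => T z u) (hF : WeaklyHol U F) :
    WeaklyHol U fun z => T z (F z) := by
  intro l
  let b := Module.finBasis ℂ E
  have (z : ℂ) : l (T z (F z)) = ∑ i, b.coord i (F z) * l (T z (b i)) := by
    conv_lhs => rw [← b.sum_repr (F z)]
    simp only [map_sum, map_smul, smul_eq_mul, Module.Basis.coord_apply]
  simp only [this]
  exact DifferentiableOn.fun_sum fun i _ => (hF _).mul (hT _ _)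

lemma weaklyHol_pi {n : ℕ} {F : ℂ → Fin n → ℂ} (h : ∀ i, DifferentiableOn ℂ (fun z => F z i) U) :
    WeaklyHol U F := by
  intro l
  have (z : ℂ) : l (F z) = ∑ i, F z i * l (Pi.single i 1) := by
    rw [LinearMap.pi_apply_eq_sum_univ l (F z)]
    refine Finset.sum_congr rfl fun i _ => ?_
    rw [smul_eq_mul]
    congr 2
    ext j
    simp [Pi.single_apply, eq_comm]
  simp only [this]
  exact DifferentiableOn.fun_sum fun i _ => (h i).mul_const _

lemma weaklyHol_matrix {F : ℂ → Matrix (Fin 2) (Fin 2) ℂ}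
    (h : ∀ i j, DifferentiableOn ℂ (fun z => F z i j) U) : WeaklyHol U F := by
  intro l
  have (z : ℂ) : l (F z) = ∑ i, ∑ j, F z i j * l (Matrix.single i j 1) := by
    conv_lhs => rw [Matrix.matrix_eq_sum_single (F z)]
    simp only [map_sum]
    refine Finset.sum_congr rfl fun i _ => Finset.sum_congr rfl fun j _ => ?_
    rw [← smul_eq_mul, ← map_smul, Matrix.smul_single, smul_eq_mul, mul_one]
  simp only [this]
  exact DifferentiableOn.fun_sum fun i _ => DifferentiableOn.fun_sum fun j _ =>
    (h i j).mul_const _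

/-- In finite dimension every linear form on the dual space is the evaluation at a vector. -/
lemma weaklyHol_dual [Module.Finite ℂ E] {F : ℂ → Module.Dual ℂ E}
    (h : ∀ u, DifferentiableOn ℂ (fun z => F z u) U) : WeaklyHol U F := by
  intro l
  obtain ⟨u, rfl⟩ := (Module.evalEquiv ℂ E).surjective l
  simpa using h u

end WeaklyHol

/-- The matrix-valued function `A` is holomorphic on `U`. -/
def HolMatrix (U : Set ℂ) (A : ℂ → Matrix (Fin 2) (Fin 2) ℂ) : Prop :=
  ∀ i j, DifferentiableOn ℂ (fun z => A z i j) U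

variable {U : Set ℂ}

lemma HolMatrix.coeff_subst {A : ℂ → Matrix (Fin 2) (Fin 2) ℂ} (hA : HolMatrix U A)
    (p : MvPolynomial (Fin 2) ℂ) (m : Fin 2 →₀ ℕ) :
    DifferentiableOn ℂ (fun z => coeff m (subst (A z) p)) U := by
  induction p using MvPolynomial.induction_on generalizing m with
  | C a => simp [subst]
  | add p q hp hq => 
    simp only [map_add, coeff_add]
    exact (hp m).add (hq m)
  | mul_X p j hp =>
    simp only [map_mul, coeff_mul]
    refine DifferentiableOn.fun_sum fun x _ => (hp _).mul ?_
    simp only [subst_X, coeff_add, coeff_C_mul]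
    exact ((hA 0 j).mul_const _).add ((hA 1 j).mul_const _)

lemma HolMatrix.symMap {A : ℂ → Matrix (Fin 2) (Fin 2) ℂ} (hA : HolMatrix U A) (d : ℕ)
    (p : SymW d) : WeaklyHol U fun z => symMap d (A z) p := by
  intro l
  have (z : ℂ) : l (G2Horo.symMap d (A z) p) =
      ∑ m ∈ exps d, coeff m (subst (A z) p) * l (mono d m) := by
    conv_lhs => rw [symW_eq_sum (G2Horo.symMap d (A z) p)]
    simp only [map_sum, map_smul, smul_eq_mul]
    rfl
  simp only [this]
  exact DifferentiableOn.fun_sum fun m _ => (hA.coeff_subst _ m).mul_const _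

lemma HolMatrix.mulVec {A : ℂ → Matrix (Fin 2) (Fin 2) ℂ} (hA : HolMatrix U A) (w : W) :
    WeaklyHol U fun z => (A z).mulVec w := by
  refine weaklyHol_pi fun i => ?_
  simp only [Matrix.mulVec, dotProduct]
  exact DifferentiableOn.fun_sum fun j _ => (hA i j).mul_const _

lemma HolMatrix.mul {A B : ℂ → Matrix (Fin 2) (Fin 2) ℂ} (hA : HolMatrix U A)
    (hB : HolMatrix U B) : HolMatrix U fun z => A z * B z := by
  intro i j
  simp only [Matrix.mul_apply]
  exact DifferentiableOn.fun_sum fun k _ => (hA i k).mul (hB k j)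

lemma HolMatrix.det {A : ℂ → Matrix (Fin 2) (Fin 2) ℂ} (hA : HolMatrix U A) :
    DifferentiableOn ℂ (fun z => (A z).det) U := by
  simp only [Matrix.det_fin_two]
  exact ((hA 0 0).mul (hA 1 1)).sub ((hA 0 1).mul (hA 1 0))

/-- The Levi-valued function `γ` is holomorphic on `U`. -/
def HolLevi (U : Set ℂ) (γ : ℂ → Levi) : Prop :=
  DifferentiableOn ℂ (fun z => ((γ z).1 : ℂ)) U ∧
    HolMatrix U fun z => ((γ z).2 : Matrix (Fin 2) (Fin 2) ℂ)

lemma det_GL_ne_zero (A : GL (Fin 2) ℂ) : (A : Matrix (Fin 2) (Fin 2) ℂ).det ≠ 0 :=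
  ((Matrix.isUnit_iff_isUnit_det _).mp A.isUnit).ne_zero

lemma HolLevi.inv {γ : ℂ → Levi} (h : HolLevi U γ) : HolLevi U fun z => (γ z)⁻¹ := by
  constructor
  · simp only [Prod.fst_inv, Units.val_inv_eq_inv_val]
    exact h.1.inv fun z _ => (γ z).1.ne_zero
  · have hd := h.2.det.inv fun z _ => det_GL_ne_zero (γ z).2
    intro i j
    simp only [Prod.snd_inv, Matrix.coe_units_inv, Matrix.inv_def, Ring.inverse_eq_inv',
      Matrix.smul_apply, smul_eq_mul, Matrix.adjugate_fin_two]
    refine hd.mul ?_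
    fin_cases i <;> fin_cases j
    · exact h.2 1 1
    · exact (h.2 0 1).neg
    · exact (h.2 1 0).neg
    · exact h.2 0 0

lemma HolLevi.repLevi {γ : ℂ → Levi} (h : HolLevi U γ) (x : GSum) :
    WeaklyHol U fun z => repLevi (γ z) x := by
  have hi := h.inv
  have hR : DifferentiableOn ℂ (fun z => chiR (γ z)) U := h.1
  have hR' : DifferentiableOn ℂ (fun z => chiR (γ z)⁻¹) U := hi.1
  have hQ : DifferentiableOn ℂ (fun z => chiQ (γ z)) U := (h.1.pow 2).mul (h.2.det.pow 3)
  have hQ' : DifferentiableOn ℂ (fun z => (chiQ (γ z))⁻¹) U :=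
    hQ.inv fun z _ => mul_ne_zero (pow_ne_zero _ (γ z).1.ne_zero)
      (pow_ne_zero _ (det_GL_ne_zero (γ z).2))
  have hdual (d : ℕ) (φ : Module.Dual ℂ (SymW d)) : WeaklyHol U fun z => φ ∘ₗ (chiR (γ z)⁻¹ •
      symMap d (((γ z).2⁻¹ : GL (Fin 2) ℂ) : Matrix (Fin 2) (Fin 2) ℂ)) := by
    refine weaklyHol_dual fun s => ?_
    exact (WeaklyHol.smul hR' (hi.2.symMap d s)) φ
  simp only [repLevi_apply, repV0_apply]
  refine WeaklyHol.prodMk (.prodMk ?_ (.prodMk ?_ (.prodMk (.prodMk ?_ ?_) (.prodMk ?_ ?_))))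
    (.prodMk ?_ (.prodMk ?_ ?_))
  · exact weaklyHol_of_differentiableOn (hQ.mul_const _)
  · exact WeaklyHol.smul hR (h.2.symMap 3 _)
  · exact weaklyHol_const _
  · exact weaklyHol_matrix (h.2.mul (HolMatrix.mul (fun _ _ => differentiableOn_const _) hi.2))
  · exact hdual 3 _
  · exact weaklyHol_of_differentiableOn (hQ'.mul_const _)
  · exact h.2.mulVec _
  · exact hdual 2 _
  · exact WeaklyHol.smul hQ' (h.2.mulVec _)

/-- A section of a line bundle of negative degree over the projective line vanishes. -/
lemma eq_zero_of_transition {F : Fin 2 → ℂ → ℂ} (hF : ∀ b, Differentiable ℂ (F b)) {n : ℕ}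
    (hn : n ≠ 0) (h : ∀ b b', b ≠ b' → ∀ z, z ≠ 0 → F b z = (z⁻¹) ^ n * F b' z⁻¹)
    (b : Fin 2) (z : ℂ) : F b z = 0 := by
  obtain ⟨b', hb⟩ : ∃ b', b ≠ b' := ⟨b + 1, by fin_cases b <;> simp⟩
  have hinv : Filter.Tendsto (fun z : ℂ => z⁻¹) (Filter.cocompact ℂ) (nhds 0) :=
    Filter.tendsto_inv₀_cobounded.comp (Metric.cobounded_eq_cocompact (α := ℂ)).ge
  -- At infinity `z⁻ⁿ` tends to `0` while `F b' z⁻¹` tends to `F b' 0`. The entire function `F b`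
  -- thus has limit `0` at infinity, and Liouville's theorem makes it zero.
  have hlim : Filter.Tendsto (fun z : ℂ => (z⁻¹) ^ n * F b' z⁻¹) (Filter.cocompact ℂ) (nhds 0) := by
    have h1 := (hinv.pow n).mul (((hF b').continuous.tendsto 0).comp hinv)
    simpa [hn] using h1
  refine (hF b).apply_eq_of_tendsto_cocompact z (hlim.congr' ?_)
  have h0 : ∀ᶠ z : ℂ in Filter.cocompact ℂ, z ≠ 0 :=
    (isCompact_singleton (x := (0 : ℂ))).compl_mem_cocompact
  filter_upwards [h0] with z hz
  exact (h b b' hb z hz).symm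

section Manifold

variable {M : Type*} [TopologicalSpace M] [ChartedSpace Model M] [IsManifold 𝓘(ℂ, Model) ω M]
  (S : Setup M)

/-! ### Frames adapted to sections of `𝒲` and `ℛ` -/

/-- The frame `p` sends the standard bases of `W` and `R` to `s1, s0` and `r`. -/
def Setup.IsAdapted {x : M} (p : S.A.fiber x) (s1 s0 : S.V (-1) x) (r : S.A.assoc repR x) : Prop :=
  wCoord (s1.1 p) = Pi.single 0 1 ∧ wCoord (s0.1 p) = Pi.single 1 1 ∧ r.1 p = 1

/-- The matrix with columns `w, w'`. -/
def colMatrix (w w' : W) : Matrix (Fin 2) (Fin 2) ℂ := Matrix.of fun i j => ![w i, w' i] j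

lemma colMatrix_mulVec (w w' v : W) : (colMatrix w w').mulVec v = v 0 • w + v 1 • w' := by
  ext i
  simp [colMatrix, Matrix.mulVec, dotProduct, Fin.sum_univ_two, mul_comm]

/-- The element of the Levi group given by bases of `R` and `W`. -/
def leviOfBasis {r : ℂ} {w w' : W} (hr : r ≠ 0) (hd : (colMatrix w w').det ≠ 0) : Levi :=
  (Units.mk0 r hr, Matrix.GeneralLinearGroup.mkOfDetNeZero (colMatrix w w') hd)

lemma repR_apply (g : G0) (u : ℂ) : repR g u = (g.right.1 : ℂ) * u := rfl

lemma GL_mulVec_injective (A : GL (Fin 2) ℂ) :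
    Function.Injective (A : Matrix (Fin 2) (Fin 2) ℂ).mulVec :=
  Matrix.mulVec_injective_iff_isUnit.mpr A.isUnit

/-- Coordinates transform by `s (p g) = g⁻¹ s (p)`. It suffices to take for `g` the Levi element
whose columns and scalar are the coordinates of `s1`, `s0` and `r` in `p`. -/
lemma Setup.isAdapted_act {x : M} (p : S.A.fiber x) {s1 s0 : S.V (-1) x}
    {r : S.A.assoc repR x} (hr : r.1 p ≠ 0)
    (hd : (colMatrix (wCoord (s1.1 p)) (wCoord (s0.1 p))).det ≠ 0) :
    S.IsAdapted (S.A.act p (SemidirectProduct.inr (leviOfBasis hr hd))) s1 s0 r := by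
  set g : G0 := SemidirectProduct.inr (leviOfBasis hr hd) with hg
  have hA : (g.right.2 : Matrix (Fin 2) (Fin 2) ℂ) =
    colMatrix (wCoord (s1.1 p)) (wCoord (s0.1 p)) := rfl
  refine ⟨GL_mulVec_injective g.right.2 ?_, GL_mulVec_injective g.right.2 ?_, ?_⟩
  · rw [← wCoord_rep, G0Structure.assoc_act, hA, colMatrix_mulVec]
    simp
  · rw [← wCoord_rep, G0Structure.assoc_act, hA, colMatrix_mulVec]
    simp
  · have h := G0Structure.assoc_act r p g
    rw [repR_apply] at h
    exact mul_left_cancel₀ hr (h.trans (mul_one _).symm)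

/-- The change of frame multiplies `e₀` by `c`, fixes `e₁` and multiplies the basis of `R` by `c⁻¹`,
which determines its Levi component. The component in `V₀` stays free. -/
lemma Setup.exists_right_eq_tor {x : M} {p p' : S.A.fiber x} {s1 s0 : S.V (-1) x}
    {r : S.A.assoc repR x} (c : ℂˣ) (h : S.IsAdapted p s1 s0 r)
    (h' : S.IsAdapted p' ((c : ℂ) • s1) s0 ((c : ℂ)⁻¹ • r)) :
    ∃ g, p' = S.A.act p g ∧ g.right = tor c⁻¹ c 1 := by
  obtain ⟨g, rfl⟩ := S.A.exists_eq_act p p'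
  refine ⟨g, rfl, Prod.ext (Units.ext ?_) (Units.ext ?_)⟩
  · have h1 : (c : ℂ)⁻¹ * r.1 (S.A.act p g) = 1 := h'.2.2
    have h2 := G0Structure.assoc_act r p g
    rw [repR_apply, h.2.2] at h2
    have h3 : r.1 (S.A.act p g) = c := by
      field_simp at h1
      exact h1
    rw [h3] at h2
    rw [tor, Units.val_inv_eq_inv_val]
    exact eq_inv_of_mul_eq_one_left h2
  · refine Matrix.ext_of_mulVec_single fun j => ?_
    rw [tor, diagGL_val]
    fin_cases j
    · have h1 : (c : ℂ) • wCoord (s1.1 (S.A.act p g)) = Pi.single 0 1 := by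
        rw [← map_smul]; exact h'.1
      have h2 := wCoord_rep g (s1.1 (S.A.act p g))
      rw [G0Structure.assoc_act, h.1] at h2
      have h3 : (g.right.2 : Matrix (Fin 2) (Fin 2) ℂ).mulVec (Pi.single 0 1) =
          (c : ℂ) • Pi.single 0 1 := by
        conv_lhs => rw [← h1]
        rw [Matrix.mulVec_smul, ← h2]
      refine h3.trans ?_
      ext i
      fin_cases i <;> simp [Matrix.mulVec_diagonal]
    · have h2 := wCoord_rep g (s0.1 (S.A.act p g))
      rw [G0Structure.assoc_act, h.2.1, h'.2.1] at h2
      simp only [Fin.mk_one]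
      rw [← h2]
      ext i
      fin_cases i <;> simp [Matrix.mulVec_diagonal]

/-! ### Vanishing of the coefficients of negative degree -/

/-- Trivializations over the two charts of `ℙ¹` of a splitting `f^*𝒲 ≅ 𝒪(1) ⊕ 𝒪` and of
`f^*ℛ ≅ 𝒪(-1)`. -/
structure Setup.CurveFrame (f : P1 → M) where
  s1 : Fin 2 → ∀ t, S.V (-1) (f t)
  s0 : ∀ t, S.V (-1) (f t)
  r : Fin 2 → ∀ t, S.A.assoc repR (f t)
  hol_s1 : ∀ b, (S.A.pull (repV (-1)) f).IsHol (Set.range (chart b)) (s1 b)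
  hol_s0 : (S.A.pull (repV (-1)) f).IsHol Set.univ s0
  hol_r : ∀ b, (S.A.pull repR f).IsHol (Set.range (chart b)) (r b)
  indep : ∀ b, ∀ t ∈ Set.range (chart b), ∀ c c' : ℂ, c • s1 b t + c' • s0 t = 0 → c = 0 ∧ c' = 0
  r_ne : ∀ b, ∀ t ∈ Set.range (chart b), r b t ≠ 0
  trans_s1 : ∀ b b', b ≠ b' → ∀ z : ℂ, z ≠ 0 → s1 b' (chart b z) = z • s1 b (chart b z)
  trans_r : ∀ b b', b ≠ b' → ∀ z : ℂ, z ≠ 0 → r b' (chart b z) = z⁻¹ • r b (chart b z)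

lemma affVec_inv {b b' : Fin 2} (h : b ≠ b') {z : ℂ} (hz : z ≠ 0) :
    affVec b' z⁻¹ = z⁻¹ • affVec b z := by
  ext i
  fin_cases b <;> fin_cases b' <;> fin_cases i <;> simp [affVec, hz] at h ⊢

lemma chart_inv {b b' : Fin 2} (h : b ≠ b') {z : ℂ} (hz : z ≠ 0) : chart b' z⁻¹ = chart b z :=
  (Projectivization.mk_eq_mk_iff' ℂ _ _ _ _).mpr ⟨z⁻¹, (affVec_inv h hz).symm⟩

variable {S} {f : P1 → M} (F : S.CurveFrame f)

lemma Setup.CurveFrame.det_ne_zero {b : Fin 2} {t : P1} (ht : t ∈ Set.range (chart b))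
    (p : S.A.fiber (f t)) :
    (colMatrix (wCoord ((F.s1 b t).1 p)) (wCoord ((F.s0 t).1 p))).det ≠ 0 := by
  intro h
  obtain ⟨v, hv, h0⟩ := Matrix.exists_mulVec_eq_zero_iff.mpr h
  rw [colMatrix_mulVec, ← map_smul, ← map_smul, ← map_add, ← map_zero wCoord] at h0
  have h1 : v 0 • F.s1 b t + v 1 • F.s0 t = 0 := by
    apply G0Structure.evalAt_injective p
    rw [map_zero]
    exact wCoord_injective h0
  obtain ⟨h2, h3⟩ := F.indep b t ht _ _ h1
  refine hv (funext fun i => ?_)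
  fin_cases i
  · exact h2
  · exact h3

lemma Setup.CurveFrame.r_apply_ne_zero {b : Fin 2} {t : P1} (ht : t ∈ Set.range (chart b))
    (p : S.A.fiber (f t)) : (F.r b t).1 p ≠ 0 := fun h =>
  F.r_ne b t ht (G0Structure.evalAt_injective p (h.trans (map_zero (G0Structure.evalAt repR p)).symm))

/-- The Levi component of the change from the frame `p` to an adapted frame. -/
def Setup.CurveFrame.levi {b : Fin 2} {t : P1} (ht : t ∈ Set.range (chart b))
    (p : S.A.fiber (f t)) : Levi :=
  leviOfBasis (F.r_apply_ne_zero ht p) (F.det_ne_zero ht p)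

lemma Setup.CurveFrame.isAdapted {b : Fin 2} {t : P1} (ht : t ∈ Set.range (chart b))
    (p : S.A.fiber (f t)) :
    S.IsAdapted (S.A.act p (SemidirectProduct.inr (F.levi ht p))) (F.s1 b t) (F.s0 t) (F.r b t) :=
  S.isAdapted_act p _ _

variable {i j k : ℤ} (σ : ∀ x : M, S.wedge i j x →ₗ[ℂ] S.VL k x)

lemma Setup.homCoord_eq_of_isAdapted {x : M} {p p' : S.A.fiber x} {s1 s0 : S.V (-1) x}
    {r : S.A.assoc repR x} (c : ℂˣ) (h : S.IsAdapted p s1 s0 r)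
    (h' : S.IsAdapted p' ((c : ℂ) • s1) s0 ((c : ℂ)⁻¹ • r)) (y z : GSum) :
    repLevi (tor c⁻¹ c 1) (S.homCoord (σ x) p' y z) =
      S.homCoord (σ x) p (repLevi (tor c⁻¹ c 1) y) (repLevi (tor c⁻¹ c 1) z) := by
  obtain ⟨g, rfl, hg⟩ := S.exists_right_eq_tor c h h'
  rw [← hg, S.homCoord_act]

lemma tor_weight (c : ℂˣ) (m n n' : ℤ) :
    ((c⁻¹ : ℂˣ) : ℂ) ^ m * (c : ℂ) ^ n * ((1 : ℂˣ) : ℂ) ^ n' = (c : ℂ) ^ (n - m) := by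
  rw [Units.val_one, one_zpow, mul_one, zpow_sub₀ c.ne_zero, Units.val_inv_eq_inv_val, inv_zpow,
    mul_comm, div_eq_mul_inv]

/-- The torus element `tor c⁻¹ c 1` acts on the weight `(m, n, n')` by `c ^ (n - m)`. With `c = z`
this is the transition function between the two charts: the coefficient is a section of `𝒪(e)`, `e`
being the exponent. -/
lemma Setup.cowt_homCoord_of_isAdapted {x : M} {p p' : S.A.fiber x} {s1 s0 : S.V (-1) x}
    {r : S.A.assoc repR x} (c : ℂˣ) (h : S.IsAdapted p s1 s0 r)
    (h' : S.IsAdapted p' ((c : ℂ) • s1) s0 ((c : ℂ)⁻¹ • r)) {y z : GSum} {l : Module.Dual ℂ GSum}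
    {m₁ n₁ n₁' m₂ n₂ n₂' m n n' : ℤ} (hy : IsWt m₁ n₁ n₁' y) (hz : IsWt m₂ n₂ n₂' z)
    (hl : IsCowt m n n' l) :
    l (S.homCoord (σ x) p y z) =
      (c : ℂ) ^ ((n - m) - (n₁ - m₁) - (n₂ - m₂)) * l (S.homCoord (σ x) p' y z) := by
  have h1 := congrArg l (Setup.homCoord_eq_of_isAdapted σ c h h' y z)
  rw [hl.1, hy.1, hz.1, tor_weight, tor_weight, tor_weight] at h1
  simp only [map_smul, LinearMap.smul_apply, smul_eq_mul] at h1
  rw [zpow_sub₀ c.ne_zero, zpow_sub₀ c.ne_zero]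
  have e1 := zpow_ne_zero (n₁ - m₁) c.ne_zero
  have e2 := zpow_ne_zero (n₂ - m₂) c.ne_zero
  field_simp
  linear_combination - h1

open Classical in
/-- A matrix coefficient of `σ` in the frames adapted to the trivialization over the chart `b`. -/
def Setup.CurveFrame.coeff (y z : GSum) (l : Module.Dual ℂ GSum) (b : Fin 2) (t : P1) : ℂ :=
  if h : ∃ p, S.IsAdapted p (F.s1 b t) (F.s0 t) (F.r b t) then
    l (S.homCoord (σ (f t)) h.choose y z) else 0

/-- Two frames adapted to the same data differ by an element with trivial Levi component (the case
`c = 1` of the transition formula), and `homCoord` does not see the rest. The choice made in `coeff`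
is therefore immaterial. -/
lemma Setup.CurveFrame.coeff_eq {b : Fin 2} {t : P1} {p : S.A.fiber (f t)}
    (hp : S.IsAdapted p (F.s1 b t) (F.s0 t) (F.r b t)) (y z : GSum) (l : Module.Dual ℂ GSum) :
    F.coeff σ y z l b t = l (S.homCoord (σ (f t)) p y z) := by
  have h : ∃ p, S.IsAdapted p (F.s1 b t) (F.s0 t) (F.r b t) := ⟨p, hp⟩
  have h1 : S.IsAdapted h.choose (((1 : ℂˣ) : ℂ) • F.s1 b t) (F.s0 t)
      (((1 : ℂˣ) : ℂ)⁻¹ • F.r b t) := by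
    rw [Units.val_one, inv_one, one_smul, one_smul]
    exact h.choose_spec
  have h2 := Setup.homCoord_eq_of_isAdapted σ 1 hp h1 y z
  have h3 : tor 1⁻¹ 1 1 = 1 := by
    rw [inv_one]
    refine Prod.ext rfl (Units.ext ?_)
    rw [tor, diagGL_val]
    ext i j
    fin_cases i <;> fin_cases j <;> simp
  rw [h3, map_one] at h2
  rw [coeff, dif_pos h]
  exact congrArg l h2

lemma Setup.exists_section (S : Setup M) (x : M) :
    ∃ (N : Set M) (φ : ∀ y, S.A.fiber y), x ∈ N ∧ S.A.IsHolSection N φ := by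
  obtain ⟨N, hN, hx, φ, hφ⟩ := S.A.exists_section x
  exact ⟨N, φ, hx, hN, hφ⟩

lemma Setup.IsHolHom.isHolFun {σ : ∀ x : M, S.wedge i j x →ₗ[ℂ] S.VL k x} (hσ : S.IsHolHom σ)
    {N : Set M} {φ : ∀ y, S.A.fiber y} (hφ : S.A.IsHolSection N φ) (y z : GSum)
    (l : Module.Dual ℂ GSum) : IsHolFun (fun x => l (S.homCoord (σ x) (φ x) y z)) N :=
  hσ N φ hφ (G2Horo.ofG i y) (G2Horo.ofG j z) (fun x => S.ofG i (φ x) y)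
    (fun x => S.ofG j (φ x) z) (fun x _ => S.coord_ofG i (φ x) y)
    (fun x _ => S.coord_ofG j (φ x) z) (l ∘ₗ G2Horo.toG k)

lemma IsHolFun.comp_curve {h : M → ℂ} {N : Set M} (hh : IsHolFun h N) (hf : IsHolCurve f)
    (b : Fin 2) :
    DifferentiableOn ℂ (fun z => h (f (chart b z))) {z | f (chart b z) ∈ N} := by
  have h1 : ContMDiffOn 𝓘(ℂ, ℂ) 𝓘(ℂ, ℂ) ω (h ∘ fun z => f (chart b z)) {z | f (chart b z) ∈ N} :=
    ContMDiffOn.comp hh (hf b).contMDiffOn fun z hz => hz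
  exact (contMDiffOn_iff_contDiffOn.mp h1).differentiableOn (by simp)

/-- The chosen adapted frames need not vary holomorphically. The comparison is with a local
holomorphic section `φ` of `A`: the Levi component `γ` of the passage to an adapted frame has as
entries the coordinates of `s1`, `s0`, `r` in `φ`, hence is holomorphic, and the coefficient is
obtained by conjugating the coordinates of `σ` in `φ` by `γ`. -/
lemma Setup.CurveFrame.differentiable_coeff (hf : IsHolCurve f) (hσ : S.IsHolHom σ)
    (y z : GSum) (l : Module.Dual ℂ GSum) (b : Fin 2) :
    Differentiable ℂ fun w => F.coeff σ y z l b (chart b w) := by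
  intro w₀
  obtain ⟨N, φ, hx, hφ⟩ := S.exists_section (f (chart b w₀))
  set U : Set ℂ := {w | f (chart b w) ∈ N} with hU
  have hUo : IsOpen U := hφ.1.preimage (hf b).continuous
  have hmem (w : ℂ) : chart b w ∈ Set.range (chart b) := ⟨w, rfl⟩
  let γ : ℂ → Levi := fun w => F.levi (hmem w) (φ (f (chart b w)))
  have hγ : HolLevi U γ := by
    constructor
    · have h := F.hol_r b N φ hφ LinearMap.id b
      exact h.mono fun w hw => ⟨hmem w, hw⟩
    · intro a c
      have h1 := F.hol_s1 b N φ hφ (LinearMap.proj a ∘ₗ wCoord) b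
      have h0 := F.hol_s0 N φ hφ (LinearMap.proj a ∘ₗ wCoord) b
      fin_cases c
      · exact h1.mono fun w hw => ⟨hmem w, hw⟩
      · exact h0.mono fun w hw => ⟨trivial, hw⟩
  have hB (y z : GSum) : WeaklyHol U fun w =>
      S.homCoord (σ (f (chart b w))) (φ (f (chart b w))) y z := fun l =>
    (hσ.isHolFun hφ y z l).comp_curve hf b
  have h1 : WeaklyHol U fun w => repLevi (γ w)⁻¹
      (S.homCoord (σ (f (chart b w))) (φ (f (chart b w))) (repLevi (γ w) y)
        (repLevi (γ w) z)) := by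
    refine WeaklyHol.apply (T := fun w => repLevi (γ w)⁻¹) (fun u => hγ.inv.repLevi u) ?_
    refine WeaklyHol.apply (T := fun w => S.homCoord (σ (f (chart b w))) (φ (f (chart b w)))
      (repLevi (γ w) y)) (fun u => ?_) (hγ.repLevi z)
    exact WeaklyHol.apply (T := fun w => (S.homCoord (σ (f (chart b w)))
      (φ (f (chart b w)))).flip u) (fun v => hB v u) (hγ.repLevi y)
  have h2 : (fun w => F.coeff σ y z l b (chart b w)) = fun w => l (repLevi (γ w)⁻¹
      (S.homCoord (σ (f (chart b w))) (φ (f (chart b w))) (repLevi (γ w) y)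
        (repLevi (γ w) z))) := by
    funext w
    rw [F.coeff_eq σ (F.isAdapted (hmem w) (φ (f (chart b w))))]
    have h3 := S.homCoord_act (σ (f (chart b w))) (φ (f (chart b w)))
      (SemidirectProduct.inr (γ w)) y z
    rw [SemidirectProduct.right_inr] at h3
    rw [← h3, ← Module.End.mul_apply, ← map_mul, inv_mul_cancel, map_one]
    rfl
  rw [h2]
  exact (h1 l).differentiableAt (hUo.mem_nhds hx)

/-- By `hlt` the coefficient is a global section of a line bundle of negative degree on `ℙ¹`. -/
theorem Setup.CurveFrame.cowt_homCoord_eq_zero (hf : IsHolCurve f) (hσ : S.IsHolHom σ)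
    {b : Fin 2} {t : P1} (ht : t ∈ Set.range (chart b)) {p : S.A.fiber (f t)}
    (hp : S.IsAdapted p (F.s1 b t) (F.s0 t) (F.r b t)) {y z : GSum} {l : Module.Dual ℂ GSum}
    {m₁ n₁ n₁' m₂ n₂ n₂' m n n' : ℤ} (hy : IsWt m₁ n₁ n₁' y) (hz : IsWt m₂ n₂ n₂' z)
    (hl : IsCowt m n n' l) (hlt : n - m < (n₁ - m₁) + (n₂ - m₂)) :
    l (S.homCoord (σ (f t)) p y z) = 0 := by
  obtain ⟨w, rfl⟩ := ht
  rw [← F.coeff_eq σ hp]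
  -- `n` is minus the degree of that line bundle, positive by `hlt`.
  refine eq_zero_of_transition (F := fun b w => F.coeff σ y z l b (chart b w))
    (n := ((n₁ - m₁) + (n₂ - m₂) - (n - m)).toNat)
    (fun b => F.differentiable_coeff σ hf hσ y z l b) (by omega) ?_ b w
  intro b b' hb w hw
  rw [chart_inv hb hw]
  obtain ⟨φ⟩ : Nonempty (∀ y, S.A.fiber y) := by
    obtain ⟨N, φ, -⟩ := S.exists_section (f (chart b w))
    exact ⟨φ⟩
  have ht : chart b w ∈ Set.range (chart b) := ⟨w, rfl⟩
  have ht' : chart b w ∈ Set.range (chart b') := ⟨w⁻¹, chart_inv hb hw⟩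
  have h := F.isAdapted ht (φ _)
  have h' := F.isAdapted ht' (φ _)
  rw [F.coeff_eq σ h, F.coeff_eq σ h']
  rw [F.trans_s1 b b' hb w hw, F.trans_r b b' hb w hw] at h'
  rw [Setup.cowt_homCoord_of_isAdapted σ (Units.mk0 w hw) h h' hy hz hl]
  congr 1
  rw [Units.val_mk0, inv_pow, ← zpow_natCast, ← zpow_neg]
  congr 1
  omega

end Manifold

/-! ### Standard sections of `𝒪(k)` -/

lemma mem_range_chart {b b' : Fin 2} (h : b ≠ b') {z : ℂ} :
    chart b z ∈ Set.range (chart b') ↔ z ≠ 0 := by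
  constructor
  · rintro ⟨w, hw⟩ rfl
    obtain ⟨a, ha⟩ := (Projectivization.mk_eq_mk_iff' ℂ _ _ _ _).mp hw
    have h1 := congrFun ha b'
    simp [affVec, h.symm] at h1
  · exact fun hz => ⟨z⁻¹, chart_inv h hz⟩

lemma isOpenP1_range_chart (b : Fin 2) : IsOpenP1 (Set.range (chart b)) := by
  intro b'
  by_cases h : b' = b
  · subst h
    have : chart b' ⁻¹' Set.range (chart b') = Set.univ := Set.eq_univ_of_forall fun z => ⟨z, rfl⟩
    rw [this]
    exact isOpen_univ
  · have : chart b' ⁻¹' Set.range (chart b) = {0}ᶜ := by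
      ext z
      exact mem_range_chart h
    rw [this]
    exact isOpen_compl_singleton

lemma isOpenP1_univ : IsOpenP1 Set.univ := fun _ => isOpen_univ

lemma exists_mem_range_chart (t : P1) : ∃ b, t ∈ Set.range (chart b) := by
  induction t using Projectivization.ind with
  | h v hv =>
  have key (b b' : Fin 2) (hb : b ≠ b') (h : v b ≠ 0) :
      Projectivization.mk ℂ v hv ∈ Set.range (chart b) := by
    refine ⟨v b' / v b, (Projectivization.mk_eq_mk_iff' ℂ _ _ _ _).mpr ⟨(v b)⁻¹, ?_⟩⟩
    ext i
    fin_cases b <;> fin_cases b' <;> fin_cases i <;> simp [affVec] at hb h ⊢ <;> field_simp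
  by_cases h0 : v 0 = 0
  · refine ⟨1, key 1 0 (by simp) fun h1 => hv (funext fun i => ?_)⟩
    fin_cases i
    · exact h0
    · exact h1
  · exact ⟨0, key 0 1 (by simp) h0⟩

/-- The section `v ↦ v_b ^ k` of `𝒪(k)`, which trivializes it over the chart `b`. -/
def coordSection (k : ℤ) (b : Fin 2) (t : P1) : (O k).E t :=
  ⟨fun v => v.1 b ^ k, fun v v' c h => by
    change v'.1 b ^ k = c ^ k * v.1 b ^ k
    rw [h, Pi.smul_apply, smul_eq_mul, mul_zpow]⟩

/-- The nonzero vector `(1, z)` or `(z, 1)` of a line. -/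
def affLineVec (b : Fin 2) (z : ℂ) : LineVec (chart b z) := ⟨affVec b z, affVec_ne_zero b z, rfl⟩

lemma exists_smul_affVec {b : Fin 2} {z : ℂ} (v : LineVec (chart b z)) :
    v.1 = v.1 b • affVec b z := by
  obtain ⟨v, hv, h⟩ := v
  obtain ⟨a, ha⟩ := (Projectivization.mk_eq_mk_iff' ℂ _ _ _ _).mp h
  have h1 := congrFun ha b
  simp only [affVec, Pi.smul_apply, if_true, smul_eq_mul, mul_one] at h1
  dsimp only
  rw [← h1, ha]

lemma eq_smul_coordSection {k : ℤ} {b : Fin 2} {z : ℂ} (s : (O k).E (chart b z)) :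
    s = s.1 (affLineVec b z) • coordSection k b (chart b z) := by
  apply Subtype.ext
  funext v
  have h := s.2 (affLineVec b z) v (v.1 b) (exists_smul_affVec v)
  rw [h, mul_comm]
  rfl

lemma coordSection_ne_zero {k : ℤ} {b : Fin 2} {t : P1} (ht : t ∈ Set.range (chart b)) :
    coordSection k b t ≠ 0 := by
  obtain ⟨z, rfl⟩ := ht
  intro h
  have h1 : affVec b z b ^ k = 0 := congrArg (fun s => s.1 (affLineVec b z)) h
  simp [affVec] at h1

lemma exists_eq_smul_coordSection {k : ℤ} {b : Fin 2} {t : P1} (ht : t ∈ Set.range (chart b))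
    (s : (O k).E t) : ∃ c : ℂ, s = c • coordSection k b t := by
  obtain ⟨z, rfl⟩ := ht
  exact ⟨_, eq_smul_coordSection s⟩

/-- With exponent `0` the section is the constant `1`, also where the coordinate `v_b` vanishes, by
the convention `0 ^ 0 = 1`. -/
lemma coordSection_zero_ne_zero (b : Fin 2) (t : P1) : coordSection 0 b t ≠ 0 := by
  obtain ⟨b', z, rfl⟩ := exists_mem_range_chart t
  intro h
  have h1 : affVec b' z b ^ (0 : ℤ) = 0 := congrArg (fun s => s.1 (affLineVec b' z)) h
  simp at h1

lemma coordSection_transition {k : ℤ} {b b' : Fin 2} (h : b ≠ b') (z : ℂ) :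
    coordSection k b' (chart b z) = z ^ k • coordSection k b (chart b z) := by
  apply Subtype.ext
  funext v
  change v.1 b' ^ k = z ^ k * v.1 b ^ k
  have h1 := congrFun (exists_smul_affVec v) b'
  rw [h1, Pi.smul_apply, smul_eq_mul, mul_zpow, mul_comm]
  simp [affVec, h.symm]

lemma isHol_coordSection (k : ℤ) (b : Fin 2) :
    (O k).IsHol (Set.range (chart b)) (coordSection k b) := by
  intro b'
  change DifferentiableOn ℂ (fun z => affVec b' z b ^ k) _
  by_cases h : b' = b
  · subst h
    simp [affVec]
  · simp only [affVec, Ne.symm h, if_false]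
    exact differentiableOn_id.zpow (Or.inl fun z hz => (mem_range_chart h).mp hz)

lemma isHol_univ_coordSection {k : ℤ} (hk : 0 ≤ k) (b : Fin 2) :
    (O k).IsHol Set.univ (coordSection k b) := by
  intro b'
  change DifferentiableOn ℂ (fun z => affVec b' z b ^ k) _
  by_cases h : b' = b
  · subst h
    simp [affVec]
  · simp only [affVec, Ne.symm h, if_false]
    exact differentiableOn_id.zpow (Or.inr hk)

lemma isHol_zero (k : ℤ) (T : Set P1) : (O k).IsHol T 0 := fun _ => differentiableOn_const 0

/-! ### Adapted trivializations along a good curve -/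

section Split

variable {B : P1Bundle} {L : ∀ t, Submodule ℂ (B.E t)}
  (e : ∀ t, B.E t ≃ₗ[ℂ] ((B.sub L).sum (O 0)).E t) (eL : ∀ t, (B.sub L).E t ≃ₗ[ℂ] (O 1).E t)

/-- The inclusion of `𝒪(1)` in a bundle with a splitting `B ≅ L ⊕ 𝒪`, `L ≅ 𝒪(1)`. -/
def inclO1 (t : P1) : (O 1).E t →ₗ[ℂ] B.E t :=
  (e t).symm.toLinearMap ∘ₗ LinearMap.inl ℂ ((B.sub L).E t) ((O 0).E t) ∘ₗ (eL t).symm.toLinearMap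

/-- The inclusion of `𝒪` in a bundle with a splitting `B ≅ L ⊕ 𝒪`. -/
def inclO0 (t : P1) : (O 0).E t →ₗ[ℂ] B.E t :=
  (e t).symm.toLinearMap ∘ₗ LinearMap.inr ℂ ((B.sub L).E t) ((O 0).E t)

lemma apply_inclO1 (t : P1) (s : (O 1).E t) : e t (inclO1 e eL t s) = ((eL t).symm s, 0) :=
  (e t).apply_symm_apply _

lemma apply_inclO0 (t : P1) (s : (O 0).E t) : e t (inclO0 e t s) = (0, s) :=
  (e t).apply_symm_apply _

lemma isHol_inclO1
    (he : ∀ (T : Set P1) (s : ∀ t, B.E t), IsOpenP1 T →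
      (B.IsHol T s ↔ ((B.sub L).sum (O 0)).IsHol T fun t => e t (s t)))
    (heL : ∀ (T : Set P1) (s : ∀ t, (B.sub L).E t), IsOpenP1 T →
      ((B.sub L).IsHol T s ↔ (O 1).IsHol T fun t => eL t (s t)))
    {T : Set P1} (hT : IsOpenP1 T) (s : ∀ t, (O 1).E t) :
    B.IsHol T (fun t => inclO1 e eL t (s t)) ↔ (O 1).IsHol T s := by
  rw [he T _ hT]
  simp only [apply_inclO1]
  have h1 : ((B.sub L).sum (O 0)).IsHol T (fun t => ((eL t).symm (s t), 0)) ↔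
      (B.sub L).IsHol T (fun t => (eL t).symm (s t)) ∧ (O 0).IsHol T 0 := Iff.rfl
  rw [h1, heL T _ hT]
  simp only [LinearEquiv.apply_symm_apply, isHol_zero, and_true]

lemma isHol_inclO0
    (he : ∀ (T : Set P1) (s : ∀ t, B.E t), IsOpenP1 T →
      (B.IsHol T s ↔ ((B.sub L).sum (O 0)).IsHol T fun t => e t (s t)))
    {T : Set P1} (hT : IsOpenP1 T) (hz : (B.sub L).IsHol T 0) {s : ∀ t, (O 0).E t}
    (hs : (O 0).IsHol T s) : B.IsHol T (fun t => inclO0 e t (s t)) := by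
  rw [he T _ hT]
  simp only [apply_inclO0]
  exact ⟨hz, hs⟩

lemma inclO1_injective (t : P1) : Function.Injective (inclO1 e eL t) := by
  intro s s' h
  have h1 := congrArg (e t) h
  rw [apply_inclO1, apply_inclO1] at h1
  exact (eL t).symm.injective (congrArg Prod.fst h1)

lemma eq_inclO1_add_inclO0 (t : P1) (q : B.E t) :
    q = inclO1 e eL t (eL t (e t q).1) + inclO0 e t (e t q).2 := by
  apply (e t).injective
  rw [map_add, apply_inclO1, apply_inclO0, LinearEquiv.symm_apply_apply]
  exact Prod.ext (add_zero _).symm (zero_add _).symm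

/-- An abstract isomorphism `B ≅ L ⊕ 𝒪` need not carry the subbundle `L` to the first summand. The
preimage of that summand is nevertheless a line subbundle of degree 1, to which the uniqueness of
`L` applies. -/
lemma isLineSubbundleOfDegree_range_inclO1
    (he : ∀ (T : Set P1) (s : ∀ t, B.E t), IsOpenP1 T →
      (B.IsHol T s ↔ ((B.sub L).sum (O 0)).IsHol T fun t => e t (s t)))
    (heL : ∀ (T : Set P1) (s : ∀ t, (B.sub L).E t), IsOpenP1 T →
      ((B.sub L).IsHol T s ↔ (O 1).IsHol T fun t => eL t (s t))) :
    B.IsLineSubbundleOfDegree (fun t => LinearMap.range (inclO1 e eL t)) 1 := by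
  constructor
  · intro t₀
    obtain ⟨b, hb⟩ := exists_mem_range_chart t₀
    refine ⟨Set.range (chart b), isOpenP1_range_chart b, hb,
      fun t => inclO1 e eL t (coordSection 1 b t),
      (isHol_inclO1 e eL he heL (isOpenP1_range_chart b) _).mpr (isHol_coordSection 1 b), ?_⟩
    intro t ht
    constructor
    · rw [← map_zero (inclO1 e eL t)]
      exact fun h => coordSection_ne_zero ht (inclO1_injective e eL t h)
    · obtain ⟨z, rfl⟩ := ht
      apply le_antisymm
      · rintro _ ⟨s, rfl⟩
        rw [eq_smul_coordSection s, map_smul]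
        exact Submodule.smul_mem _ _ (Submodule.mem_span_singleton_self _)
      · rw [Submodule.span_singleton_le_iff_mem]
        exact ⟨_, rfl⟩
  · refine ⟨fun t => (LinearEquiv.ofInjective _ (inclO1_injective e eL t)).symm, fun T s hT => ?_⟩
    rw [← isHol_inclO1 e eL he heL hT]
    have (t : P1) : inclO1 e eL t ((LinearEquiv.ofInjective _ (inclO1_injective e eL t)).symm
        (s t)) = (LinearMap.range (inclO1 e eL t)).subtype (s t) :=
      congrArg Subtype.val (LinearEquiv.apply_symm_apply
        (LinearEquiv.ofInjective _ (inclO1_injective e eL t)) (s t))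
    have h : (fun t => inclO1 e eL t ((LinearEquiv.ofInjective _ (inclO1_injective e eL t)).symm
        (s t))) = fun t => (LinearMap.range (inclO1 e eL t)).subtype (s t) := funext this
    exact Iff.of_eq (congrArg (B.IsHol T) h.symm)

end Split

/-- The holomorphic sections of `B` over each open set form a vector space. -/
structure P1Bundle.IsLinear (B : P1Bundle) : Prop where
  zero : ∀ T, B.IsHol T 0
  add : ∀ T s s', B.IsHol T s → B.IsHol T s' → B.IsHol T fun t => s t + s' t
  smul : ∀ T s (c : ℂ), B.IsHol T s → B.IsHol T fun t => c • s t

lemma exists_trivialization_line {B : P1Bundle} (hB : B.IsLinear) (h : B.Iso (O (-1))) {o : P1}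
    {b : Fin 2} (hb : o ∈ Set.range (chart b)) {u : B.E o} (hu : u ≠ 0) :
    ∃ r : Fin 2 → ∀ t, B.E t, (∀ b, B.IsHol (Set.range (chart b)) (r b)) ∧
      (∀ b, ∀ t ∈ Set.range (chart b), r b t ≠ 0) ∧
      (∀ b b', b ≠ b' → ∀ z : ℂ, z ≠ 0 → r b' (chart b z) = z⁻¹ • r b (chart b z)) ∧
      r b o = u := by
  obtain ⟨e, he⟩ := h
  obtain ⟨c, hc⟩ := exists_eq_smul_coordSection hb (e o u)
  have hc0 : c ≠ 0 := by
    rintro rfl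
    rw [zero_smul] at hc
    exact hu ((e o).injective (hc.trans (map_zero _).symm))
  refine ⟨fun b t => c • (e t).symm (coordSection (-1) b t), fun b => ?_, fun b t ht h0 => ?_,
    fun b b' hbb z hz => ?_, ?_⟩
  · refine hB.smul _ _ _ ((he _ _ (isOpenP1_range_chart b)).mpr ?_)
    simp only [LinearEquiv.apply_symm_apply]
    exact isHol_coordSection (-1) b
  · exact coordSection_ne_zero ht
      ((e t).symm.injective (((smul_eq_zero.mp h0).resolve_left hc0).trans (map_zero _).symm))
  · beta_reduce
    rw [coordSection_transition hbb, map_smul, zpow_neg_one, smul_comm]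
  · beta_reduce
    rw [← map_smul, ← hc, LinearEquiv.symm_apply_apply]

/-- The values at `o` can be prescribed: a constant factor brings the section of `𝒪(1)` to `a`, and
a multiple of a global section of `𝒪(1)` added to the section of `𝒪` brings it to any `q` outside
the line of `a`. The result still completes `𝒪(1)` to a splitting. -/
lemma exists_trivialization_plane {B : P1Bundle} (hB : B.IsLinear)
    {L : ∀ t, Submodule ℂ (B.E t)} (hL : B.IsLineSubbundleOfDegree L 1)
    (huniq : ∀ L', B.IsLineSubbundleOfDegree L' 1 → L' = L)
    (h : B.Iso ((B.sub L).sum (O 0))) {o : P1} {b : Fin 2} (hb : o ∈ Set.range (chart b))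
    {a q : B.E o} (hLo : L o = Submodule.span ℂ {a}) (hq : q ∉ Submodule.span ℂ {a}) :
    ∃ (s1 : Fin 2 → ∀ t, B.E t) (s0 : ∀ t, B.E t),
      (∀ b, B.IsHol (Set.range (chart b)) (s1 b)) ∧ B.IsHol Set.univ s0 ∧
      (∀ b, ∀ t ∈ Set.range (chart b), ∀ c c' : ℂ, c • s1 b t + c' • s0 t = 0 →
        c = 0 ∧ c' = 0) ∧
      (∀ b b', b ≠ b' → ∀ z : ℂ, z ≠ 0 → s1 b' (chart b z) = z • s1 b (chart b z)) ∧
      s1 b o = a ∧ s0 o = q := by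
  obtain ⟨-, eL, heL⟩ := hL
  obtain ⟨e, he⟩ := h
  let σ1 : Fin 2 → ∀ t, B.E t := fun b t => inclO1 e eL t (coordSection 1 b t)
  let σ0 : ∀ t, B.E t := fun t => inclO0 e t (coordSection 0 b t)
  -- Uniqueness of the degree-1 subbundle identifies the copy of `𝒪(1)` in the splitting with `L`,
  -- whose fibre at `o` is spanned by `a`.
  have hLo' : LinearMap.range (inclO1 e eL o) = Submodule.span ℂ {a} :=
    (congrFun (huniq _ (isLineSubbundleOfDegree_range_inclO1 e eL he heL)) o).trans hLo
  have hσ1 : σ1 b o ≠ 0 := by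
    rw [← map_zero (inclO1 e eL o)]
    exact fun h => coordSection_ne_zero hb (inclO1_injective e eL o h)
  have hσ1a : σ1 b o ∈ Submodule.span ℂ {a} := hLo'.le ⟨coordSection 1 b o, rfl⟩
  obtain ⟨κ, hκ⟩ := Submodule.mem_span_singleton.mp hσ1a
  have hκ0 : κ ≠ 0 := by
    rintro rfl
    exact hσ1 (hκ.symm.trans (zero_smul ℂ a))
  -- `q` is decomposed at `o` in the splitting. The coefficient `α` in `𝒪` is nonzero because `q` is
  -- not a multiple of `a`.
  obtain ⟨β, hβ⟩ := exists_eq_smul_coordSection hb (eL o (e o q).1)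
  obtain ⟨α, hα⟩ := exists_eq_smul_coordSection hb (e o q).2
  have hqq : q = β • σ1 b o + α • σ0 o := by
    have h1 := eq_inclO1_add_inclO0 e eL o q
    rw [hβ, hα, map_smul, map_smul] at h1
    exact h1
  have hα0 : α ≠ 0 := by
    rintro rfl
    refine hq ?_
    rw [hqq, zero_smul, add_zero]
    exact Submodule.smul_mem _ _ hσ1a
  have hholσ1 (b : Fin 2) {T : Set P1} (hT : IsOpenP1 T)
      (h : (O 1).IsHol T (coordSection 1 b)) : B.IsHol T (σ1 b) :=
    (isHol_inclO1 e eL he heL hT _).mpr h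
  -- The index `b` in the second section is the fixed chart around `o`: the section `v ↦ v_b` of
  -- `𝒪(1)` extends to all of `ℙ¹`, so `s0` is global.
  refine ⟨fun b t => κ⁻¹ • σ1 b t, fun t => β • σ1 b t + α • σ0 t, fun b => hB.smul _ _ _
    (hholσ1 b (isOpenP1_range_chart b) (isHol_coordSection 1 b)),
    hB.add _ _ _
      (hB.smul _ _ β (hholσ1 b isOpenP1_univ (isHol_univ_coordSection zero_le_one b)))
      (hB.smul _ _ α (isHol_inclO0 e he isOpenP1_univ (hB.zero _)
        (isHol_univ_coordSection le_rfl b))), ?_, ?_, ?_, hqq.symm⟩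
  · intro b' t ht c c' h0
    have e1 (b : Fin 2) : (e t (σ1 b t)).2 = 0 := congrArg Prod.snd (apply_inclO1 e eL t _)
    have e0 : (e t (σ0 t)).2 = coordSection 0 b t := congrArg Prod.snd (apply_inclO0 e t _)
    -- The projection to `𝒪` kills the sections of `𝒪(1)` and maps `s0` to a nowhere zero section,
    -- which gives `c' = 0`.
    let π : B.E t →ₗ[ℂ] (O 0).E t :=
      LinearMap.snd ℂ ((B.sub L).E t) ((O 0).E t) ∘ₗ (e t).toLinearMap
    have h1 := congrArg π h0
    have p1 (b : Fin 2) : π (σ1 b t) = 0 := e1 b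
    have p0 : π (σ0 t) = coordSection 0 b t := e0
    simp only [map_add, map_smul, p1, p0, smul_zero, zero_add, map_zero, smul_smul,
      smul_eq_zero, mul_eq_zero, hα0, or_false, coordSection_zero_ne_zero b t] at h1
    refine ⟨?_, h1⟩
    rw [h1, zero_smul, add_zero, smul_smul] at h0
    have h3 : inclO1 e eL t ((c * κ⁻¹) • coordSection 1 b' t) = 0 := by
      rw [map_smul]; exact h0
    have h4 := inclO1_injective e eL t (h3.trans (map_zero _).symm)
    rw [smul_eq_zero] at h4
    exact (mul_eq_zero.mp (h4.resolve_right (coordSection_ne_zero ht))).resolve_right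
      (inv_ne_zero hκ0)
  · intro b b' hbb z hz
    have h1 : σ1 b' (chart b z) = z • σ1 b (chart b z) := by
      simp only [σ1]
      rw [coordSection_transition hbb, map_smul, zpow_one]
    beta_reduce
    rw [h1, smul_comm]
  · change κ⁻¹ • σ1 b o = a
    rw [← hκ, inv_smul_smul₀ hκ0]

section Manifold

variable {M : Type*} [TopologicalSpace M] [ChartedSpace Model M] [IsManifold 𝓘(ℂ, Model) ω M]

/-- The predicate `IsHol` of a `P1Bundle` carries no axioms, so the operations on sections used
above have to be justified for pull-backs. -/
lemma isLinear_pull {D : ∀ x : M, Submodule ℂ (TangentSpace 𝓘(ℂ, Model) x)} (A : G0Structure D)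
    {U : Type} [AddCommGroup U] [Module ℂ U] (ρ : Representation ℂ G0 U) (f : P1 → M) :
    (A.pull ρ f).IsLinear where
  zero _ _ _ _ l _ := (differentiableOn_const 0).congr fun _ _ => map_zero l
  add _ _ _ h h' N φ hφ l b :=
    ((h N φ hφ l b).add (h' N φ hφ l b)).congr fun _ _ => map_add l _ _
  smul _ _ c h N φ hφ l b := ((h N φ hφ l b).const_mul c).congr fun _ _ => map_smul l _ _

lemma factorsLevi_repR : FactorsLevi repR := fun g g' h => LinearMap.ext fun u => by
  rw [repR_apply, repR_apply, h]

/-- The frame `p` is given in advance, with the sole condition that `a` is its first basis vector of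
`W`; the trivializations are then chosen to match it at `o`. This freedom lets one frame be used
with two curves. -/
theorem Setup.IsGoodCurve.exists_curveFrame {S : Setup M} {o : P1} {f : P1 → M}
    {a : S.V (-1) (f o)} (h : S.IsGoodCurve o (f o) a f) {p : S.A.fiber (f o)}
    (hp : wCoord (a.1 p) = Pi.single 0 1) :
    ∃ (F : S.CurveFrame f) (b : Fin 2), o ∈ Set.range (chart b) ∧
      S.IsAdapted p (F.s1 b o) (F.s0 o) (F.r b o) := by
  obtain ⟨-, hx, -, hR, L, hL, huniq, hiso, hLo⟩ := h
  obtain ⟨b, hb⟩ := exists_mem_range_chart o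
  obtain ⟨w, hw⟩ := wCoord_surjective (Pi.single 1 1)
  obtain ⟨q, hq⟩ := G0Structure.evalAt_surjective (factorsLevi_repV (-1)) p w
  have hqp : wCoord (q.1 p) = Pi.single 1 1 := (congrArg wCoord hq).trans hw
  obtain ⟨u, hu⟩ := G0Structure.evalAt_surjective factorsLevi_repR p (1 : ℂ)
  have hu0 : u ≠ 0 := by
    rintro rfl
    rw [map_zero] at hu
    exact zero_ne_one hu
  have hqa : q ∉ Submodule.span ℂ {a} := by
    rw [Submodule.mem_span_singleton]
    rintro ⟨c, rfl⟩
    have h1 : wCoord ((c • a).1 p) = c • wCoord (a.1 p) := map_smul wCoord c (a.1 p)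
    rw [h1, hp] at hqp
    have h2 := congrFun hqp 1
    simp at h2
  obtain ⟨r, hr1, hr2, hr3, hr4⟩ :=
    exists_trivialization_line (isLinear_pull S.A repR f) hR hb hu0
  obtain ⟨s1, s0, h1, h2, h3, h4, h5, h6⟩ := exists_trivialization_plane
    (isLinear_pull S.A (repV (-1)) f) hL huniq hiso hb (a := a) (q := q) hLo hqa
  refine ⟨⟨s1, s0, r, h1, h2, hr1, h3, hr2, h4, hr3⟩, b, hb, ?_, ?_, ?_⟩
  · dsimp only
    rw [h5, hp]
  · dsimp only
    rw [h6, hqp]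
  · dsimp only
    rw [hr4]
    exact hu

end Manifold

/-! ### Vanishing at the points of two curves -/

/-- The element of `GL(R) × GL(W)` that exchanges the basis vectors of `W`. -/
def swapLevi : Levi :=
  (1, ⟨!![0, 1; 1, 0], !![0, 1; 1, 0], by simp [Matrix.one_fin_two], by simp [Matrix.one_fin_two]⟩)

lemma swapLevi_val : (swapLevi.2 : Matrix (Fin 2) (Fin 2) ℂ) = !![0, 1; 1, 0] := rfl

lemma swapLevi_mul_self : swapLevi * swapLevi = 1 := by
  refine Prod.ext (by simp [swapLevi]) (Units.ext ?_)
  rw [Prod.snd_mul, Units.val_mul, swapLevi_val]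
  simp [Matrix.one_fin_two]

lemma tor_mul_swapLevi (r a b : ℂˣ) : tor r a b * swapLevi = swapLevi * tor r b a := by
  refine Prod.ext (by simp [swapLevi, tor]) (Units.ext ?_)
  rw [Prod.snd_mul, Units.val_mul, Prod.snd_mul, Units.val_mul, swapLevi_val, tor, tor, diagGL_val,
    diagGL_val]
  ext i j
  fin_cases i <;> fin_cases j <;> simp

lemma repLevi_swapLevi_self (y : GSum) : repLevi swapLevi (repLevi swapLevi y) = y := by
  rw [← Module.End.mul_apply, ← map_mul, swapLevi_mul_self, map_one]
  rfl

lemma repLevi_tor_swapLevi (r a b : ℂˣ) (y : GSum) :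
    repLevi (tor r a b) (repLevi swapLevi y) = repLevi swapLevi (repLevi (tor r b a) y) := by
  rw [← Module.End.mul_apply, ← map_mul, tor_mul_swapLevi, map_mul, Module.End.mul_apply]

lemma IsWt.swap {m n n' : ℤ} {y : GSum} (h : IsWt m n n' y) :
    IsWt m n' n (repLevi swapLevi y) := by
  constructor
  · intro r a b
    rw [repLevi_tor_swapLevi, h.1, map_smul]
    congr 1
    ring
  · rw [← repLevi_degSum, h.2, map_smul, sub_right_comm]

lemma IsCowt.swap {m n n' : ℤ} {l : Module.Dual ℂ GSum} (h : IsCowt m n n' l) :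
    IsCowt m n' n (l ∘ₗ repLevi swapLevi) := by
  constructor
  · intro r a b x
    rw [LinearMap.comp_apply, LinearMap.comp_apply, ← repLevi_tor_swapLevi, h.1]
    ring
  · intro x
    rw [LinearMap.comp_apply, LinearMap.comp_apply, repLevi_degSum, h.2, sub_right_comm]

section Manifold

variable {M : Type*} [TopologicalSpace M] [ChartedSpace Model M] [IsManifold 𝓘(ℂ, Model) ω M]
  {S : Setup M} {i j k : ℤ} {σ : ∀ x : M, S.wedge i j x →ₗ[ℂ] S.VL k x}

lemma Setup.IsGoodCurve.cowt_homCoord_eq_zero (hσ : S.IsHolHom σ) {o : P1} {x : M}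
    {a : S.V (-1) x} {f : P1 → M} (h : S.IsGoodCurve o x a f) {p : S.A.fiber x}
    (hp : wCoord (a.1 p) = Pi.single 0 1) {y z : GSum} {l : Module.Dual ℂ GSum}
    {m₁ n₁ n₁' m₂ n₂ n₂' m n n' : ℤ} (hy : IsWt m₁ n₁ n₁' y) (hz : IsWt m₂ n₂ n₂' z)
    (hl : IsCowt m n n' l) (hlt : n - m < (n₁ - m₁) + (n₂ - m₂)) :
    l (S.homCoord (σ x) p y z) = 0 := by
  obtain ⟨hf, hx, -⟩ := id h
  subst hx
  obtain ⟨F, b, hb, hF⟩ := h.exists_curveFrame hp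
  exact F.cowt_homCoord_eq_zero σ hf hσ hb hF hy hz hl hlt

/-- The exchange of `e₀` and `e₁` transforms a curve in the direction of the second basis vector
into one in the direction of the first, and interchanges `n` and `n'` in all weights. -/
lemma Setup.IsGoodCurve.cowt_homCoord_eq_zero_swap (hσ : S.IsHolHom σ) {o : P1} {x : M}
    {a : S.V (-1) x} {f : P1 → M} (h : S.IsGoodCurve o x a f) {p : S.A.fiber x}
    (hp : wCoord (a.1 p) = Pi.single 1 1) {y z : GSum} {l : Module.Dual ℂ GSum}
    {m₁ n₁ n₁' m₂ n₂ n₂' m n n' : ℤ} (hy : IsWt m₁ n₁ n₁' y) (hz : IsWt m₂ n₂ n₂' z)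
    (hl : IsCowt m n n' l) (hlt : n' - m < (n₁' - m₁) + (n₂' - m₂)) :
    l (S.homCoord (σ x) p y z) = 0 := by
  set g : G0 := SemidirectProduct.inr swapLevi with hg
  have hgr : g.right = swapLevi := rfl
  have hp' : wCoord (a.1 (S.A.act p g)) = Pi.single 0 1 := by
    apply GL_mulVec_injective g.right.2
    rw [← wCoord_rep, G0Structure.assoc_act, hp, hgr, swapLevi_val]
    ext c
    fin_cases c <;> simp
  have h1 := h.cowt_homCoord_eq_zero hσ hp' hy.swap hz.swap hl.swap hlt
  have h2 := S.homCoord_act (σ x) p g (repLevi swapLevi y) (repLevi swapLevi z)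
  rw [hgr, repLevi_swapLevi_self, repLevi_swapLevi_self] at h2
  rw [← h2]
  exact h1

/-- For each matrix coefficient the degrees along the two curves add up to `i + j - k < 0`, so one
of them is negative and the corresponding curve forces the coefficient to vanish. -/
lemma Setup.eq_zero_of_isGoodCurve (hσ : S.IsHolHom σ) (hk : i + j + 1 ≤ k) {o : P1} {x : M}
    {a a' : S.V (-1) x} {f f' : P1 → M} (h : S.IsGoodCurve o x a f) (h' : S.IsGoodCurve o x a' f')
    {p : S.A.fiber x} (hp : wCoord (a.1 p) = Pi.single 0 1)
    (hp' : wCoord (a'.1 p) = Pi.single 1 1) : σ x = 0 := by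
  apply S.eq_zero_of_homCoord (σ x) p
  have key : ∀ y ∈ wtVectors, ∀ z ∈ wtVectors, S.homCoord (σ x) p y z = 0 := by
    rintro y ⟨m₁, n₁, n₁', hy⟩ z ⟨m₂, n₂, n₂', hz⟩
    by_cases hi : i = 2 * m₁ - n₁ - n₁'
    swap
    -- `homCoord` is defined on all of `𝔤` through the projections to degrees `i` and `j`, so weight
    -- vectors of other degrees contribute nothing.
    · rw [S.homCoord_apply, S.ofG_eq_zero p hy.2 hi, S.wedgeMk_zero_left, map_zero, map_zero]
    by_cases hj : j = 2 * m₂ - n₂ - n₂'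
    swap
    · rw [S.homCoord_apply, S.ofG_eq_zero p hz.2 hj, S.wedgeMk_zero_right, map_zero, map_zero]
    refine eq_zero_of_isCowt _ fun m n n' l hl => ?_
    by_cases hkl : k = 2 * m - n - n'
    · by_cases hlt : n - m < (n₁ - m₁) + (n₂ - m₂)
      · exact h.cowt_homCoord_eq_zero hσ hp hy hz hl hlt
      -- The first degree is nonnegative here and the sum of the two is `i + j - k ≤ -1`, so the
      -- second one is negative.
      · exact h'.cowt_homCoord_eq_zero_swap hσ hp' hy hz hl (by omega)
    -- The values of `homCoord` have degree `k`, and a form of another degree kills them.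
    · have h1 := hl.2 (S.homCoord (σ x) p y z)
      rw [S.degSum_homCoord, map_smul, smul_eq_mul, ← sub_eq_zero, ← sub_mul, mul_eq_zero,
        sub_eq_zero, Int.cast_inj] at h1
      exact h1.resolve_left hkl
  refine LinearMap.ext_on span_wtVectors fun y hy => ?_
  exact LinearMap.ext_on span_wtVectors fun z hz => key y hy z hz

/-! ### Two independent vectors in an open set -/

lemma exists_det_colMatrix_ne_zero {w : W} (hw : w ≠ 0) : ∃ w', (colMatrix w w').det ≠ 0 := by
  by_cases h0 : w 0 = 0
  · refine ⟨Pi.single 0 1, ?_⟩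
    have h1 : w 1 ≠ 0 := fun h1 => hw (funext fun c => by fin_cases c <;> assumption)
    simpa [colMatrix, Matrix.det_fin_two] using h1
  · refine ⟨Pi.single 1 1, ?_⟩
    simpa [colMatrix, Matrix.det_fin_two] using h0

/-- Openness is tested on linear maps from `ℂⁿ`. The map `(u, v) ↦ u a + v b` restricted to `u = 1`
shows that all small `c` are admissible, and some of them are nonzero. -/
lemma exists_ne_zero_add_smul_mem {E : Type*} [AddCommGroup E] [Module ℂ E] {s : Set E}
    (hs : IsEuclideanOpen s) {a : E} (ha : a ∈ s) (b : E) : ∃ c : ℂ, c ≠ 0 ∧ a + c • b ∈ s := by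
  let e : (Fin 2 → ℂ) →ₗ[ℂ] E :=
    (LinearMap.proj 0).smulRight a + (LinearMap.proj 1).smulRight b
  have he (c : ℂ) : e ![1, c] = a + c • b := by simp [e]
  have hcont : Continuous fun c : ℂ => (![1, c] : Fin 2 → ℂ) := by fun_prop
  have hopen : IsOpen {c : ℂ | a + c • b ∈ s} := by
    have h := (hs 2 e).preimage hcont
    simpa only [Set.preimage, Set.mem_ofPred_eq, he] using h
  have h0 : {c : ℂ | a + c • b ∈ s} ∈ nhds (0 : ℂ) := hopen.mem_nhds (by simpa using ha)
  have h1 : ∃ᶠ c : ℂ in nhds 0, c ≠ 0 := by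
    exact mem_closure_iff_frequently.mp (dense_compl_singleton (0 : ℂ) 0)
  exact (h1.and_eventually h0).exists

/-- An open set that contains a nonzero `a` also contains some `a + c b` independent of `a`; the two
curves are those of these vectors. -/
lemma Setup.eq_zero_of_mem (hσ : S.IsHolHom σ) (hk : i + j + 1 ≤ k) {o : P1} {x : M}
    {s : Set (S.V (-1) x)} (hs : IsEuclideanOpen s) (hne : s.Nonempty) (h0 : (0 : S.V (-1) x) ∉ s)
    (hc : ∀ a ∈ s, ∃ f : P1 → M, S.IsGoodCurve o x a f) : σ x = 0 := by
  obtain ⟨a, ha⟩ := hne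
  obtain ⟨N, φ, -, -⟩ := S.exists_section x
  set p := φ x
  have hw : wCoord (a.1 p) ≠ 0 := by
    intro hw
    have h1 : a.1 p = 0 := wCoord_injective (hw.trans (map_zero _).symm)
    have h2 : a = 0 := G0Structure.evalAt_injective p (h1.trans (map_zero _).symm)
    exact h0 (h2 ▸ ha)
  obtain ⟨w', hw'⟩ := exists_det_colMatrix_ne_zero hw
  obtain ⟨v, rfl⟩ := wCoord_surjective w'
  obtain ⟨b, rfl⟩ := G0Structure.evalAt_surjective (factorsLevi_repV (-1)) p v
  obtain ⟨c, hc0, hcs⟩ := exists_ne_zero_add_smul_mem hs ha b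
  -- Any nonzero element of `R` would do: the normalization of `R` at `x` plays no role for the two
  -- curves.
  obtain ⟨r, hr⟩ := G0Structure.evalAt_surjective factorsLevi_repR p (1 : ℂ)
  have hr0 : r.1 p ≠ 0 := hr.trans_ne one_ne_zero
  have hadd : wCoord ((a + c • b).1 p) =
      wCoord (a.1 p) + c • wCoord (G0Structure.evalAt (repV (-1)) p b) := by
    rw [← map_smul, ← map_add]
    rfl
  have hd : (colMatrix (wCoord (a.1 p)) (wCoord ((a + c • b).1 p))).det ≠ 0 := by
    rw [hadd]
    have h1 := mul_ne_zero hc0 hw'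
    simp only [colMatrix, Matrix.det_fin_two, Matrix.of_apply, Matrix.cons_val_zero,
      Matrix.cons_val_one, Pi.add_apply, Pi.smul_apply, smul_eq_mul] at h1 ⊢
    convert h1 using 1
    ring
  have had := S.isAdapted_act p (s1 := a) (s0 := a + c • b) hr0 hd
  obtain ⟨f, hf⟩ := hc a ha
  obtain ⟨f', hf'⟩ := hc _ hcs
  exact Setup.eq_zero_of_isGoodCurve hσ hk hf hf' had.1 had.2.1

/-! ### Density of Zariski-open subsets -/

/-- The identity theorem in the chart at `x`: `h` is analytic on a small ball around `x`, and the
open set `V`, having `x` in its closure, meets that ball. -/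
lemma IsHolFun.eventually_eq_zero {h : M → ℂ} {N V : Set M} (hN : IsOpen N) (hh : IsHolFun h N)
    (hV : IsOpen V) (h0 : ∀ y ∈ V ∩ N, h y = 0) {x : M} (hx : x ∈ N) (hxV : x ∈ closure V) :
    ∀ᶠ y in nhds x, h y = 0 := by
  set e := extChartAt 𝓘(ℂ, Model) x with he
  set T : Set Model := e.target ∩ e.symm ⁻¹' N with hT
  have hTo : IsOpen T :=
    (continuousOn_extChartAt_symm x).isOpen_inter_preimage (isOpen_extChartAt_target x) hN
  have hg : ContDiffOn ℂ ω (h ∘ e.symm) T := by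
    rw [← contMDiffOn_iff_contDiffOn]
    exact ContMDiffOn.comp hh ((contMDiffOn_extChartAt_symm x).mono Set.inter_subset_left)
      fun y hy => hy.2
  have hxT : e x ∈ T := ⟨mem_extChartAt_target x, by
    rw [Set.mem_preimage, extChartAt_to_inv]; exact hx⟩
  obtain ⟨ε, hε, hball⟩ := Metric.isOpen_iff.mp hTo _ hxT
  have hana : AnalyticOnNhd ℂ (h ∘ e.symm) (Metric.ball (e x) ε) := fun y hy =>
    (hg.contDiffAt (hTo.mem_nhds (hball hy))).analyticAt
  have hnhds : e.source ∩ e ⁻¹' Metric.ball (e x) ε ∈ nhds x :=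
    Filter.inter_mem (extChartAt_source_mem_nhds x)
      ((continuousAt_extChartAt x).preimage_mem_nhds (Metric.ball_mem_nhds _ hε))
  obtain ⟨y, ⟨hys, hyb⟩, hyV⟩ := mem_closure_iff_nhds.mp hxV _ hnhds
  have hev : (h ∘ e.symm) =ᶠ[nhds (e y)] 0 := by
    have hc : ContinuousAt e.symm (e y) :=
      (continuousOn_extChartAt_symm x).continuousAt
        ((isOpen_extChartAt_target x).mem_nhds (hball hyb).1)
    have hyy : e.symm (e y) = y := e.left_inv hys
    filter_upwards [hTo.mem_nhds (hball hyb), hc.preimage_mem_nhds (hV.mem_nhds (hyy.symm ▸ hyV))]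
      with w hw hwV
    exact h0 _ ⟨hwV, hw.2⟩
  have hz := hana.eqOn_zero_of_preconnected_of_eventuallyEq_zero
    (convex_ball (e x) ε).isPreconnected hyb hev
  filter_upwards [hnhds] with w hw
  have h1 := hz hw.2
  rwa [Function.comp_apply, e.left_inv hw.1] at h1

/-- The interior of the complement is also closed: near a point of its closure the local equations
vanish identically by the identity theorem. By connectedness it is empty or everything, and the
latter is excluded by a point of `M'`. -/
lemma IsZariskiOpen.dense [PreconnectedSpace M] {M' : Set M} (h : IsZariskiOpen M')
    (hne : M'.Nonempty) : Dense M' := by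
  have hcl : IsClosed (interior M'ᶜ) := by
    refine isClosed_of_closure_subset fun x hx => ?_
    obtain ⟨N, hN, hxN, n, g, hg, hZ⟩ := h x
    rw [mem_interior_iff_mem_nhds]
    have hev (c : Fin n) : ∀ᶠ y in nhds x, g c y = 0 := by
      refine (hg c).eventually_eq_zero hN isOpen_interior (fun y hy => ?_) hxN hx
      have : y ∈ M'ᶜ ∩ N := ⟨interior_subset hy.1, hy.2⟩
      rw [hZ] at this
      exact this.2 c
    filter_upwards [Filter.eventually_all.mpr hev, hN.mem_nhds hxN] with y hy hyN
    have : y ∈ M'ᶜ ∩ N := by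
      rw [hZ]
      exact ⟨hyN, hy⟩
    exact this.1
  rcases isClopen_iff.mp ⟨hcl, isOpen_interior⟩ with h0 | h1
  · rw [interior_eq_empty_iff_dense_compl, compl_compl] at h0
    exact h0
  · obtain ⟨x, hx⟩ := hne
    exact absurd hx (interior_subset (h1 ▸ Set.mem_univ x : x ∈ interior M'ᶜ))

/-- In a local holomorphic section of `A` the coefficients of `σ` are continuous, so the set where
one of them is nonzero is open and would meet `M'`. -/
lemma Setup.IsHolHom.eq_zero_of_dense (hσ : S.IsHolHom σ) {M' : Set M} (hM' : Dense M')
    (h : ∀ x ∈ M', σ x = 0) (x : M) : σ x = 0 := by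
  obtain ⟨N, φ, hx, hφ⟩ := S.exists_section x
  refine S.eq_zero_of_homCoord (σ x) (φ x) (LinearMap.ext₂ fun y z => ?_)
  refine (Module.forall_dual_apply_eq_zero_iff ℂ _).mp fun l => ?_
  have hc : ContinuousOn (fun x => l (S.homCoord (σ x) (φ x) y z)) N :=
    ContMDiffOn.continuousOn (hσ.isHolFun hφ y z l)
  by_contra hne
  have hopen := hc.isOpen_inter_preimage hφ.1 (isOpen_compl_singleton (x := (0 : ℂ)))
  obtain ⟨x', ⟨-, hx'⟩, hx''⟩ := hM'.inter_open_nonempty _ hopen ⟨x, hx, hne⟩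
  refine hx' ?_
  change l (S.homCoord (σ x') (φ x') y z) = 0
  rw [S.homCoord_apply, h x' hx'', LinearMap.zero_apply, map_zero, map_zero]

end Manifold

end

end G2Horo

open G2Horo
theorem mainTheorem5 {M : Type*} [TopologicalSpace M] [T2Space M] [ConnectedSpace M]
    [ChartedSpace Model M] [IsManifold 𝓘(ℂ, Model) ω M]
    (S : Setup M) (o : P1) (hS : S.HasRationalCurves o)
    (i j k : ℤ) (hi : i < 0) (hj : j < 0) (hk : i + j + 1 ≤ k)
    (σ : ∀ x : M, S.wedge i j x →ₗ[ℂ] S.VL k x) (hσ : S.IsHolHom σ) :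
    ∀ x : M, σ x = 0 := by
  obtain ⟨M', hM', hne, Wo, hWo⟩ := hS
  refine hσ.eq_zero_of_dense (hM'.dense hne) fun x hx => ?_
  obtain ⟨h1, h2, h3, h4⟩ := hWo x hx
  exact Setup.eq_zero_of_mem hσ hk h1 h2 h3 h4
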